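/- Let $M$ be a smooth manifold without boundary (Hausdorff, second countable), let $k\in\{1,2,\dots\}\cup\{\infty\}$, let $\mathcal F$ be a foliation of $M$ of class $C^{k+2}$ and codimension $q\ge 1$, with normal bundle $\nu(\mathcal F)=TM/T\mathcal F$. Let $g$ be a pseudo-Riemannian metric of class $C^{k+1}$ on $M$ which (a) is $\mathcal F$-bundle-like: $g|_{T\mathcal F}$ is non-degenerate and $L_X(g|_{T\mathcal F^\perp})=0$ for every vector field $X$ tangent to $\mathcal F$, i.e. $X\cdot g(Y,Z)=g([X,Y],Z)+g(Y,[X,Z])$ for all sections $Y,Z$ of $T\mathcal F^\perp$; (b) is transversely Lorentzian: the scalar product that $g$ induces on $\nu(\mathcal F)\cong T\mathcal F^\perp$ has signature $(-,+,\dots,+)$ (with $q-1$ plus signs); (c) makes the orthogonal distribution geodesically complete: for all $x\in M$ and $v\in T_x\mathcal F^\perp$ the geodesic of $g$ with initial velocity $v$ is defined on all of $\mathbb R$. Let $\operatorname{Lor}(\mathcal F)$ be the Lorentzian transverse frame bundle, i.e. the $\mathrm O(1,q-1)$-principal bundle over $M$ whose points over $x$ are the linear isometries $z:\mathbb R^{1,q-1}\to\nu_x(\mathcal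 F)$, and let $\mathcal F^1$ be the lifted foliation on $\operatorname{Lor}(\mathcal F)$: it has the same dimension as $\mathcal F$, and if $y:U\to\mathbb R^q$ is a submersion on an open set $U\subset M$ whose fibres are the plaques of $\mathcal F$ in $U$, then, writing $\overline{d_xy}:\nu_x(\mathcal F)\to\mathbb R^q$ for the induced isomorphism, the leaf of $\mathcal F^1$ through a frame $z$ over $x_0\in U$ is given near $z$ by the frames $\overline{d_xy}^{\,-1}\circ\overline{d_{x_0}y}\circ z$, where $x$ is in the plaque of $x_0$. Then $\mathcal F$ is transversely complete, that is, $\mathcal F^1$ is a complete transversely parallelizable foliation of $N=\operatorname{Lor}(\mathcal F)$. Explicitly, call a $C^k$ vector field $Y$ on $N$ basic if $[X,Y]$ is tangent to $\mathcal F^1$ for every $C^k$ vector field $X$ on $N$ tangent to $\mathcal F^1$. Then: 1. there is a tuple of basic vector fields on $N$ which at every point $z\in N$ form a basis of a complement of $T_z\mathcal F^1$ in $T_zN$; 2. for every $z\in N$, some of the values at $z$ of the complete basic vector fields on $N$ span a complement of $T_z\mathcal F^1$ in $T_zN$. -/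

import Mathlib

open scoped Manifold ContDiff Topology
open Bundle Set VectorField

noncomputable section

/-! ### Vector fields on an embedded submanifold and complete transversely parallelizable foliations

`P` is a manifold, `S ⊆ P` is (the underlying set of) a closed embedded submanifold, and a foliation
of `S` is given by its tangent distribution `D` (only the values `D p` with `p ∈ S` matter).
A `C^k` vector field on the closed submanifold `S` is the restriction of a `C^k` vector field of `P`
which is tangent to `S` at the points of `S`; the Lie bracket of two such fields is tangent to `S`
and, along `S`, depends only on the restrictions to `S`. -/

section Submanifold

variable {E' : Type*} [NormedAddCommGroup E'] [NormedSpace ℝ E']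
  {H' : Type*} [TopologicalSpace H'] (I' : ModelWithCorners ℝ E' H')
  {P : Type*} [TopologicalSpace P] [ChartedSpace H' P]

/-- The tangent space `T_p S ⊆ T_p P`: the velocities at `p` of the `C^1` curves of `P` lying in
`S`. -/
def submanifoldTangent (S : Set P) (p : P) : Set (TangentSpace I' p) :=
  {v | ∃ c : ℝ → P, ContMDiffAt 𝓘(ℝ, ℝ) I' 1 c 0 ∧ (∀ᶠ t in 𝓝 (0 : ℝ), c t ∈ S) ∧
    (⟨c 0, mfderiv 𝓘(ℝ, ℝ) I' c 0 (1 : ℝ)⟩ : TangentBundle I' P) = ⟨p, v⟩}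

variable [IsManifold I' 1 P]

/-- `Y` is a vector field of class `C^k` on the submanifold `S`. -/
def IsVectorFieldOn (k : WithTop ℕ∞) (S : Set P) (Y : ∀ p : P, TangentSpace I' p) : Prop :=
  ContMDiff I' I'.tangent k (fun p => (⟨p, Y p⟩ : TangentBundle I' P)) ∧
    ∀ p ∈ S, Y p ∈ submanifoldTangent I' S p

/-- `Y` is a basic (foliated) vector field of class `C^k` on `S`: `[X, Y]` is tangent to the
foliation for all vector fields `X` on `S` which are tangent to the foliation. -/
def IsBasicField (k : WithTop ℕ∞) (S : Set P) (D : ∀ p : P, Submodule ℝ (TangentSpace I' p))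
    (Y : ∀ p : P, TangentSpace I' p) : Prop :=
  IsVectorFieldOn I' k S Y ∧
    ∀ X : ∀ p : P, TangentSpace I' p, IsVectorFieldOn I' k S X → (∀ p ∈ S, X p ∈ D p) →
      ∀ p ∈ S, mlieBracket I' X Y p ∈ D p

/-- `Y` is complete on `S`: through every point of `S` there is an integral curve of `Y` in `S` that
is defined for all times. -/
def IsCompleteField (S : Set P) (Y : ∀ p : P, TangentSpace I' p) : Prop :=
  ∀ p ∈ S, ∃ c : ℝ → P, c 0 = p ∧ (∀ t, c t ∈ S) ∧ IsMIntegralCurve c Y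

/-- The family of vectors `v` at `p` is made of vectors spanning a complement of `D p` in `T_p S`. -/
def SpansComplement (S : Set P) (D : ∀ p : P, Submodule ℝ (TangentSpace I' p)) (p : P)
    (V : Set (TangentSpace I' p)) : Prop :=
  D p ⊓ Submodule.span ℝ V = ⊥ ∧
    ((D p ⊔ Submodule.span ℝ V : Submodule ℝ (TangentSpace I' p)) : Set (TangentSpace I' p)) =
      submanifoldTangent I' S p

/-- Transversely parallelizable foliation: there is a transverse parallelism, that is a tuple of
basic vector fields which at every point form a basis of a complement of the tangent space of the
foliation. -/
def IsTransverselyParallelizable (k : WithTop ℕ∞) (S : Set P)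
    (D : ∀ p : P, Submodule ℝ (TangentSpace I' p)) : Prop :=
  ∃ (d : ℕ) (X : Fin d → ∀ p : P, TangentSpace I' p),
    (∀ i, IsBasicField I' k S D (X i)) ∧
    ∀ p ∈ S, LinearIndependent ℝ (fun i => X i p) ∧
      SpansComplement I' S D p (range fun i => X i p)

/-- Complete transversely parallelizable foliation: it is transversely parallelizable and, at each
point, there are values of complete basic vector fields spanning a complement of the tangent space
of the foliation. -/
def IsCompleteTransverselyParallelizable (k : WithTop ℕ∞) (S : Set P)
    (D : ∀ p : P, Submodule ℝ (TangentSpace I' p)) : Prop :=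
  IsTransverselyParallelizable I' k S D ∧
    ∀ p ∈ S, ∃ V ⊆ {v | ∃ Y, IsBasicField I' k S D Y ∧ IsCompleteField I' S Y ∧ Y p = v},
      SpansComplement I' S D p V

end Submanifold

/-! ### Foliations and pseudo-Riemannian metrics -/

section Foliation

variable (n : ℕ) (M : Type*) [TopologicalSpace M] [ChartedSpace (EuclideanSpace ℝ (Fin n)) M]

/-- A foliation of class `C^s` and codimension `q` on `M`, given by its tangent distribution: locally
the leaves are the fibres of a `C^s` submersion to `ℝ^q`. -/
structure Foliation (q : ℕ) (s : WithTop ℕ∞) where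
  /-- The tangent space of the leaf through `x`. -/
  tangent : ∀ x : M, Submodule ℝ (TangentSpace (𝓡 n) x)
  exists_submersion : ∀ x₀ : M, ∃ (U : Set M) (y : M → EuclideanSpace ℝ (Fin q)),
    IsOpen U ∧ x₀ ∈ U ∧ ContMDiffOn (𝓡 n) (𝓡 q) s y U ∧
      ∀ x ∈ U, Function.Surjective (mfderiv (𝓡 n) (𝓡 q) y x) ∧
        ∀ u : TangentSpace (𝓡 n) x, u ∈ tangent x ↔ mfderiv (𝓡 n) (𝓡 q) y x u = 0

variable [IsManifold (𝓡 n) ∞ M]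

/-- A pseudo-Riemannian metric of class `C^r` on `M`. -/
structure PseudoRiemannianMetric (r : WithTop ℕ∞) where
  /-- The scalar product on the tangent space at `x`. -/
  val : ∀ x : M, TangentSpace (𝓡 n) x →L[ℝ] TangentSpace (𝓡 n) x →L[ℝ] ℝ
  symm : ∀ (x : M) (u v : TangentSpace (𝓡 n) x), val x u v = val x v u
  nondegenerate : ∀ (x : M) (u : TangentSpace (𝓡 n) x), (∀ v, val x u v = 0) → u = 0
  contMDiff : ContMDiff (𝓡 n)
    ((𝓡 n).prod 𝓘(ℝ, EuclideanSpace ℝ (Fin n) →L[ℝ] EuclideanSpace ℝ (Fin n) →L[ℝ] ℝ)) r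
    (fun x => TotalSpace.mk'
      (EuclideanSpace ℝ (Fin n) →L[ℝ] EuclideanSpace ℝ (Fin n) →L[ℝ] ℝ)
      (E := fun x : M => TangentSpace (𝓡 n) x →L[ℝ] TangentSpace (𝓡 n) x →L[ℝ] ℝ) x (val x))

end Foliation

section Metric

variable {n : ℕ} {M : Type*} [TopologicalSpace M] [ChartedSpace (EuclideanSpace ℝ (Fin n)) M]
  [IsManifold (𝓡 n) ∞ M] {q : ℕ} {r s : WithTop ℕ∞}

namespace PseudoRiemannianMetric

/-- The scalar product of `g` read in the preferred chart around `x₀`. -/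
def inChart (g : PseudoRiemannianMetric n M r) (x₀ : M) (y u v : EuclideanSpace ℝ (Fin n)) : ℝ :=
  g.val ((extChartAt (𝓡 n) x₀).symm y)
    (mfderiv (𝓡 n) (𝓡 n) (extChartAt (𝓡 n) x₀).symm y u)
    (mfderiv (𝓡 n) (𝓡 n) (extChartAt (𝓡 n) x₀).symm y v)

/-- Geodesics of the Levi-Civita connection of `g`, defined for all times: `C^2` curves satisfying
the geodesic equation. In the chart around `γ t`, with `c` the curve and `G` the metric in
coordinates, the geodesic equation with lowered index is
`G_{kl} c''^k + (∂_i G_{jl} - (1/2) ∂_l G_{ij}) c'^i c'^j = 0` for all `l`, where the bracket,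
symmetrized in `i, j`, is the Christoffel symbol of the first kind. -/
def IsGeodesic (g : PseudoRiemannianMetric n M r) (γ : ℝ → M) : Prop :=
  ContMDiff 𝓘(ℝ, ℝ) (𝓡 n) 2 γ ∧
    ∀ (t : ℝ) (w : EuclideanSpace ℝ (Fin n)),
      let c : ℝ → EuclideanSpace ℝ (Fin n) := fun τ => extChartAt (𝓡 n) (γ t) (γ τ)
      let G := g.inChart (γ t)
      G (c t) (deriv (deriv c) t) w
        + fderiv ℝ (fun y => G y (deriv c t) w) (c t) (deriv c t)
        - (1 / 2) * fderiv ℝ (fun y => G y (deriv c t) (deriv c t)) (c t) w = 0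

/-- The fibre at `x` of the orthogonal distribution `TF^⊥`. -/
def orthogonal (g : PseudoRiemannianMetric n M r) (F : Foliation n M q s) (x : M) :
    Submodule ℝ (TangentSpace (𝓡 n) x) where
  carrier := {v | ∀ u ∈ F.tangent x, g.val x u v = 0}
  add_mem' := fun ha hb u hu => by rw [map_add, ha u hu, hb u hu, add_zero]
  zero_mem' := fun u _ => map_zero _
  smul_mem' := fun a v hv u hu => by rw [map_smul, hv u hu, smul_zero]

/-- `g` is `F`-bundle-like: its restriction to `TF` is non-degenerate, and
`L_X (g|_{TF^⊥}) = 0` for all (local) vector fields `X` tangent to `F`, that is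
`X (g(Y, Z)) = g([X, Y], Z) + g(Y, [X, Z])` for all local sections `Y, Z` of `TF^⊥`. -/
def IsBundleLike (g : PseudoRiemannianMetric n M r) (F : Foliation n M q s) : Prop :=
  (∀ x, ∀ u ∈ F.tangent x, (∀ v ∈ F.tangent x, g.val x u v = 0) → u = 0) ∧
  ∀ (U : Set M) (X Y Z : ∀ x : M, TangentSpace (𝓡 n) x), IsOpen U →
    ContMDiffOn (𝓡 n) (𝓡 n).tangent r (fun x => (⟨x, X x⟩ : TangentBundle (𝓡 n) M)) U →
    ContMDiffOn (𝓡 n) (𝓡 n).tangent r (fun x => (⟨x, Y x⟩ : TangentBundle (𝓡 n) M)) U →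
    ContMDiffOn (𝓡 n) (𝓡 n).tangent r (fun x => (⟨x, Z x⟩ : TangentBundle (𝓡 n) M)) U →
    (∀ x ∈ U, X x ∈ F.tangent x ∧ Y x ∈ g.orthogonal F x ∧ Z x ∈ g.orthogonal F x) →
    ∀ x ∈ U, mfderiv (𝓡 n) 𝓘(ℝ, ℝ) (fun x' => g.val x' (Y x') (Z x')) x (X x) =
      g.val x (mlieBracket (𝓡 n) X Y x) (Z x) + g.val x (Y x) (mlieBracket (𝓡 n) X Z x)

/-- `TF^⊥` is geodesically complete: every geodesic starting orthogonally to `F` is defined for all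
times. -/
def IsOrthogonallyComplete (g : PseudoRiemannianMetric n M r) (F : Foliation n M q s) : Prop :=
  ∀ (x : M), ∀ v ∈ g.orthogonal F x, ∃ γ : ℝ → M, g.IsGeodesic γ ∧
    (⟨γ 0, mfderiv 𝓘(ℝ, ℝ) (𝓡 n) γ 0 (1 : ℝ)⟩ : TangentBundle (𝓡 n) M) = ⟨x, v⟩

end PseudoRiemannianMetric

/-- The standard Lorentz form `- a₀ b₀ + a₁ b₁ + ⋯ + a_{q-1} b_{q-1}` on `ℝ^q`; its isometry group is
`O(1, q-1)`. -/
def lorentzForm (q : ℕ) (a b : EuclideanSpace ℝ (Fin q)) : ℝ :=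
  ∑ i : Fin q, (if i.val = 0 then -1 else 1) * a i * b i

namespace Foliation

/-- A transverse frame at `x`: a linear isomorphism from `ℝ^q` to `ν_x(F) = T_x M / T_x F`. -/
abbrev TransverseFrame (F : Foliation n M q s) (x : M) : Type _ :=
  EuclideanSpace ℝ (Fin q) ≃ₗ[ℝ] (TangentSpace (𝓡 n) x ⧸ F.tangent x)

/-- The transverse frame `z` is an isometry from `ℝ^q` with the standard Lorentz form to `ν_x(F)`
with the scalar product induced by `g` through `T_x F^⊥ → ν_x(F)`. -/
def TransverseFrame.IsLorentz {F : Foliation n M q s} {x : M} (z : F.TransverseFrame x)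
    (g : PseudoRiemannianMetric n M r) : Prop :=
  ∀ u ∈ g.orthogonal F x, ∀ v ∈ g.orthogonal F x,
    g.val x u v = lorentzForm q (z.symm ((F.tangent x).mkQ u)) (z.symm ((F.tangent x).mkQ v))

/-- `g` induces a Lorentzian metric on the normal bundle `ν(F)`. -/
def IsTransverselyLorentzian (F : Foliation n M q s) (g : PseudoRiemannianMetric n M r) : Prop :=
  1 ≤ q ∧ ∀ x : M, ∃ z : F.TransverseFrame x, z.IsLorentz g

variable (n M q) in
/-- The total space of the vector bundle `Hom(TM, ℝ^q)` over `M`. A transverse frame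
`z : ℝ^q ≃ T_x M / T_x F` is identified with the linear map `z⁻¹ ∘ pr : T_x M → ℝ^q`, `pr` being the
projection `T_x M → T_x M / T_x F`; the frame bundles of `F` are submanifolds of this space. -/
abbrev CoframeSpace : Type _ :=
  TotalSpace (EuclideanSpace ℝ (Fin n) →L[ℝ] EuclideanSpace ℝ (Fin q))
    (fun x : M => TangentSpace (𝓡 n) x →L[ℝ] EuclideanSpace ℝ (Fin q))

variable (n q) in
/-- The model with corners of `CoframeSpace n M q`. -/
abbrev coframeModel :=
  (𝓡 n).prod 𝓘(ℝ, EuclideanSpace ℝ (Fin n) →L[ℝ] EuclideanSpace ℝ (Fin q))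

/-- The Lorentzian transverse frame bundle `Lor(F)` of the transverse Lorentzian metric induced by
`g`, a closed submanifold of `CoframeSpace n M q`. -/
def lorentzFrameBundle (F : Foliation n M q s) (g : PseudoRiemannianMetric n M r) :
    Set (CoframeSpace n M q) :=
  {p | ∃ z : F.TransverseFrame p.1, z.IsLorentz g ∧
    ∀ u : TangentSpace (𝓡 n) p.1, p.2 u = z.symm ((F.tangent p.1).mkQ u)}

/-- The local section `x ↦ d_x y` of `CoframeSpace n M q`, for a map `y` from `M` to `ℝ^q`. When `y`
is a submersion whose fibres are the plaques of `F`, this is the transverse frame field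
corresponding to the coordinate frame of `ℝ^q`; it is invariant by the holonomy along the
plaques. -/
def differentialSection (y : M → EuclideanSpace ℝ (Fin q)) (x : M) : CoframeSpace n M q :=
  ⟨x, (mfderiv (𝓡 n) (𝓡 q) y x : TangentSpace (𝓡 n) x →L[ℝ] EuclideanSpace ℝ (Fin q))⟩

/-- The tangent space at `p` of the lifted foliation `F¹` on the transverse frame bundle.
Locally, the leaf of `F¹` through the transverse frame `p` over `x` is the image of the plaque of `x`
by the frame field `dy`, where `y` is any submersion defining `F` near `x` for which `d_x y` is the
frame `p`; so its tangent space is `d_x(dy) (T_x F)`. (It does not depend on `y`: the set below is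
the same for all such `y`, and is already a linear subspace.) -/
def liftTangent (F : Foliation n M q s) (p : CoframeSpace n M q) :
    Submodule ℝ (TangentSpace (coframeModel n q) p) :=
  Submodule.span ℝ {v | ∃ (U : Set M) (y : M → EuclideanSpace ℝ (Fin q)),
    IsOpen U ∧ p.1 ∈ U ∧ ContMDiffOn (𝓡 n) (𝓡 q) s y U ∧
    (∀ x ∈ U, Function.Surjective (mfderiv (𝓡 n) (𝓡 q) y x) ∧
      ∀ u : TangentSpace (𝓡 n) x, u ∈ F.tangent x ↔ mfderiv (𝓡 n) (𝓡 q) y x u = 0) ∧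
    ∃ u ∈ F.tangent p.1,
      (⟨differentialSection y p.1,
        mfderiv (𝓡 n) (coframeModel n q) (differentialSection y) p.1 u⟩ :
          TangentBundle (coframeModel n q) (CoframeSpace n M q)) = ⟨p, v⟩}

/-- `F`, with the transverse Lorentzian metric induced by `g`, is transversely complete: the lifted
foliation on `Lor(F)` is a complete transversely parallelizable foliation (with vector fields of
class `C^k`). -/
def IsTransverselyComplete (k : WithTop ℕ∞) (F : Foliation n M q s)
    (g : PseudoRiemannianMetric n M r) : Prop :=
  IsCompleteTransverselyParallelizable (coframeModel n q) k (F.lorentzFrameBundle g) F.liftTangent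

end Foliation

end Metric

end

/-! A Lorentz frame z over x is read as the coframe p = z⁻¹ ∘ pr : T_xM → ℝ^q. In this form Lor(F)
is cut out of Hom(TM, ℝ^q) by two conditions: p vanishes on TF, and the contravariant scalar product
p g⁻¹ pᵀ (`gram`) is the diagonal matrix η of the Lorentz form (`frame_iff_gram_eq`).

The parallelism is the classical one of a frame bundle with a connection. To ξ ∈ ℝ^q corresponds the
horizontal field which at p lifts the vector of TF^⊥ with coordinates ξ in the frame p, for the
Levi-Civita connection of the transverse metric; to A ∈ so(1,q-1) corresponds the vertical field p ↦
A p.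

Basic. In a chart let Y be a submersion defining F. Bundle-likeness says that f = dY g⁻¹ dYᵀ is
constant along the plaques (`fderiv_gram_eq_zero_of_invariant`), hence so are the Christoffel
symbols Γ (`fderiv_Γ_eq_zero`). Frames are p = a ∘ dY with a f a* = η; along the frames Y and a are
first integrals of the lifted foliation, and in them the field of (ξ, A) has components ω = f a* η ξ
and a Γ(ω) + A a. These are constant along the leaves, so the bracket with a leafwise field is
leafwise (`lieBracket_stdField`).

Global. The horizontal lift of u at p is d(dy)(u) for any plaque submersion y with d_x y = p whose
matrix dy g⁻¹ dyᵀ is constant to first order at x (`fderiv_fderiv_eq_lift`); such y exist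
(`exists_submersion_of_mem_frames`). This does not mention a chart, so the local standard fields
agree on Lor(F), and a partition of unity extends them to Hom(TM, ℝ^q) (`exists_isStandardField`).
They are C^k because D²Y and Γ are, when F is C^{k+2} and g is C^{k+1}.

Complete. Vertical fields integrate to exp(tA) p. Horizontal curves project to geodesics orthogonal
to F (`eulerLagrange_eq_zero_of_parallel`). Conversely, the geodesic issued from the ξ-vector of p
is defined for all times. Near each time T its lifts exist on an interval independent of the initial
frame, since any other admissible frame is a constant isometry applied to one fixed lift
(`exists_horizontal_lift`). The local lifts are then glued (`exists_isMIntegralCurve_of_local`). A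
basis of ℝ^q × so(1,q-1) made of purely horizontal and purely vertical vectors gives both
assertions. -/

set_option maxSynthPendingDepth 2
set_option synthInstance.maxHeartbeats 400000
set_option maxHeartbeats 1000000
set_option linter.unusedSectionVars false


/-! ### Linear algebra of scalar products and transverse frames -/

section LinearAlgebra

variable {E E₂ V : Type*} [NormedAddCommGroup E] [NormedSpace ℝ E]
  [NormedAddCommGroup E₂] [NormedSpace ℝ E₂] [NormedAddCommGroup V] [InnerProductSpace ℝ V]

/-- The transpose `V ≃ V^* → E^*` of a linear map `p : E → V`, linearly in `p`. -/
noncomputable def coadjL (E V : Type*) [NormedAddCommGroup E] [NormedSpace ℝ E]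
    [NormedAddCommGroup V] [InnerProductSpace ℝ V] :
    (E →L[ℝ] V) →L[ℝ] V →L[ℝ] E →L[ℝ] ℝ :=
  ((ContinuousLinearMap.compL ℝ V (V →L[ℝ] ℝ) (E →L[ℝ] ℝ)).flip (innerSL ℝ)).comp
    (ContinuousLinearMap.compL ℝ E V ℝ).flip

@[simp] theorem coadjL_apply (p : E →L[ℝ] V) (v : V) (e : E) :
    coadjL E V p v e = inner ℝ v (p e) := rfl

/-- The adjoint of `p : E → V` with respect to the scalar product `B` on `E`. -/
noncomputable def raise (B : E →L[ℝ] E →L[ℝ] ℝ) (p : E →L[ℝ] V) : V →L[ℝ] E :=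
  B.inverse.comp (coadjL E V p)

/-- The contravariant scalar product of the components of `p : E → V`. -/
noncomputable def gram (B : E →L[ℝ] E →L[ℝ] ℝ) (p : E →L[ℝ] V) : V →L[ℝ] V :=
  p.comp (raise B p)

theorem raise_spec {B : E →L[ℝ] E →L[ℝ] ℝ} (hB : B.IsInvertible) (p : E →L[ℝ] V) (v : V) (e : E) :
    B (raise B p v) e = inner ℝ v (p e) := by
  simp [raise, hB.self_apply_inverse]

theorem raise_eq {B : E →L[ℝ] E →L[ℝ] ℝ} (hB : B.IsInvertible) {p : E →L[ℝ] V} {v : V} {u : E}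
    (h : ∀ e, B u e = inner ℝ v (p e)) : raise B p v = u := by
  apply hB.injective
  ext e
  rw [raise_spec hB, h]

theorem gram_apply (B : E →L[ℝ] E →L[ℝ] ℝ) (p : E →L[ℝ] V) (v : V) :
    gram B p v = p (raise B p v) := rfl

theorem raise_congr {B : E →L[ℝ] E →L[ℝ] ℝ} (hB : B.IsInvertible) {B' : E₂ →L[ℝ] E₂ →L[ℝ] ℝ}
    (hB' : B'.IsInvertible) (L : E₂ →L[ℝ] E) (hL : L.IsInvertible)
    (h : ∀ u v, B' u v = B (L u) (L v)) (p : E →L[ℝ] V) (v : V) :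
    L (raise B' (p.comp L) v) = raise B p v := by
  symm
  refine raise_eq hB fun e => ?_
  obtain ⟨e', rfl⟩ := hL.surjective e
  rw [← h, raise_spec hB']
  rfl

/-- The contravariant scalar product is natural under isometries. This is what lets orthonormality
of a coframe be tested in any chart. -/
theorem gram_congr {B : E →L[ℝ] E →L[ℝ] ℝ} (hB : B.IsInvertible) {B' : E₂ →L[ℝ] E₂ →L[ℝ] ℝ}
    (hB' : B'.IsInvertible) (L : E₂ →L[ℝ] E) (hL : L.IsInvertible)
    (h : ∀ u v, B' u v = B (L u) (L v)) (p : E →L[ℝ] V) :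
    gram B' (p.comp L) = gram B p := by
  ext v
  rw [gram_apply, gram_apply, ← raise_congr hB hB' L hL h p v]
  rfl

theorem inner_gram_comm {B : E →L[ℝ] E →L[ℝ] ℝ} (hB : B.IsInvertible)
    (hs : ∀ u v, B u v = B v u) (p : E →L[ℝ] V) (v w : V) :
    inner ℝ (gram B p v) w = inner ℝ v (gram B p w) := by
  rw [gram_apply, gram_apply, ← raise_spec hB, real_inner_comm, ← raise_spec hB, hs]

theorem isInvertible_of_nondegenerate [FiniteDimensional ℝ E] (B : E →L[ℝ] E →L[ℝ] ℝ)
    (h : ∀ u, (∀ v, B u v = 0) → u = 0) : B.IsInvertible := by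
  have hinj : Function.Injective B := by
    rw [injective_iff_map_eq_zero]
    exact fun u hu => h u fun v => by rw [hu]; rfl
  have hd : Module.finrank ℝ E = Module.finrank ℝ (E →L[ℝ] ℝ) := by
    rw [← (LinearMap.toContinuousLinearMap (𝕜 := ℝ) (E := E) (F' := ℝ)).finrank_eq]
    exact (Subspace.dual_finrank_eq (K := ℝ) (V := E)).symm
  exact ⟨(LinearEquiv.ofInjectiveOfFinrankEq (B : E →ₗ[ℝ] E →L[ℝ] ℝ) hinj hd).toContinuousLinearEquiv, rfl⟩

variable [FiniteDimensional ℝ V]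

theorem raise_comp {B : E →L[ℝ] E →L[ℝ] ℝ} (hB : B.IsInvertible) (a : V →L[ℝ] V) (p : E →L[ℝ] V) :
    raise B (a.comp p) = (raise B p).comp a.adjoint := by
  ext v
  refine raise_eq hB fun e => ?_
  rw [ContinuousLinearMap.comp_apply, raise_spec hB, ContinuousLinearMap.adjoint_inner_left]
  rfl

theorem gram_comp {B : E →L[ℝ] E →L[ℝ] ℝ} (hB : B.IsInvertible) (a : V →L[ℝ] V) (p : E →L[ℝ] V) :
    gram B (a.comp p) = a.comp ((gram B p).comp a.adjoint) := by
  rw [gram, raise_comp hB]; rfl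

theorem adjoint_gram {B : E →L[ℝ] E →L[ℝ] ℝ} (hB : B.IsInvertible)
    (hs : ∀ u v, B u v = B v u) (p : E →L[ℝ] V) :
    (gram B p).adjoint = gram B p := by
  ext v
  refine ext_inner_right ℝ fun w => ?_
  rw [ContinuousLinearMap.adjoint_inner_left, inner_gram_comm hB hs]

/-- Taking adjoints, as a continuous linear map. -/
noncomputable def adjL (V : Type*) [NormedAddCommGroup V] [InnerProductSpace ℝ V]
    [FiniteDimensional ℝ V] : (V →L[ℝ] V) →L[ℝ] (V →L[ℝ] V) :=
  LinearMap.toContinuousLinearMap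
    { toFun := fun a => a.adjoint
      map_add' := fun a b => map_add _ a b
      map_smul' := fun c a => by simp }

@[simp] theorem adjL_apply (a : V →L[ℝ] V) : adjL V a = a.adjoint := rfl

/-- The Koszul formula: half of `μ(v)w + μ(w)v - μ(·)(v,w)`. -/
noncomputable def koszul (μ : V →L[ℝ] V →L[ℝ] V) : V →L[ℝ] V →L[ℝ] V :=
  (1 / 2 : ℝ) • (μ + μ.flip - (adjL V).comp μ.flip)

theorem koszul_symm {μ : V →L[ℝ] V →L[ℝ] V} (h : ∀ v, (μ v).adjoint = μ v) (v w : V) :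
    koszul μ v w = koszul μ w v := by
  have h3 : (μ.flip v).adjoint w = (μ.flip w).adjoint v := by
    refine ext_inner_right ℝ fun z => ?_
    rw [ContinuousLinearMap.adjoint_inner_left, ContinuousLinearMap.adjoint_inner_left,
      ContinuousLinearMap.flip_apply, ContinuousLinearMap.flip_apply, real_inner_comm,
      ← ContinuousLinearMap.adjoint_inner_right, h z]
  simp [koszul, h3, add_comm]

/-- With μ the derivative of a covariant metric, this is metric compatibility with lowered index:
the terms μ(w)v and μ(·)(v,w) are adjoint to each other and cancel in the symmetrization. -/
theorem koszul_add_adjoint {μ : V →L[ℝ] V →L[ℝ] V} (h : ∀ v, (μ v).adjoint = μ v) (v : V) :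
    koszul μ v + (koszul μ v).adjoint = μ v := by
  have : koszul μ v = (1 / 2 : ℝ) • (μ v + μ.flip v - (μ.flip v).adjoint) := by
    simp [koszul]
  rw [this, map_smulₛₗ, map_sub, map_add, ContinuousLinearMap.adjoint_adjoint, h v]
  simp only [conj_trivial]
  module

/-- The classical braid argument: a trilinear form symmetric in two arguments and skew in the last
two equals its own opposite after alternating the two moves three times. It gives the uniqueness of
the Levi-Civita connection. -/
theorem eq_zero_of_symm_of_skew {κ : V →L[ℝ] V →L[ℝ] V} (hs : ∀ v w, κ v w = κ w v)
    (ha : ∀ v, κ v + (κ v).adjoint = 0) : κ = 0 := by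
  have hk : ∀ v w z, inner ℝ (κ v w) z = - inner ℝ (κ v z) w := by
    intro v w z
    have := congrArg (fun T : V →L[ℝ] V => inner ℝ (T w) z) (ha v)
    simp only [_root_.add_apply, inner_add_left, ContinuousLinearMap.adjoint_inner_left,
      _root_.zero_apply, inner_zero_left] at this
    rw [real_inner_comm w]
    linarith
  ext v w
  refine ext_inner_right ℝ fun z => ?_
  have h1 := hk v w z
  have h2 := hk z v w
  have h3 := hk w z v
  rw [hs v z] at h1
  rw [hs z w] at h2
  rw [hs w v] at h3
  simp only [_root_.zero_apply, inner_zero_left]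
  linarith

end LinearAlgebra

/-! ### Smoothness -/

section Smoothness

variable {E V X : Type*} [NormedAddCommGroup E] [NormedSpace ℝ E] [CompleteSpace E]
  [NormedAddCommGroup V] [InnerProductSpace ℝ V] [NormedAddCommGroup X] [NormedSpace ℝ X]
  {m : WithTop ℕ∞} {W : Set X}

theorem ContDiffOn.clm_inverse {F : Type*} [NormedAddCommGroup F] [NormedSpace ℝ F]
    {B : X → E →L[ℝ] F} (hB : ContDiffOn ℝ m B W)
    (hi : ∀ x ∈ W, (B x).IsInvertible) : ContDiffOn ℝ m (fun x => (B x).inverse) W := by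
  intro x hx
  obtain ⟨e, he⟩ := hi x hx
  have := contDiffAt_map_inverse (𝕜 := ℝ) (n := m) e
  rw [he] at this
  exact this.comp_contDiffWithinAt x (hB x hx)

theorem ContDiffOn.raise {B : X → E →L[ℝ] E →L[ℝ] ℝ} {p : X → E →L[ℝ] V}
    (hB : ContDiffOn ℝ m B W) (hi : ∀ x ∈ W, (B x).IsInvertible) (hp : ContDiffOn ℝ m p W) :
    ContDiffOn ℝ m (fun x => _root_.raise (B x) (p x)) W :=
  (hB.clm_inverse hi).clm_comp ((coadjL E V).contDiff.comp_contDiffOn hp)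

theorem ContDiffOn.gram {B : X → E →L[ℝ] E →L[ℝ] ℝ} {p : X → E →L[ℝ] V}
    (hB : ContDiffOn ℝ m B W) (hi : ∀ x ∈ W, (B x).IsInvertible) (hp : ContDiffOn ℝ m p W) :
    ContDiffOn ℝ m (fun x => _root_.gram (B x) (p x)) W :=
  hp.clm_comp (hB.raise hi hp)

end Smoothness
/-! ### Christoffel symbols of a transverse metric -/

section Christoffel

variable {V X : Type*} [NormedAddCommGroup V] [InnerProductSpace ℝ V] [FiniteDimensional ℝ V]
  [NormedAddCommGroup X] [NormedSpace ℝ X]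

/-- The derivative of the inverse of a contravariant metric `f` whose derivative is `l`. -/
noncomputable def inverseDeriv (f : V →L[ℝ] V) (l : V →L[ℝ] V →L[ℝ] V) : V →L[ℝ] V →L[ℝ] V :=
  -((ContinuousLinearMap.compL ℝ V V V f.inverse).comp
    (((ContinuousLinearMap.compL ℝ V V V).flip f.inverse).comp l))

theorem inverseDeriv_apply (f : V →L[ℝ] V) (l : V →L[ℝ] V →L[ℝ] V) (v : V) :
    inverseDeriv f l v = -(f.inverse.comp ((l v).comp f.inverse)) := rfl

/-- The Christoffel symbols of a contravariant metric with value `f` and derivative `l`. -/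
noncomputable def christoffel (f : V →L[ℝ] V) (l : V →L[ℝ] V →L[ℝ] V) : V →L[ℝ] V →L[ℝ] V :=
  (ContinuousLinearMap.compL ℝ V V V f).comp (koszul (inverseDeriv f l))

theorem adjoint_inverse {f : V →L[ℝ] V} (hf : f.IsInvertible) (hs : f.adjoint = f) :
    f.inverse.adjoint = f.inverse := by
  ext v
  refine ext_inner_right ℝ fun w => ?_
  rw [ContinuousLinearMap.adjoint_inner_left]
  calc inner ℝ v (f.inverse w) = inner ℝ (f.adjoint (f.inverse v)) (f.inverse w) := by
        rw [hs, hf.self_apply_inverse]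
    _ = inner ℝ (f.inverse v) w := by
        rw [ContinuousLinearMap.adjoint_inner_left, hf.self_apply_inverse]

theorem inverseDeriv_symm {f : V →L[ℝ] V} (hf : f.IsInvertible) (hs : f.adjoint = f)
    {l : V →L[ℝ] V →L[ℝ] V} (hl : ∀ v, (l v).adjoint = l v) (v : V) :
    (inverseDeriv f l v).adjoint = inverseDeriv f l v := by
  rw [inverseDeriv_apply, map_neg, ContinuousLinearMap.adjoint_comp,
    ContinuousLinearMap.adjoint_comp, adjoint_inverse hf hs, hl]
  rfl

theorem christoffel_symm {f : V →L[ℝ] V} (hf : f.IsInvertible) (hs : f.adjoint = f)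
    {l : V →L[ℝ] V →L[ℝ] V} (hl : ∀ v, (l v).adjoint = l v) (v w : V) :
    christoffel f l v w = christoffel f l w v :=
  congrArg f (koszul_symm (inverseDeriv_symm hf hs hl) v w)

/-- The contravariant metric is parallel: conjugating the covariant compatibility identity by f
turns the derivative -f⁻¹ l f⁻¹ of f⁻¹ into -l. -/
theorem christoffel_compat {f : V →L[ℝ] V} (hf : f.IsInvertible) (hs : f.adjoint = f)
    {l : V →L[ℝ] V →L[ℝ] V} (hl : ∀ v, (l v).adjoint = l v) (v : V) :
    (christoffel f l v).comp f + f.comp (christoffel f l v).adjoint = - l v := by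
  have h1 : christoffel f l v = f.comp (koszul (inverseDeriv f l) v) := rfl
  have h2 := koszul_add_adjoint (inverseDeriv_symm hf hs hl) v
  have h3 : (christoffel f l v).comp f + f.comp (christoffel f l v).adjoint =
      f.comp ((koszul (inverseDeriv f l) v + (koszul (inverseDeriv f l) v).adjoint).comp f) := by
    rw [h1, ContinuousLinearMap.adjoint_comp, hs]
    ext w
    simp
  rw [h3, h2, inverseDeriv_apply]
  ext w
  simp [hf.self_apply_inverse, hf.inverse_apply_self]

/-- The difference of two torsion-free compatible connections, with its index lowered by f⁻¹, is
symmetric in its two arguments and skew as an endomorphism, hence zero. -/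
theorem christoffel_unique {f : V →L[ℝ] V} (hf : f.IsInvertible) (hs : f.adjoint = f)
    {l : V →L[ℝ] V →L[ℝ] V} (hl : ∀ v, (l v).adjoint = l v) {Γ : V →L[ℝ] V →L[ℝ] V}
    (hΓ : ∀ v w, Γ v w = Γ w v) (hΓ' : ∀ v, (Γ v).comp f + f.comp (Γ v).adjoint = - l v) :
    Γ = christoffel f l := by
  have key : (ContinuousLinearMap.compL ℝ V V V f.inverse).comp (Γ - christoffel f l) = 0 := by
    refine eq_zero_of_symm_of_skew (fun v w => ?_) fun v => ?_
    · change f.inverse (Γ v w - christoffel f l v w) = f.inverse (Γ w v - christoffel f l w v)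
      rw [hΓ, christoffel_symm hf hs hl]
    · have h0 : (Γ v - christoffel f l v).comp f + f.comp (Γ v - christoffel f l v).adjoint = 0 := by
        have := congrArg₂ (· - ·) (hΓ' v) (christoffel_compat hf hs hl v)
        simp only [sub_self] at this
        rw [← this, map_sub]
        ext w
        simp
        abel
      change f.inverse.comp (Γ v - christoffel f l v) +
        (f.inverse.comp (Γ v - christoffel f l v)).adjoint = 0
      rw [ContinuousLinearMap.adjoint_comp, adjoint_inverse hf hs]
      have h1 := congrArg (fun T : V →L[ℝ] V => f.inverse.comp (T.comp f.inverse)) h0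
      ext w
      have h2 := congrArg (fun T : V →L[ℝ] V => T w) h1
      simpa [hf.self_apply_inverse, hf.inverse_apply_self] using h2
  ext v w
  have := congrArg (fun T : V →L[ℝ] V →L[ℝ] V => f (T v w)) key
  simp only [ContinuousLinearMap.comp_apply, ContinuousLinearMap.compL_apply,
    hf.self_apply_inverse] at this
  simpa [sub_eq_zero] using this

theorem ContDiffOn.christoffel {m : WithTop ℕ∞} {W : Set X} {f : X → V →L[ℝ] V}
    {l : X → V →L[ℝ] V →L[ℝ] V} (hf : ContDiffOn ℝ m f W) (hi : ∀ x ∈ W, (f x).IsInvertible)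
    (hl : ContDiffOn ℝ m l W) : ContDiffOn ℝ m (fun x => _root_.christoffel (f x) (l x)) W := by
  have h1 : ContDiffOn ℝ m (fun x => inverseDeriv (f x) (l x)) W := by
    have hi := hf.clm_inverse hi
    exact (((ContinuousLinearMap.compL ℝ V V V).contDiff.comp_contDiffOn hi).clm_comp
      (((ContinuousLinearMap.compL ℝ V V V).flip.contDiff.comp_contDiffOn hi).clm_comp hl)).neg
  have h2 : ContDiffOn ℝ m (fun x => koszul (inverseDeriv (f x) (l x))) W := by
    have hfl : ContDiffOn ℝ m (fun x => (inverseDeriv (f x) (l x)).flip) W :=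
      (ContinuousLinearMap.flipₗᵢ ℝ V V V).toContinuousLinearEquiv.contDiff.comp_contDiffOn h1
    exact (contDiffOn_const (c := (1 / 2 : ℝ))).smul ((h1.add hfl).sub (contDiffOn_const.clm_comp hfl))
  exact ((ContinuousLinearMap.compL ℝ V V V).contDiff.comp_contDiffOn hf).clm_comp h2

end Christoffel

/-! ### A foliation with a bundle-like metric in coordinates -/

/-- A submersion `Y` defining a foliation of an open set `W`, and a bundle-like metric `G`. -/
structure BundleLikeChart (E V : Type*) [NormedAddCommGroup E] [NormedSpace ℝ E]
    [NormedAddCommGroup V] [InnerProductSpace ℝ V] (k : ℕ∞) where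
  W : Set E
  Y : E → V
  G : E → E →L[ℝ] E →L[ℝ] ℝ
  isOpen : IsOpen W
  contDiffOn_Y : ContDiffOn ℝ ((k : WithTop ℕ∞) + 2) Y W
  contDiffOn_G : ContDiffOn ℝ ((k : WithTop ℕ∞) + 1) G W
  symm : ∀ x ∈ W, ∀ u v, G x u v = G x v u
  inv : ∀ x ∈ W, (G x).IsInvertible
  gram_inv : ∀ x ∈ W, (gram (G x) (fderiv ℝ Y x)).IsInvertible
  invariant : ∀ x ∈ W, ∀ w, fderiv ℝ Y x w = 0 →
    fderiv ℝ (fun x => gram (G x) (fderiv ℝ Y x)) x w = 0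

namespace BundleLikeChart

variable {E V : Type*} [NormedAddCommGroup E] [NormedSpace ℝ E] [FiniteDimensional ℝ E]
  [NormedAddCommGroup V] [InnerProductSpace ℝ V] [FiniteDimensional ℝ V] {k : ℕ∞}
  (D : BundleLikeChart E V k)

/-- The differential of the submersion. -/
noncomputable def dY (x : E) : E →L[ℝ] V := fderiv ℝ D.Y x

/-- The second differential of the submersion. -/
noncomputable def d2Y (x : E) : E →L[ℝ] E →L[ℝ] V := fderiv ℝ D.dY x

/-- The contravariant transverse metric. -/
noncomputable def f (x : E) : V →L[ℝ] V := gram (D.G x) (D.dY x)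

/-- The derivative of the contravariant transverse metric. -/
noncomputable def df (x : E) : E →L[ℝ] V →L[ℝ] V := fderiv ℝ D.f x

/-- The horizontal lift. -/
noncomputable def s (x : E) : V →L[ℝ] E := (raise (D.G x) (D.dY x)).comp (D.f x).inverse

/-- The derivative of the contravariant metric along horizontal lifts. -/
noncomputable def l (x : E) : V →L[ℝ] V →L[ℝ] V := (D.df x).comp (D.s x)

/-- The Christoffel symbols of the transverse metric. -/
noncomputable def Γ (x : E) : V →L[ℝ] V →L[ℝ] V := christoffel (D.f x) (D.l x)

variable {D} {x : E}

theorem nhds (hx : x ∈ D.W) : D.W ∈ 𝓝 x := D.isOpen.mem_nhds hx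

section smooth
variable (D)

theorem contDiffOn_dY : ContDiffOn ℝ ((k : WithTop ℕ∞) + 1) D.dY D.W :=
  D.contDiffOn_Y.fderiv_of_isOpen D.isOpen (by rw [add_assoc]; rfl)

theorem contDiffOn_d2Y : ContDiffOn ℝ k D.d2Y D.W :=
  D.contDiffOn_dY.fderiv_of_isOpen D.isOpen le_rfl

theorem contDiffOn_f : ContDiffOn ℝ ((k : WithTop ℕ∞) + 1) D.f D.W :=
  D.contDiffOn_G.gram D.inv D.contDiffOn_dY

theorem contDiffOn_df : ContDiffOn ℝ k D.df D.W :=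
  D.contDiffOn_f.fderiv_of_isOpen D.isOpen le_rfl

theorem contDiffOn_s : ContDiffOn ℝ ((k : WithTop ℕ∞) + 1) D.s D.W :=
  (D.contDiffOn_G.raise D.inv D.contDiffOn_dY).clm_comp (D.contDiffOn_f.clm_inverse D.gram_inv)

theorem contDiffOn_l : ContDiffOn ℝ k D.l D.W :=
  D.contDiffOn_df.clm_comp (D.contDiffOn_s.of_le le_self_add)

theorem contDiffOn_Γ : ContDiffOn ℝ k D.Γ D.W :=
  (D.contDiffOn_f.of_le le_self_add).christoffel D.gram_inv D.contDiffOn_l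

end smooth

theorem hasFDerivAt_Y (hx : x ∈ D.W) : HasFDerivAt D.Y (D.dY x) x :=
  ((D.contDiffOn_Y.contDiffAt (nhds hx)).differentiableAt (by simp)).hasFDerivAt

theorem hasFDerivAt_dY (hx : x ∈ D.W) : HasFDerivAt D.dY (D.d2Y x) x :=
  ((D.contDiffOn_dY.contDiffAt (nhds hx)).differentiableAt (by simp)).hasFDerivAt

theorem hasFDerivAt_f (hx : x ∈ D.W) : HasFDerivAt D.f (D.df x) x :=
  ((D.contDiffOn_f.contDiffAt (nhds hx)).differentiableAt (by simp)).hasFDerivAt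

theorem hasFDerivAt_G (hx : x ∈ D.W) : HasFDerivAt D.G (fderiv ℝ D.G x) x :=
  ((D.contDiffOn_G.contDiffAt (nhds hx)).differentiableAt (by simp)).hasFDerivAt

theorem d2Y_symm (hx : x ∈ D.W) (v w : E) : D.d2Y x v w = D.d2Y x w v := by
  have h := (D.contDiffOn_Y.contDiffAt (nhds hx)).isSymmSndFDerivAt (by simp)
  exact h v w

theorem f_inv (hx : x ∈ D.W) : (D.f x).IsInvertible := D.gram_inv x hx

theorem f_adjoint (hx : x ∈ D.W) : (D.f x).adjoint = D.f x :=
  adjoint_gram (D.inv x hx) (D.symm x hx) _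

theorem dY_s (hx : x ∈ D.W) (v : V) : D.dY x (D.s x v) = v :=
  (f_inv hx).self_apply_inverse v

theorem df_adjoint (hx : x ∈ D.W) (w : E) : (D.df x w).adjoint = D.df x w := by
  have h1 : HasFDerivAt (fun y => adjL V (D.f y)) ((adjL V).comp (D.df x)) x :=
    (adjL V).hasFDerivAt.comp x (hasFDerivAt_f hx)
  have h2 : (fun y => adjL V (D.f y)) =ᶠ[𝓝 x] D.f := by
    filter_upwards [nhds hx] with y hy using f_adjoint hy
  exact congrArg (fun T : E →L[ℝ] V →L[ℝ] V => T w)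
    ((h1.congr_of_eventuallyEq h2.symm).unique (hasFDerivAt_f hx))

/-- The vector w - s(dY w) is tangent to the leaf, where the derivative of f vanishes; so df factors
through dY. -/
theorem df_s_dY (hx : x ∈ D.W) (w : E) : D.l x (D.dY x w) = D.df x w := by
  have h := D.invariant x hx (w - D.s x (D.dY x w))
    (by rw [map_sub]; exact sub_eq_zero.2 (dY_s hx _).symm)
  rw [map_sub, sub_eq_zero] at h
  exact h.symm

theorem l_adjoint (hx : x ∈ D.W) (v : V) : (D.l x v).adjoint = D.l x v := df_adjoint hx _

theorem Γ_symm (hx : x ∈ D.W) (v w : V) : D.Γ x v w = D.Γ x w v :=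
  christoffel_symm (f_inv hx) (f_adjoint hx) (l_adjoint hx) v w

theorem Γ_compat (hx : x ∈ D.W) (w : E) :
    (D.Γ x (D.dY x w)).comp (D.f x) + (D.f x).comp (D.Γ x (D.dY x w)).adjoint = - D.df x w := by
  rw [← df_s_dY hx]
  exact christoffel_compat (f_inv hx) (f_adjoint hx) (l_adjoint hx) _

theorem Γ_unique (hx : x ∈ D.W) {Γ : V →L[ℝ] V →L[ℝ] V} (hΓ : ∀ v w, Γ v w = Γ w v)
    (hΓ' : ∀ w, (Γ (D.dY x w)).comp (D.f x) + (D.f x).comp (Γ (D.dY x w)).adjoint = - D.df x w) :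
    Γ = D.Γ x :=
  christoffel_unique (f_inv hx) (f_adjoint hx) (l_adjoint hx) hΓ fun v => by
    have := hΓ' (D.s x v)
    rwa [dY_s hx] at this

/-- `d (l ∘ dY) = 0`, so that `l` is constant along the leaves. -/
theorem fderiv_l_eq_zero (hk : 1 ≤ k) (hx : x ∈ D.W) {w : E} (hw : D.dY x w = 0) :
    fderiv ℝ D.l x w = 0 := by
  have hk' : (k : WithTop ℕ∞) ≠ 0 := by
    have : k ≠ 0 := (zero_lt_one.trans_le hk).ne'
    exact_mod_cast this
  have hl : HasFDerivAt D.l (fderiv ℝ D.l x) x :=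
    ((D.contDiffOn_l.contDiffAt (nhds hx)).differentiableAt hk').hasFDerivAt
  have h1 := hl.clm_comp (hasFDerivAt_dY hx)
  have h2 : (fun y => (D.l y).comp (D.dY y)) =ᶠ[𝓝 x] D.df := by
    filter_upwards [nhds hx] with y hy
    ext1 v
    exact df_s_dY hy v
  have h3 := (h1.congr_of_eventuallyEq h2.symm)
  have h4 : IsSymmSndFDerivAt ℝ D.f x :=
    (D.contDiffOn_f.contDiffAt (nhds hx)).isSymmSndFDerivAt (by
      simp only [minSmoothness_of_isRCLikeNormedField]
      calc (2 : WithTop ℕ∞) = 1 + 1 := one_add_one_eq_two.symm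
        _ ≤ k + 1 := by gcongr; exact_mod_cast hk)
  have h5 : fderiv ℝ D.df x = _ := h3.fderiv
  ext1 v
  -- Differentiate df = l ∘ dY once more and use the symmetry of the second derivative of f, which
  -- is C² because k ≥ 1. The D²Y terms agree and dY w = 0 kills the remaining one, leaving dl(w)(v)
  -- = 0.
  have h6 := h4 w (D.s x v)
  change fderiv ℝ D.df x w (D.s x v) = fderiv ℝ D.df x (D.s x v) w at h6
  rw [h5] at h6
  simp only [_root_.add_apply, ContinuousLinearMap.comp_apply, ContinuousLinearMap.compL_apply,
    ContinuousLinearMap.flip_apply, dY_s hx, hw, map_zero, d2Y_symm hx w] at h6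
  simpa using h6

/-- Γ is a differentiable function of the pair (f, l), and both have zero derivative in leaf
directions. -/
theorem fderiv_Γ_eq_zero (hk : 1 ≤ k) (hx : x ∈ D.W) {w : E} (hw : D.dY x w = 0) :
    HasFDerivAt D.Γ (fderiv ℝ D.Γ x) x ∧ fderiv ℝ D.Γ x w = 0 := by
  have hk' : (k : WithTop ℕ∞) ≠ 0 := by
    have : k ≠ 0 := (zero_lt_one.trans_le hk).ne'
    exact_mod_cast this
  have hl : HasFDerivAt D.l (fderiv ℝ D.l x) x :=
    ((D.contDiffOn_l.contDiffAt (nhds hx)).differentiableAt hk').hasFDerivAt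
  let c : (V →L[ℝ] V) × (V →L[ℝ] V →L[ℝ] V) → V →L[ℝ] V →L[ℝ] V := fun z => christoffel z.1 z.2
  have hc : DifferentiableAt ℝ c (D.f x, D.l x) := by
    obtain ⟨e, he⟩ := f_inv hx
    have hU : {z : (V →L[ℝ] V) × (V →L[ℝ] V →L[ℝ] V) | z.1.IsInvertible} ∈ 𝓝 (D.f x, D.l x) := by
      have : range ((↑) : (V ≃L[ℝ] V) → V →L[ℝ] V) ∈ 𝓝 (D.f x) :=
        he ▸ ContinuousLinearEquiv.nhds e
      exact (continuous_fst.continuousAt (x := (D.f x, D.l x))).preimage_mem_nhds this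
    exact ((contDiff_fst.contDiffOn.christoffel (fun z hz => hz) contDiff_snd.contDiffOn
      (m := 1)).contDiffAt hU).differentiableAt one_ne_zero
  have h : HasFDerivAt D.Γ _ x := HasFDerivAt.comp (f := fun y => (D.f y, D.l y)) x hc.hasFDerivAt
    ((hasFDerivAt_f hx).prodMk hl)
  refine ⟨h.differentiableAt.hasFDerivAt, ?_⟩
  rw [h.fderiv]
  have h0 : D.df x w = 0 := by rw [← df_s_dY hx, hw, map_zero]
  change fderiv ℝ c (D.f x, D.l x) (D.df x w, fderiv ℝ D.l x w) = 0
  rw [h0, fderiv_l_eq_zero hk hx hw]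
  exact map_zero _

end BundleLikeChart
/-! ### Curves of orthonormal frames -/

section ODE

variable {F : Type*} [NormedAddCommGroup F] [NormedSpace ℝ F] [CompleteSpace F]

/-- The Picard–Lindelöf solution is C¹ at the initial time because its derivative f ∘ α is
continuous there; the tangent spaces of the frame bundle are defined by C¹ curves. -/
theorem exists_integralCurve_contDiffAt {f : F → F} {z₀ : F} (hf : ContDiffAt ℝ 1 f z₀) (T : ℝ) :
    ∃ ε > 0, ∃ α : ℝ → F, α T = z₀ ∧ ContDiffAt ℝ 1 α T ∧
      ∀ t ∈ Ioo (T - ε) (T + ε), HasDerivAt α (f (α t)) t := by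
  obtain ⟨r, hr, ε, hε, h⟩ :=
    hf.exists_forall_mem_closedBall_exists_eq_forall_mem_Ioo_hasDerivAt T
  obtain ⟨α, hα, hd⟩ := h z₀ (Metric.mem_closedBall_self hr.le)
  refine ⟨ε, hε, α, hα, ?_, hd⟩
  have hT : T ∈ Ioo (T - ε) (T + ε) := ⟨by linarith, by linarith⟩
  have hc : ContinuousAt α T := (hd T hT).continuousAt
  have hf' : ∀ᶠ z in 𝓝 (α T), ContinuousAt f z := by
    rw [hα]
    filter_upwards [hf.eventually (by simp)] with z hz using hz.continuousAt
  have h1 : ∀ᶠ t in 𝓝 T, ContinuousAt f (α t) ∧ HasDerivAt α (f (α t)) t :=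
    (hc.eventually hf').and (by filter_upwards [isOpen_Ioo.mem_nhds hT] with t ht using hd t ht)
  refine contDiffAt_one_iff.2 ⟨fun t => (1 : ℝ →L[ℝ] ℝ).smulRight (f (α t)), _, h1, ?_, ?_⟩
  · intro t ht
    have : ContinuousAt (fun t => f (α t)) t := ContinuousAt.comp ht.1 ht.2.continuousAt
    exact ((ContinuousLinearMap.smulRightL ℝ ℝ F 1).continuous.continuousAt.comp
      this).continuousWithinAt
  · exact fun t ht => ht.2.hasFDerivAt

end ODE

/-! ### Matrices of orthonormal frames -/

section Frames

variable {V : Type*} [NormedAddCommGroup V] [InnerProductSpace ℝ V] [FiniteDimensional ℝ V]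
  {η a f : V →L[ℝ] V}

theorem comp_eq_id_comm_of_finiteDimensional {a b : V →L[ℝ] V}
    (h : a.comp b = ContinuousLinearMap.id ℝ V) : b.comp a = ContinuousLinearMap.id ℝ V := by
  have h' : (a : V →ₗ[ℝ] V) * (b : V →ₗ[ℝ] V) = 1 :=
    LinearMap.ext fun v => congrArg (fun T : V →L[ℝ] V => T v) h
  ext v
  exact congrArg (fun T : V →ₗ[ℝ] V => T v) (mul_eq_one_comm.1 h')

/-- Since η² = 1, the relation a f a* = η exhibits f a* η as the inverse of a. This explicit inverse
is used throughout. -/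
theorem frame_right_inv (hη : ∀ v, η (η v) = v) (h : a.comp (f.comp a.adjoint) = η) :
    a.comp (f.comp (a.adjoint.comp η)) = ContinuousLinearMap.id ℝ V := by
  ext v
  exact (congrArg (fun T : V →L[ℝ] V => T (η v)) h).trans (hη v)

theorem frame_left_inv (hη : ∀ v, η (η v) = v) (h : a.comp (f.comp a.adjoint) = η) (v : V) :
    f (a.adjoint (η (a v))) = v :=
  congrArg (fun T : V →L[ℝ] V => T v) (comp_eq_id_comm_of_finiteDimensional (frame_right_inv hη h))

theorem frame_isInvertible (hη : ∀ v, η (η v) = v) (h : a.comp (f.comp a.adjoint) = η) :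
    a.IsInvertible :=
  ContinuousLinearMap.IsInvertible.of_inverse (frame_right_inv hη h)
    (comp_eq_id_comm_of_finiteDimensional (frame_right_inv hη h))

end Frames

/-! ### Parallel frames and the tangent spaces of the frame bundle in a chart -/

namespace BundleLikeChart

variable {E V : Type*} [NormedAddCommGroup E] [NormedSpace ℝ E] [FiniteDimensional ℝ E]
  [NormedAddCommGroup V] [InnerProductSpace ℝ V] [FiniteDimensional ℝ V] {k : ℕ∞}
  (D : BundleLikeChart E V k) {x : E} {p : E →L[ℝ] V} {η : V →L[ℝ] V}

/-- The orthonormal transverse frames, for the standard scalar product given by `η`. -/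
def frames (η : V →L[ℝ] V) : Set (E × (E →L[ℝ] V)) :=
  {c | c.1 ∈ D.W ∧ (∀ e, D.dY c.1 e = 0 → c.2 e = 0) ∧ gram (D.G c.1) c.2 = η}

/-- The horizontal lift to the bundle of coframes for the transverse Levi-Civita connection. -/
noncomputable def lift (x : E) (p : E →L[ℝ] V) : E →L[ℝ] E →L[ℝ] V :=
  (ContinuousLinearMap.compL ℝ E V V (p.comp (D.s x))).comp
    (D.d2Y x + ((ContinuousLinearMap.compL ℝ E V V).flip (D.dY x)).comp ((D.Γ x).comp (D.dY x)))

variable {D}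

theorem lift_apply (w : E) : D.lift x p w =
    (p.comp (D.s x)).comp (D.d2Y x w + (D.Γ x (D.dY x w)).comp (D.dY x)) := rfl

theorem eq_comp_dY (hx : x ∈ D.W) (hp : ∀ e, D.dY x e = 0 → p e = 0) :
    (p.comp (D.s x)).comp (D.dY x) = p := by
  ext e
  have := hp (D.s x (D.dY x e) - e) (by rw [map_sub, dY_s hx, sub_self])
  rwa [map_sub, sub_eq_zero] at this

theorem comp_dY_comp_s (hx : x ∈ D.W) (a : V →L[ℝ] V) : (a.comp (D.dY x)).comp (D.s x) = a := by
  ext v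
  simp [dY_s hx]

theorem comp_dY_mem_frames (hx : x ∈ D.W) {a : V →L[ℝ] V}
    (ha : a.comp ((D.f x).comp a.adjoint) = η) : (x, a.comp (D.dY x)) ∈ D.frames η := by
  refine ⟨hx, fun e he => ?_, ?_⟩
  · simp only [ContinuousLinearMap.comp_apply] at he ⊢
    rw [he, map_zero]
  · rw [gram_comp (D.inv x hx)]; exact ha

/-- A coframe vanishing on ker dY factors through dY. The matrix a = p ∘ s is its fibre coordinate,
and orthonormality becomes the condition a f a* = η. -/
theorem exists_of_mem_frames (h : (x, p) ∈ D.frames η) : ∃ a : V →L[ℝ] V,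
    p.comp (D.s x) = a ∧ a.comp (D.dY x) = p ∧ a.comp ((D.f x).comp a.adjoint) = η := by
  refine ⟨_, rfl, eq_comp_dY h.1 h.2.1, ?_⟩
  rw [f, ← gram_comp (D.inv x h.1)]
  rw [eq_comp_dY h.1 h.2.1]
  exact h.2.2

theorem lift_comp_dY (hx : x ∈ D.W) (a : V →L[ℝ] V) (w : E) : D.lift x (a.comp (D.dY x)) w =
    a.comp (D.d2Y x w + (D.Γ x (D.dY x w)).comp (D.dY x)) := by
  rw [lift_apply, comp_dY_comp_s hx]

theorem hasDerivAt_comp_dY {γ : ℝ → E} {a : ℝ → V →L[ℝ] V} {t : ℝ} {w : E} {a' : V →L[ℝ] V}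
    (hx : γ t ∈ D.W) (hγ : HasDerivAt γ w t) (ha : HasDerivAt a a' t) :
    HasDerivAt (fun τ => (a τ).comp (D.dY (γ τ)))
      (a'.comp (D.dY (γ t)) + (a t).comp (D.d2Y (γ t) w)) t := by
  have h1 : HasDerivAt (fun τ => D.dY (γ τ)) (D.d2Y (γ t) w) t :=
    (hasFDerivAt_dY hx).comp_hasDerivAt t hγ
  exact ha.clm_comp h1

theorem hasDerivAt_frame_gram {γ : ℝ → E} {a : ℝ → V →L[ℝ] V} {t : ℝ} {w : E} {a' : V →L[ℝ] V}
    (hx : γ t ∈ D.W) (hγ : HasDerivAt γ w t) (ha : HasDerivAt a a' t) :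
    HasDerivAt (fun τ => (a τ).comp ((D.f (γ τ)).comp (a τ).adjoint))
      (a'.comp ((D.f (γ t)).comp (a t).adjoint) +
        (a t).comp ((D.df (γ t) w).comp (a t).adjoint + (D.f (γ t)).comp a'.adjoint)) t := by
  have h1 : HasDerivAt (fun τ => D.f (γ τ)) (D.df (γ t) w) t :=
    (hasFDerivAt_f hx).comp_hasDerivAt t hγ
  have h2 : HasDerivAt (fun τ => adjL V (a τ)) (adjL V a') t :=
    (adjL V).hasFDerivAt.comp_hasDerivAt t ha
  exact ha.clm_comp (h1.clm_comp h2)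

/-- Parallel translation of frames along a curve given by a differential equation. -/
theorem exists_parallel_curve (hk : 1 ≤ k) {τ : E × (V →L[ℝ] V) → E} {x₀ : E} {a₀ : V →L[ℝ] V}
    (hτ : ContDiffAt ℝ 1 τ (x₀, a₀)) (hx₀ : x₀ ∈ D.W)
    (ha₀ : a₀.comp ((D.f x₀).comp a₀.adjoint) = η) (T : ℝ) :
    ∃ ε > 0, ∃ (γ : ℝ → E) (a : ℝ → V →L[ℝ] V), γ T = x₀ ∧ a T = a₀ ∧
      ContDiffAt ℝ 1 γ T ∧ ContDiffAt ℝ 1 a T ∧ ∀ t ∈ Ioo (T - ε) (T + ε), γ t ∈ D.W ∧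
        HasDerivAt γ (τ (γ t, a t)) t ∧
        HasDerivAt a ((a t).comp (D.Γ (γ t) (D.dY (γ t) (τ (γ t, a t))))) t ∧
        (a t).comp ((D.f (γ t)).comp (a t).adjoint) = η := by
  have hk' : (1 : WithTop ℕ∞) ≤ k := by exact_mod_cast hk
  have hΓ : ContDiffAt ℝ 1 (fun z : E × (V →L[ℝ] V) => D.Γ z.1) (x₀, a₀) :=
    ContDiffAt.comp (x₀, a₀) (g := D.Γ)
      ((D.contDiffOn_Γ.contDiffAt (nhds hx₀)).of_le hk') contDiffAt_fst
  have hdY : ContDiffAt ℝ 1 (fun z : E × (V →L[ℝ] V) => D.dY z.1) (x₀, a₀) :=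
    ContDiffAt.comp (x₀, a₀) (g := D.dY)
      ((D.contDiffOn_dY.contDiffAt (nhds hx₀)).of_le (hk'.trans le_self_add)) contDiffAt_fst
  -- Base point and frame are solved for together, since the velocity τ may depend on the frame: it
  -- does for horizontal lifts of geodesics.
  have hF : ContDiffAt ℝ 1 (fun z : E × (V →L[ℝ] V) =>
      (τ z, z.2.comp (D.Γ z.1 (D.dY z.1 (τ z))))) (x₀, a₀) :=
    hτ.prodMk (contDiffAt_snd.clm_comp (hΓ.clm_apply (hdY.clm_apply hτ)))
  obtain ⟨ε, hε, α, hα, hα1, hd⟩ := exists_integralCurve_contDiffAt hF T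
  have hT : T ∈ Ioo (T - ε) (T + ε) := ⟨by linarith, by linarith⟩
  have hW : ∀ᶠ t in 𝓝 T, (α t).1 ∈ D.W := by
    have : ContinuousAt (fun t => (α t).1) T := continuousAt_fst.comp hα1.continuousAt
    refine this.eventually (nhds ?_)
    simpa [hα] using hx₀
  obtain ⟨δ, hδ, hδ'⟩ := Metric.eventually_nhds_iff_ball.1 hW
  have hsub : ∀ t ∈ Ioo (T - min ε δ) (T + min ε δ), t ∈ Ioo (T - ε) (T + ε) ∧ (α t).1 ∈ D.W := by
    intro t ht
    have h1 := min_le_left ε δ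
    have h2 := min_le_right ε δ
    refine ⟨⟨by linarith [ht.1], by linarith [ht.2]⟩, hδ' t ?_⟩
    rw [Real.ball_eq_Ioo]
    exact ⟨by linarith [ht.1], by linarith [ht.2]⟩
  have hx' : ∀ t ∈ Ioo (T - min ε δ) (T + min ε δ),
      HasDerivAt (fun t => (α t).1) (τ (α t)) t := fun t ht => (hd t (hsub t ht).1).fst
  have ha' : ∀ t ∈ Ioo (T - min ε δ) (T + min ε δ), HasDerivAt (fun t => (α t).2)
      ((α t).2.comp (D.Γ (α t).1 (D.dY (α t).1 (τ (α t))))) t := fun t ht => (hd t (hsub t ht).1).snd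
  -- The derivative of a f a* along a parallel frame is a (Γ f + f Γ* + df) a*, which vanishes by
  -- compatibility; so the frame stays orthonormal.
  have hq : ∀ t ∈ Ioo (T - min ε δ) (T + min ε δ), HasDerivAt
      (fun t => (α t).2.comp ((D.f (α t).1).comp (α t).2.adjoint)) 0 t := by
    intro t ht
    have hW := (hsub t ht).2
    convert hasDerivAt_frame_gram hW (hx' t ht) (ha' t ht) using 1
    have h := Γ_compat hW (τ (α t))
    rw [ContinuousLinearMap.adjoint_comp]
    have h' := congrArg (fun Q : V →L[ℝ] V => (α t).2.comp (Q.comp (α t).2.adjoint)) h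
    ext v
    have h2 := congrArg (fun Q : V →L[ℝ] V => Q v) h'
    simp only [ContinuousLinearMap.comp_apply, _root_.add_apply, _root_.neg_apply, map_add,
      map_neg, _root_.zero_apply] at h2 ⊢
    linear_combination (norm := module) (-1 : ℝ) • h2
  refine ⟨min ε δ, lt_min hε hδ, fun t => (α t).1, fun t => (α t).2, by simp [hα], by simp [hα],
    contDiffAt_fst.comp T hα1, contDiffAt_snd.comp T hα1, fun t ht => ⟨(hsub t ht).2, hx' t ht,
      ha' t ht, ?_⟩⟩
  have hmin : 0 < min ε δ := lt_min hε hδ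
  have := isOpen_Ioo.is_const_of_deriv_eq_zero (isPreconnected_Ioo)
    (fun t ht => (hq t ht).differentiableAt.differentiableWithinAt)
    (fun t ht => (hq t ht).deriv) ht (y := T) ⟨by linarith, by linarith⟩
  simp only [hα] at this
  rw [← ha₀, ← this]

/-- The tangent space of the bundle of orthonormal frames. -/
def frameTangent (D : BundleLikeChart E V k) (η : V →L[ℝ] V) (x : E) (p : E →L[ℝ] V) :
    Set (E × (E →L[ℝ] V)) :=
  {v | ∃ A : V →L[ℝ] V, A.comp η + η.comp A.adjoint = 0 ∧ v.2 = D.lift x p v.1 + A.comp p}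

/-- Differentiating p = a ∘ dY and a f a* = η along the curve, the deviation from parallelism A =
(a' - a Γ) a⁻¹ satisfies A η + η A* = 0, by compatibility of Γ with f. -/
theorem mem_frameTangent_of_hasDerivAt (hη : ∀ v, η (η v) = v) (hη' : η.adjoint = η)
    {c : ℝ → E × (E →L[ℝ] V)} {v : E × (E →L[ℝ] V)} {t : ℝ}
    (hc : HasDerivAt c v t) (hS : ∀ᶠ τ in 𝓝 t, c τ ∈ D.frames η) :
    v ∈ D.frameTangent η (c t).1 (c t).2 := by
  have hx : (c t).1 ∈ D.W := hS.self_of_nhds.1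
  have hc1 : HasDerivAt (fun τ => (c τ).1) v.1 t := hc.fst
  have hc2 : HasDerivAt (fun τ => (c τ).2) v.2 t := hc.snd
  have hs : HasDerivAt (fun τ => D.s (c τ).1) (fderiv ℝ D.s (c t).1 v.1) t :=
    HasFDerivAt.comp_hasDerivAt (l := D.s) t ((D.contDiffOn_s.contDiffAt (nhds hx)).differentiableAt
      (by simp)).hasFDerivAt hc1
  obtain ⟨a', ha⟩ : ∃ a', HasDerivAt (fun τ => (c τ).2.comp (D.s (c τ).1)) a' t :=
    ⟨_, hc2.clm_comp hs⟩
  obtain ⟨a, ha1, ha2, ha3⟩ := exists_of_mem_frames (x := (c t).1) (p := (c t).2) hS.self_of_nhds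
  have h1 := hasDerivAt_comp_dY hx hc1 ha
  have h2 := hasDerivAt_frame_gram hx hc1 ha
  have e1 : (fun τ => ((c τ).2.comp (D.s (c τ).1)).comp (D.dY (c τ).1)) =ᶠ[𝓝 t]
      fun τ => (c τ).2 := by
    filter_upwards [hS] with τ hτ using eq_comp_dY hτ.1 hτ.2.1
  have e2 : (fun τ => ((c τ).2.comp (D.s (c τ).1)).comp
      ((D.f (c τ).1).comp ((c τ).2.comp (D.s (c τ).1)).adjoint)) =ᶠ[𝓝 t] fun _ => η := by
    filter_upwards [hS] with τ hτ
    obtain ⟨a, rfl, -, h⟩ := exists_of_mem_frames (x := (c τ).1) (p := (c τ).2) hτ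
    exact h
  have d1 := hc2.unique (h1.congr_of_eventuallyEq e1.symm)
  have d2 := (hasDerivAt_const t η).unique (h2.congr_of_eventuallyEq e2.symm)
  simp only [ha1] at d1 d2
  have hli := frame_left_inv hη ha3
  set b : V →L[ℝ] V := (D.f (c t).1).comp (a.adjoint.comp η) with hb
  have hba : ∀ v, b (a v) = v := hli
  have hbη : b.comp η = (D.f (c t).1).comp a.adjoint := by
    ext v; simp [hb, hη]
  set Γ := D.Γ (c t).1 (D.dY (c t).1 v.1) with hΓ
  have hcompat := Γ_compat hx v.1
  rw [← hΓ] at hcompat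
  refine ⟨(a' - a.comp Γ).comp b, ?_, ?_⟩
  · rw [ContinuousLinearMap.adjoint_comp, ContinuousLinearMap.comp_assoc, hbη]
    have : η.comp (b.adjoint.comp (a' - a.comp Γ).adjoint) =
        a.comp ((D.f (c t).1).comp (a' - a.comp Γ).adjoint) := by
      rw [← ContinuousLinearMap.comp_assoc]
      have h3 := congrArg (fun T : V →L[ℝ] V => T.adjoint) hbη
      simp only [ContinuousLinearMap.adjoint_comp, hη', ContinuousLinearMap.adjoint_adjoint,
        f_adjoint hx] at h3
      rw [h3, ContinuousLinearMap.comp_assoc]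
    rw [this, map_sub, ContinuousLinearMap.adjoint_comp]
    ext w
    have h4 := congrArg (fun T : V →L[ℝ] V => T w) d2
    have h5 := congrArg (fun T : V →L[ℝ] V => a (T (a.adjoint w))) hcompat
    simp only [ContinuousLinearMap.comp_apply, _root_.add_apply, _root_.neg_apply, map_add, map_sub,
      map_neg, _root_.zero_apply, _root_.sub_apply] at h4 h5 ⊢
    linear_combination (norm := module) (-1 : ℝ) • h5 - (1 : ℝ) • h4
  · rw [d1, ← ha2, lift_comp_dY hx]
    ext e
    simp only [ContinuousLinearMap.comp_apply, _root_.add_apply, map_add, hba, _root_.sub_apply]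
    rw [← hΓ]
    abel

/-- With e = exp(tA), the derivative of e η e* is e (A η + η A*) e* = 0. -/
theorem exp_smul_comp_comp_adjoint {A : V →L[ℝ] V} (hA : A.comp η + η.comp A.adjoint = 0) (t : ℝ) :
    (NormedSpace.exp (t • A)).comp (η.comp (NormedSpace.exp (t • A)).adjoint) = η := by
  let ex : ℝ → V →L[ℝ] V := fun t => NormedSpace.exp (t • A)
  have hex' : ∀ t, HasDerivAt ex (ex t * A) t := fun t => hasDerivAt_exp_smul_const A t
  have hex0 : ex 0 = 1 := by simp [ex]
  have hd : ∀ t, HasDerivAt (fun t => (ex t).comp (η.comp (ex t).adjoint)) 0 t := by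
    intro t
    have h2 : HasDerivAt (fun τ => adjL V (ex τ)) (adjL V (ex t * A)) t :=
      (adjL V).hasFDerivAt.comp_hasDerivAt t (hex' t)
    refine HasDerivAt.congr_deriv ((hex' t).clm_comp ((hasDerivAt_const t η).clm_comp h2)) ?_
    have h3 := congrArg (fun Q : V →L[ℝ] V => (ex t).comp (Q.comp (ex t).adjoint)) hA
    rw [adjL_apply, ContinuousLinearMap.mul_def, ContinuousLinearMap.adjoint_comp]
    ext w
    have h4 := congrArg (fun Q : V →L[ℝ] V => Q w) h3
    simp only [ContinuousLinearMap.comp_apply, _root_.add_apply, map_add, _root_.zero_apply,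
      map_zero] at h4 ⊢
    simp [h4]
  have := is_const_of_deriv_eq_zero (fun t => (hd t).differentiableAt) (fun t => (hd t).deriv) t 0
  refine this.trans ?_
  rw [hex0]
  ext w
  change η ((1 : V →L[ℝ] V).adjoint w) = η w
  congr 1
  exact ext_inner_right ℝ fun z => by rw [ContinuousLinearMap.adjoint_inner_left]; rfl

/-- The curve is exp(tA) a(t) dY(γ t), where a is parallel along a curve γ of constant velocity
`v.1`: the parallel frame produces the horizontal part and the exponential the vertical part. With
the converse inclusion above, the tangent spaces are found without an implicit function theorem. -/
theorem exists_curve_of_mem_frameTangent (hk : 1 ≤ k) (h : (x, p) ∈ D.frames η)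
    {v : E × (E →L[ℝ] V)} (hv : v ∈ D.frameTangent η x p) :
    ∃ c : ℝ → E × (E →L[ℝ] V), c 0 = (x, p) ∧ ContDiffAt ℝ 1 c 0 ∧ HasDerivAt c v 0 ∧
      ∀ᶠ t in 𝓝 0, c t ∈ D.frames η := by
  obtain ⟨A, hA, hv2⟩ := hv
  obtain ⟨a₀, -, rfl, ha₀⟩ := exists_of_mem_frames h
  have hk' : (1 : WithTop ℕ∞) ≤ k := by exact_mod_cast hk
  have hx : x ∈ D.W := h.1
  obtain ⟨ε, hε, γ, a, hγ0, ha0, hγc, hac, hd⟩ :=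
    exists_parallel_curve hk (contDiffAt_const (c := v.1)) hx ha₀ 0
  have h0 : (0 : ℝ) ∈ Ioo (0 - ε) (0 + ε) := ⟨by linarith, by linarith⟩
  obtain ⟨-, hγ', ha', -⟩ := hd 0 h0
  let ex : ℝ → V →L[ℝ] V := fun t => NormedSpace.exp (t • A)
  have hex : ∀ t, HasDerivAt ex (A * ex t) t := fun t => hasDerivAt_exp_smul_const' A t
  have hexc : ContDiff ℝ 1 ex :=
    contDiff_one_iff_deriv.2 ⟨fun t => (hex t).differentiableAt, by
      have : deriv ex = fun t => A * ex t := funext fun t => (hex t).deriv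
      rw [this]
      exact continuous_const.mul
        (continuous_iff_continuousAt.2 fun t => (hex t).continuousAt)⟩
  have hex0 : ex 0 = 1 := by simp [ex]
  have hexη : ∀ t, (ex t).comp (η.comp (ex t).adjoint) = η := exp_smul_comp_comp_adjoint hA
  have hea : ContDiffAt ℝ 1 (fun t => (ex t).comp (a t)) 0 := hexc.contDiffAt.clm_comp hac
  have hea' : HasDerivAt (fun t => (ex t).comp (a t))
      (A.comp a₀ + a₀.comp (D.Γ x (D.dY x v.1))) 0 := by
    have := (hex 0).clm_comp ha'
    simp only [hex0, hγ0, ha0, mul_one] at this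
    exact this
  refine ⟨fun t => (γ t, ((ex t).comp (a t)).comp (D.dY (γ t))), ?_, ?_, ?_, ?_⟩
  · simp only [hγ0, ha0, hex0]; rfl
  · refine hγc.prodMk (hea.clm_comp ?_)
    refine ContDiffAt.comp (g := D.dY) 0 ?_ hγc
    rw [hγ0]
    exact (D.contDiffOn_dY.contDiffAt (nhds hx)).of_le (hk'.trans le_self_add)
  · have h5 := hγ'.prodMk (hasDerivAt_comp_dY (by rwa [hγ0]) hγ' hea')
    convert h5 using 1
    refine Prod.ext rfl ?_
    rw [hv2, lift_comp_dY hx]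
    simp only [hγ0, ha0, hex0]
    ext e
    simp only [ContinuousLinearMap.comp_apply, _root_.add_apply, map_add]
    change _ = _ + a₀ _
    abel
  · filter_upwards [isOpen_Ioo.mem_nhds h0] with t ht
    obtain ⟨hW, -, -, h6⟩ := hd t ht
    refine comp_dY_mem_frames hW ?_
    rw [ContinuousLinearMap.adjoint_comp]
    refine Eq.trans ?_ (hexη t)
    rw [← h6]
    rfl

end BundleLikeChart
/-! ### Submersions whose differential is orthonormal to first order -/

namespace BundleLikeChart

variable {E V : Type*} [NormedAddCommGroup E] [NormedSpace ℝ E] [FiniteDimensional ℝ E]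
  [NormedAddCommGroup V] [InnerProductSpace ℝ V] [FiniteDimensional ℝ V] {k : ℕ∞}
  {D : BundleLikeChart E V k} {x : E} {p : E →L[ℝ] V} {η : V →L[ℝ] V}

section Submersion

variable {y : E → V}

/-- The map m is the Jacobian of the transition from Y to y on the leaf space. The symmetry of its
derivative m' follows from that of D²y and D²Y after removing m D²Y. -/
theorem exists_fderiv_transition (hx : x ∈ D.W) (hy : ContDiffAt ℝ 2 y x)
    (hker : ∀ᶠ z in 𝓝 x, ∀ e, D.dY z e = 0 → fderiv ℝ y z e = 0) :
    ∃ (m : E → V →L[ℝ] V) (m' : E →L[ℝ] V →L[ℝ] V), HasFDerivAt m m' x ∧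
      m x = (fderiv ℝ y x).comp (D.s x) ∧
      (∀ᶠ z in 𝓝 x, fderiv ℝ y z = (m z).comp (D.dY z)) ∧
      (∀ w, fderiv ℝ (fderiv ℝ y) x w = (m' w).comp (D.dY x) + (m x).comp (D.d2Y x w)) ∧
      ∀ v w, m' v (D.dY x w) = m' w (D.dY x v) := by
  have h1 : HasFDerivAt (fderiv ℝ y) (fderiv ℝ (fderiv ℝ y) x) x :=
    ((hy.fderiv_right (m := 1) (by norm_num)).differentiableAt one_ne_zero).hasFDerivAt
  have hs : HasFDerivAt D.s (fderiv ℝ D.s x) x :=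
    ((D.contDiffOn_s.contDiffAt (nhds hx)).differentiableAt (by simp)).hasFDerivAt
  have hm := h1.clm_comp hs
  have heq : ∀ᶠ z in 𝓝 x, fderiv ℝ y z = ((fderiv ℝ y z).comp (D.s z)).comp (D.dY z) := by
    filter_upwards [hker, nhds hx] with z hz hzW using (eq_comp_dY hzW hz).symm
  have h2 := (hm.clm_comp (hasFDerivAt_dY hx)).congr_of_eventuallyEq heq
  have h3 : ∀ w, fderiv ℝ (fderiv ℝ y) x w = _ := fun w =>
    congrArg (fun T : E →L[ℝ] E →L[ℝ] V => T w) h2.fderiv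
  refine ⟨_, _, hm, rfl, heq, fun w => ?_, fun v w => ?_⟩
  · rw [h3]
    simp only [_root_.add_apply, ContinuousLinearMap.comp_apply, ContinuousLinearMap.compL_apply,
      ContinuousLinearMap.flip_apply, ContinuousLinearMap.add_comp]
    abel
  · have h4 : IsSymmSndFDerivAt ℝ y x := hy.isSymmSndFDerivAt (by simp)
    have h5 := h4 v w
    rw [h3, h3] at h5
    have h6 := d2Y_symm hx v w
    simp only [_root_.add_apply, ContinuousLinearMap.comp_apply, ContinuousLinearMap.compL_apply,
      ContinuousLinearMap.flip_apply, h6, add_right_inj] at h5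
    simpa using h5

/-- In leaf directions the symmetry of m' forces m'(w) = 0, and the Christoffel term vanishes as dY
w = 0; both sides are m D²Y(w). Hence the lifted foliation does not depend on the submersion and is
the horizontal lift of TF. -/
theorem fderiv_fderiv_eq_lift_of_mem_ker (hx : x ∈ D.W) (hy : ContDiffAt ℝ 2 y x)
    (hker : ∀ᶠ z in 𝓝 x, ∀ e, D.dY z e = 0 → fderiv ℝ y z e = 0) {w : E} (hw : D.dY x w = 0) :
    fderiv ℝ (fderiv ℝ y) x w = D.lift x (fderiv ℝ y x) w := by
  obtain ⟨m, m', -, hmx, -, h2, hsymm⟩ := exists_fderiv_transition hx hy hker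
  have h0 : m' w = 0 := by
    ext v
    have := hsymm w (D.s x v)
    rw [dY_s hx, hw, map_zero] at this
    exact this
  rw [h2, h0, lift_apply, hw, hmx]
  simp

/-- If the metric read through y is constant to first order at x, then a⁻¹ m' s is a symmetric map
compatible with f, hence equals Γ by uniqueness. This describes the connection without reference to
a chart. -/
theorem fderiv_fderiv_eq_lift (hη : ∀ v, η (η v) = v) (hy : ContDiffAt ℝ 2 y x)
    (hker : ∀ᶠ z in 𝓝 x, ∀ e, D.dY z e = 0 → fderiv ℝ y z e = 0)
    (hmem : (x, fderiv ℝ y x) ∈ D.frames η)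
    (hgram : HasFDerivAt (fun z => gram (D.G z) (fderiv ℝ y z)) (0 : E →L[ℝ] V →L[ℝ] V) x) (w : E) :
    fderiv ℝ (fderiv ℝ y) x w = D.lift x (fderiv ℝ y x) w := by
  have hx := hmem.1
  obtain ⟨m, m', hm, hmx, heq, h2, hsymm⟩ := exists_fderiv_transition hx hy hker
  obtain ⟨a, ha1, ha2, ha3⟩ := exists_of_mem_frames hmem
  rw [ha1] at hmx
  have hainv := frame_isInvertible hη ha3
  have hm'_ker : ∀ w, D.dY x w = 0 → m' w = 0 := by
    intro w hw
    ext v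
    have := hsymm w (D.s x v)
    rw [dY_s hx, hw, map_zero] at this
    exact this
  have hm's : ∀ w, m' (D.s x (D.dY x w)) = m' w := by
    intro w
    have := hm'_ker (D.s x (D.dY x w) - w) (by rw [map_sub, dY_s hx, sub_self])
    rwa [map_sub, sub_eq_zero] at this
  have hmadj : HasFDerivAt (fun z => adjL V (m z)) ((adjL V).comp m') x :=
    (adjL V).hasFDerivAt.comp x hm
  have hd := hm.clm_comp ((hasFDerivAt_f hx).clm_comp hmadj)
  have heq' : (fun z => gram (D.G z) (fderiv ℝ y z)) =ᶠ[𝓝 x]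
      fun z => (m z).comp ((D.f z).comp (adjL V (m z))) := by
    filter_upwards [heq, nhds hx] with z hz hzW
    rw [hz, gram_comp (D.inv z hzW)]
    rfl
  have hd0 := (hgram.congr_of_eventuallyEq heq'.symm).unique hd
  let Γ' : V →L[ℝ] V →L[ℝ] V :=
    (ContinuousLinearMap.compL ℝ V V V a.inverse).comp (m'.comp (D.s x))
  have hΓ'a : ∀ w, a.comp (Γ' (D.dY x w)) = m' w := by
    intro w
    ext v
    change a (a.inverse (m' (D.s x (D.dY x w)) v)) = _
    rw [hainv.self_apply_inverse, hm's]
  have hΓ' : Γ' = D.Γ x := by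
    refine Γ_unique hx (fun v w => ?_) fun w => ?_
    · have := hsymm (D.s x v) (D.s x w)
      rw [dY_s hx, dY_s hx] at this
      exact congrArg a.inverse this
    · have h3 := congrArg (fun T : E →L[ℝ] V →L[ℝ] V => T w) hd0
      simp only [_root_.add_apply, ContinuousLinearMap.comp_apply, ContinuousLinearMap.compL_apply,
        ContinuousLinearMap.flip_apply, adjL_apply, _root_.zero_apply, hmx, ← hΓ'a,
        ContinuousLinearMap.adjoint_comp] at h3
      have ha' : Function.Surjective a.adjoint := by
        intro v
        obtain ⟨b, hb⟩ : ∃ b : V →L[ℝ] V, b.comp a = ContinuousLinearMap.id ℝ V :=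
          ⟨_, hainv.inverse_comp_self⟩
        refine ⟨b.adjoint v, ext_inner_right ℝ fun z => ?_⟩
        rw [ContinuousLinearMap.adjoint_inner_left, ContinuousLinearMap.adjoint_inner_left]
        exact congrArg (fun T : V →L[ℝ] V => inner ℝ v (T z)) hb
      ext v
      obtain ⟨v', rfl⟩ := ha' v
      apply hainv.injective
      have h4 := congrArg (fun T : V →L[ℝ] V => T v') h3
      simp only [_root_.add_apply, ContinuousLinearMap.comp_apply, _root_.zero_apply, map_add,
        _root_.neg_apply, map_neg] at h4 ⊢
      linear_combination (norm := module) (-1 : ℝ) • h4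
  rw [h2, hmx]
  conv_rhs => rw [← ha2]
  rw [lift_comp_dY hx, ← hΓ', ← hΓ'a]
  ext e
  simp only [_root_.add_apply, ContinuousLinearMap.comp_apply, map_add]
  abel

/-- Normal coordinates to second order: y = a(Δ + ½ Γ_x(Δ, Δ)) with Δ = Y - Y(x). Then dy = a(1 +
Γ_x(Δ)) dY, and the derivative of its matrix at x is a(Γ f + df + f Γ*)a* = 0. As Γ is frozen at x,
y is as smooth as Y. -/
theorem exists_submersion_of_mem_frames (hη : ∀ v, η (η v) = v) (hmem : (x, p) ∈ D.frames η) :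
    ∃ (O : Set E) (y : E → V), IsOpen O ∧ x ∈ O ∧ O ⊆ D.W ∧
      ContDiffOn ℝ ((k : WithTop ℕ∞) + 2) y O ∧
      (∀ z ∈ O, Function.Surjective (fderiv ℝ y z) ∧ ∀ e, fderiv ℝ y z e = 0 ↔ D.dY z e = 0) ∧
      fderiv ℝ y x = p ∧
      HasFDerivAt (fun z => gram (D.G z) (fderiv ℝ y z)) (0 : E →L[ℝ] V →L[ℝ] V) x := by
  have hx := hmem.1
  obtain ⟨a, -, rfl, ha3⟩ := exists_of_mem_frames hmem
  have hainv := frame_isInvertible hη ha3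
  let m : E → V →L[ℝ] V := fun z => a.comp (ContinuousLinearMap.id ℝ V + D.Γ x (D.Y z - D.Y x))
  let y : E → V := fun z =>
    a ((D.Y z - D.Y x) + (1 / 2 : ℝ) • D.Γ x (D.Y z - D.Y x) (D.Y z - D.Y x))
  have hY := fun z (hz : z ∈ D.W) => (hasFDerivAt_Y hz).sub_const (D.Y x)
  have hyd : ∀ z ∈ D.W, fderiv ℝ y z = (m z).comp (D.dY z) := by
    intro z hz
    have h1 := ((D.Γ x).hasFDerivAt.comp z (hY z hz)).clm_apply (hY z hz)
    have h2 : HasFDerivAt y _ z := a.hasFDerivAt.comp z ((hY z hz).add (h1.const_smul (1 / 2 : ℝ)))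
    rw [h2.fderiv]
    ext e
    have h3 := Γ_symm hx (D.dY z e) (D.Y z - D.Y x)
    simp only [_root_.add_apply, ContinuousLinearMap.comp_apply, _root_.smul_apply,
      ContinuousLinearMap.flip_apply, m, Function.comp_apply, ContinuousLinearMap.id_apply]
    congr 2
    rw [h3]
    module
  have hm : HasFDerivAt m ((ContinuousLinearMap.compL ℝ V V V a).comp ((D.Γ x).comp (D.dY x))) x := by
    have h1 := ((D.Γ x).hasFDerivAt.comp x (hY x hx)).const_add (ContinuousLinearMap.id ℝ V)
    exact ((ContinuousLinearMap.compL ℝ V V V a).hasFDerivAt.comp x h1)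
  have hmx : m x = a := by
    ext v
    simp [m]
  have hminv : ∀ᶠ z in 𝓝 x, (m z).IsInvertible := by
    obtain ⟨e, he⟩ := hainv
    have : range ((↑) : (V ≃L[ℝ] V) → V →L[ℝ] V) ∈ 𝓝 (m x) := by
      rw [hmx]
      exact he ▸ ContinuousLinearEquiv.nhds e
    exact hm.continuousAt.preimage_mem_nhds this
  obtain ⟨O, hO, hOo, hxO⟩ := mem_nhds_iff.1 (Filter.inter_mem hminv (nhds hx))
  refine ⟨O, y, hOo, hxO, fun z hz => (hO hz).2, ?_, fun z hz => ⟨?_, fun e => ?_⟩, ?_, ?_⟩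
  · have h1 : ContDiffOn ℝ ((k : WithTop ℕ∞) + 2) (fun z => D.Y z - D.Y x) O :=
      (D.contDiffOn_Y.mono fun z hz => (hO hz).2).sub contDiffOn_const
    exact a.contDiff.comp_contDiffOn
      (h1.add (contDiffOn_const.smul (((D.Γ x).contDiff.comp_contDiffOn h1).clm_apply h1)))
  · rw [hyd z (hO hz).2]
    intro v
    obtain ⟨v', rfl⟩ := (hO hz).1.surjective v
    exact ⟨D.s z v', congrArg (m z) (dY_s (hO hz).2 v')⟩
  · rw [hyd z (hO hz).2]
    exact (hO hz).1.injective.eq_iff' (map_zero _)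
  · rw [hyd x hx, hmx]
  · have hmadj : HasFDerivAt (fun z => adjL V (m z)) ((adjL V).comp _) x :=
      (adjL V).hasFDerivAt.comp x hm
    have hd := hm.clm_comp ((hasFDerivAt_f hx).clm_comp hmadj)
    have heq' : (fun z => gram (D.G z) (fderiv ℝ y z)) =ᶠ[𝓝 x]
        fun z => (m z).comp ((D.f z).comp (adjL V (m z))) := by
      filter_upwards [nhds hx] with z hzW
      rw [hyd z hzW, gram_comp (D.inv z hzW)]
      rfl
    refine (hd.congr_of_eventuallyEq heq').congr_fderiv ?_
    ext w v
    have h := congrArg (fun T : V →L[ℝ] V => a (T (a.adjoint v))) (Γ_compat hx w)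
    simp only [_root_.add_apply, ContinuousLinearMap.comp_apply, ContinuousLinearMap.compL_apply,
      ContinuousLinearMap.flip_apply, adjL_apply, _root_.zero_apply, hmx, map_add, map_neg,
      ContinuousLinearMap.adjoint_comp, _root_.neg_apply] at h ⊢
    linear_combination (norm := module) (1 : ℝ) • h

end Submersion

/-! ### Standard horizontal and vertical fields -/

/-- The standard vector field on the bundle of coframes given by `ξ` and `A`. -/
noncomputable def stdField (D : BundleLikeChart E V k) (η : V →L[ℝ] V) (ξ : V) (A : V →L[ℝ] V)
    (c : E × (E →L[ℝ] V)) : E × (E →L[ℝ] V) :=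
  (raise (D.G c.1) c.2 (η ξ), D.lift c.1 c.2 (raise (D.G c.1) c.2 (η ξ)) + A.comp c.2)

theorem contDiffOn_comp_fst {F : Type*} [NormedAddCommGroup F] [NormedSpace ℝ F] {g : E → F}
    {m : WithTop ℕ∞} (hg : ContDiffOn ℝ m g D.W) :
    ContDiffOn ℝ m (fun c : E × (E →L[ℝ] V) => g c.1) (D.W ×ˢ univ) :=
  hg.comp contDiffOn_fst fun _ hc => hc.1

theorem contDiffOn_stdField (ξ : V) (A : V →L[ℝ] V) :
    ContDiffOn ℝ k (D.stdField η ξ A) (D.W ×ˢ univ) := by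
  have hsnd : ContDiffOn ℝ k (fun c : E × (E →L[ℝ] V) => c.2) (D.W ×ˢ univ) := contDiffOn_snd
  have hu : ContDiffOn ℝ k (fun c : E × (E →L[ℝ] V) => raise (D.G c.1) c.2 (η ξ)) (D.W ×ˢ univ) :=
    ((contDiffOn_comp_fst (D.contDiffOn_G.of_le le_self_add)).raise (fun c hc => D.inv _ hc.1) hsnd).clm_apply
      contDiffOn_const
  have hdY := contDiffOn_comp_fst (D.contDiffOn_dY.of_le le_self_add)
  have hs := contDiffOn_comp_fst (D.contDiffOn_s.of_le le_self_add)
  have hd2 := contDiffOn_comp_fst D.contDiffOn_d2Y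
  have hΓ := contDiffOn_comp_fst D.contDiffOn_Γ
  refine hu.prodMk (ContDiffOn.add ?_ (contDiffOn_const.clm_comp hsnd))
  exact (hsnd.clm_comp hs).clm_comp
    ((hd2.clm_apply hu).add ((hΓ.clm_apply (hdY.clm_apply hu)).clm_comp hdY))

theorem apply_raise_of_mem_frames (hη : ∀ v, η (η v) = v) (hmem : (x, p) ∈ D.frames η) (ξ : V) :
    p (raise (D.G x) p (η ξ)) = ξ := by
  rw [← gram_apply, hmem.2.2, hη]

theorem dY_raise (hx : x ∈ D.W) (a : V →L[ℝ] V) (v : V) :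
    D.dY x (raise (D.G x) (a.comp (D.dY x)) v) = D.f x (a.adjoint v) := by
  rw [raise_comp (D.inv x hx)]; rfl

theorem stdField_mem_frameTangent {ξ : V} {A : V →L[ℝ] V}
    (hA : A.comp η + η.comp A.adjoint = 0) (c : E × (E →L[ℝ] V)) :
    D.stdField η ξ A c ∈ D.frameTangent η c.1 c.2 :=
  ⟨A, hA, rfl⟩

/-- Coordinates adapted to the lifted foliation: the first two components are first integrals and
the third one vanishes on the bundle of frames. -/
noncomputable def frameCoord (D : BundleLikeChart E V k) (c : E × (E →L[ℝ] V)) :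
    V × (V →L[ℝ] V) × (E →L[ℝ] V) :=
  (D.Y c.1, c.2.comp (D.s c.1), c.2 - (c.2.comp (D.s c.1)).comp (D.dY c.1))

theorem contDiffOn_frameCoord :
    ContDiffOn ℝ ((k : WithTop ℕ∞) + 1) D.frameCoord (D.W ×ˢ univ) := by
  have hsnd : ContDiffOn ℝ ((k : WithTop ℕ∞) + 1)
    (fun c : E × (E →L[ℝ] V) => c.2) (D.W ×ˢ univ) := contDiffOn_snd
  have h2 := hsnd.clm_comp (contDiffOn_comp_fst D.contDiffOn_s)
  exact (contDiffOn_comp_fst (D.contDiffOn_Y.of_le (by gcongr; exact one_le_two))).prodMk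
    (h2.prodMk (hsnd.sub (h2.clm_comp (contDiffOn_comp_fst D.contDiffOn_dY))))

theorem fderiv_frameCoord (hx : x ∈ D.W) (a : V →L[ℝ] V) (v : E × (E →L[ℝ] V)) :
    fderiv ℝ D.frameCoord (x, a.comp (D.dY x)) v =
      (D.dY x v.1, v.2.comp (D.s x) - (a.comp (D.d2Y x v.1)).comp (D.s x),
        v.2 - (v.2.comp (D.s x) - (a.comp (D.d2Y x v.1)).comp (D.s x)).comp (D.dY x)
          - a.comp (D.d2Y x v.1)) := by
  have hs : HasFDerivAt D.s (fderiv ℝ D.s x) x :=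
    ((D.contDiffOn_s.contDiffAt (nhds hx)).differentiableAt (by simp)).hasFDerivAt
  -- Differentiating dY ∘ s = id removes the derivative of s from the final formula.
  have hdYs : (D.d2Y x v.1).comp (D.s x) + (D.dY x).comp (fderiv ℝ D.s x v.1) = 0 := by
    have h1 := (hasFDerivAt_dY hx).clm_comp hs
    have h2 : (fun z => (D.dY z).comp (D.s z)) =ᶠ[𝓝 x] fun _ => ContinuousLinearMap.id ℝ V := by
      filter_upwards [nhds hx] with z hz
      ext w
      exact dY_s hz w
    have h3 := (h1.congr_of_eventuallyEq h2.symm).unique (hasFDerivAt_const _ x)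
    have h4 := congrArg (fun T : E →L[ℝ] V →L[ℝ] V => T v.1) h3
    simp only [_root_.add_apply, ContinuousLinearMap.comp_apply, ContinuousLinearMap.compL_apply,
      ContinuousLinearMap.flip_apply, _root_.zero_apply] at h4
    rw [add_comm]
    exact h4
  let c₀ : E × (E →L[ℝ] V) := (x, a.comp (D.dY x))
  have hfst : HasFDerivAt (fun c : E × (E →L[ℝ] V) => c.1) (ContinuousLinearMap.fst ℝ _ _) c₀ :=
    hasFDerivAt_fst
  have hsnd : HasFDerivAt (fun c : E × (E →L[ℝ] V) => c.2) (ContinuousLinearMap.snd ℝ _ _) c₀ :=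
    hasFDerivAt_snd
  have hs' : HasFDerivAt (fun c : E × (E →L[ℝ] V) => D.s c.1) _ c₀ :=
    HasFDerivAt.comp (g := D.s) c₀ hs hfst
  have hY' : HasFDerivAt (fun c : E × (E →L[ℝ] V) => D.Y c.1) _ c₀ :=
    HasFDerivAt.comp (g := D.Y) c₀ (hasFDerivAt_Y hx) hfst
  have hdY' : HasFDerivAt (fun c : E × (E →L[ℝ] V) => D.dY c.1) _ c₀ :=
    HasFDerivAt.comp (g := D.dY) c₀ (hasFDerivAt_dY hx) hfst
  have h2 := hsnd.clm_comp hs'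
  have h3 := hY'.prodMk (h2.prodMk (hsnd.sub (h2.clm_comp hdY')))
  have h4 : HasFDerivAt D.frameCoord _ c₀ := h3
  rw [h4.fderiv]
  have hcomp : (a.comp (D.dY x)).comp (fderiv ℝ D.s x v.1) =
      - (a.comp (D.d2Y x v.1)).comp (D.s x) := by
    have h5 := eq_neg_of_add_eq_zero_right hdYs
    rw [ContinuousLinearMap.comp_assoc, h5]
    ext w
    simp
  have e2 : (a.comp (D.dY x)).comp (fderiv ℝ D.s x v.1) + v.2.comp (D.s x) =
      v.2.comp (D.s x) - (a.comp (D.d2Y x v.1)).comp (D.s x) := by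
    rw [hcomp, neg_add_eq_sub]
  have e3 := comp_dY_comp_s hx a
  refine Prod.ext rfl (Prod.ext e2 ?_)
  change v.2 - (((a.comp (D.dY x)).comp (D.s x)).comp (D.d2Y x v.1) +
    (((a.comp (D.dY x)).comp (fderiv ℝ D.s x v.1)) + v.2.comp (D.s x)).comp (D.dY x)) = _
  rw [e2, e3]
  exact sub_add_eq_sub_sub_swap _ _ _

/-- The D²Y terms cancel, so a vector tangent to the frame bundle is seen only through dY w, a, Γ
and A. In particular leafwise horizontal vectors are killed. -/
theorem fderiv_frameCoord_lift (hx : x ∈ D.W) (a : V →L[ℝ] V) (w : E) (A : V →L[ℝ] V) :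
    fderiv ℝ D.frameCoord (x, a.comp (D.dY x))
      (w, D.lift x (a.comp (D.dY x)) w + A.comp (a.comp (D.dY x))) =
      (D.dY x w, a.comp (D.Γ x (D.dY x w)) + A.comp a, 0) := by
  rw [fderiv_frameCoord hx, lift_comp_dY hx]
  have e2 : (a.comp (D.d2Y x w + (D.Γ x (D.dY x w)).comp (D.dY x)) +
      A.comp (a.comp (D.dY x))).comp (D.s x) - (a.comp (D.d2Y x w)).comp (D.s x) =
      a.comp (D.Γ x (D.dY x w)) + A.comp a := by
    ext v
    simp only [_root_.sub_apply, _root_.add_apply, ContinuousLinearMap.comp_apply, map_add, dY_s hx]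
    abel
  refine Prod.ext rfl (Prod.ext e2 ?_)
  change _ - (((a.comp (D.d2Y x w + (D.Γ x (D.dY x w)).comp (D.dY x)) +
      A.comp (a.comp (D.dY x))).comp (D.s x) - (a.comp (D.d2Y x w)).comp (D.s x))).comp (D.dY x)
      - a.comp (D.d2Y x w) = 0
  rw [e2]
  ext e
  simp only [_root_.sub_apply, _root_.add_apply, ContinuousLinearMap.comp_apply, map_add,
    _root_.zero_apply]
  abel

/-- This is [X,Z]Φ = X(ZΦ) - Z(XΦ); the second derivatives of Φ cancel by symmetry, so Φ need only
be C² and the fields differentiable at the point. -/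
theorem lieBracket_apply_fderiv {F F' : Type*} [NormedAddCommGroup F] [NormedSpace ℝ F]
    [NormedAddCommGroup F'] [NormedSpace ℝ F'] {Φ : F → F'} {X Z : F → F} {c : F}
    (hΦ : ContDiffAt ℝ 2 Φ c) (hX : DifferentiableAt ℝ X c) (hZ : DifferentiableAt ℝ Z c) :
    fderiv ℝ Φ c (lieBracket ℝ X Z c) = fderiv ℝ (fun z => fderiv ℝ Φ z (Z z)) c (X c)
      - fderiv ℝ (fun z => fderiv ℝ Φ z (X z)) c (Z c) := by
  have h1 : HasFDerivAt (fderiv ℝ Φ) (fderiv ℝ (fderiv ℝ Φ) c) c :=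
    ((hΦ.fderiv_right (m := 1) (by norm_num)).differentiableAt one_ne_zero).hasFDerivAt
  have hs : IsSymmSndFDerivAt ℝ Φ c := hΦ.isSymmSndFDerivAt (by simp)
  rw [(h1.clm_apply hZ.hasFDerivAt).fderiv, (h1.clm_apply hX.hasFDerivAt).fderiv, lieBracket]
  simp [hs (X c) (Z c)]

/-- A vector field on the bundle of frames which is standard along the frames is basic. -/
theorem lieBracket_stdField (hk : 1 ≤ k) {c₀ : E × (E →L[ℝ] V)}
    (hc₀ : c₀ ∈ D.frames η) {X Z : E × (E →L[ℝ] V) → E × (E →L[ℝ] V)}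
    (hX : DifferentiableAt ℝ X c₀) (hZ : DifferentiableAt ℝ Z c₀)
    (hXS : ∀ᶠ c in 𝓝 c₀, c ∈ D.frames η → D.dY c.1 (X c).1 = 0 ∧ (X c).2 = D.lift c.1 c.2 (X c).1)
    {ξ : V} {A : V →L[ℝ] V} (hA : A.comp η + η.comp A.adjoint = 0)
    (hZS : ∀ᶠ c in 𝓝 c₀, c ∈ D.frames η → Z c = D.stdField η ξ A c) :
    D.dY c₀.1 (lieBracket ℝ X Z c₀).1 = 0 ∧
      (lieBracket ℝ X Z c₀).2 = D.lift c₀.1 c₀.2 (lieBracket ℝ X Z c₀).1 := by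
  have hx := hc₀.1
  have hnhds : D.W ×ˢ univ ∈ 𝓝 c₀ := (D.isOpen.prod isOpen_univ).mem_nhds ⟨hx, mem_univ _⟩
  have hΦ : ContDiffAt ℝ 2 D.frameCoord c₀ := (contDiffOn_frameCoord.contDiffAt hnhds).of_le (by
      calc (2 : WithTop ℕ∞) = 1 + 1 := one_add_one_eq_two.symm
        _ ≤ k + 1 := by gcongr; exact_mod_cast hk)
  have hΦ' : DifferentiableAt ℝ (fderiv ℝ D.frameCoord) c₀ :=
    (hΦ.fderiv_right (m := 1) (by norm_num)).differentiableAt one_ne_zero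
  have hXT : X c₀ ∈ D.frameTangent η c₀.1 c₀.2 := by
    refine ⟨0, by simp, ?_⟩
    rw [(hXS.self_of_nhds hc₀).2]
    simp
  have hZT : Z c₀ ∈ D.frameTangent η c₀.1 c₀.2 := by
    rw [hZS.self_of_nhds hc₀]
    exact stdField_mem_frameTangent hA c₀
  have hXΦ : ∀ c ∈ D.frames η, ∀ v : E × (E →L[ℝ] V), D.dY c.1 v.1 = 0 →
      v.2 = D.lift c.1 c.2 v.1 → fderiv ℝ D.frameCoord c v = 0 := by
    rintro ⟨x, p⟩ hc ⟨w, v2⟩ hw hv2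
    obtain ⟨a, -, rfl, -⟩ := exists_of_mem_frames hc
    simp only at hv2 hw
    have := fderiv_frameCoord_lift hc.1 a w 0
    rw [hw] at this
    rw [hv2]
    refine Eq.trans ?_ (show ((0, 0, 0) : V × (V →L[ℝ] V) × (E →L[ℝ] V)) = 0 from rfl)
    simpa only [map_zero, ContinuousLinearMap.comp_zero, ContinuousLinearMap.zero_comp,
      add_zero] using this
  -- XΦ vanishes only on the frame bundle, but Z is tangent to it there, so the derivative can be
  -- taken along a curve of frames with velocity Z.
  have h1 : fderiv ℝ (fun z => fderiv ℝ D.frameCoord z (X z)) c₀ (Z c₀) = 0 := by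
    obtain ⟨c, hc0, -, hc', hcS⟩ := exists_curve_of_mem_frameTangent hk hc₀ hZT
    have hd : HasFDerivAt (fun z => fderiv ℝ D.frameCoord z (X z)) _ (c 0) :=
      (show c 0 = c₀ from hc0) ▸ (hΦ'.clm_apply hX).hasFDerivAt
    have h2 := hd.comp_hasDerivAt 0 hc'
    have hcc : Filter.Tendsto c (𝓝 0) (𝓝 c₀) := by
      have := hc'.continuousAt.tendsto
      rwa [show c 0 = c₀ from hc0] at this
    have h3 : (fun z => fderiv ℝ D.frameCoord z (X z)) ∘ c =ᶠ[𝓝 0] fun _ => 0 := by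
      filter_upwards [hcS, hcc.eventually hXS] with t ht htX
      exact hXΦ _ ht _ (htX ht).1 (htX ht).2
    have h4 := (h2.congr_of_eventuallyEq h3.symm).unique (hasDerivAt_const (0 : ℝ) _)
    rwa [show c 0 = c₀ from hc0] at h4
  -- Along a curve of frames with velocity X, ZΦ is an expression in f, Γ and a; each has zero
  -- derivative because X is leafwise.
  have h2 : fderiv ℝ (fun z => fderiv ℝ D.frameCoord z (Z z)) c₀ (X c₀) = 0 := by
    obtain ⟨c, hc0, -, hc', hcS⟩ := exists_curve_of_mem_frameTangent hk hc₀ hXT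
    have hc0' : c 0 = c₀ := hc0
    have hd : HasFDerivAt (fun z => fderiv ℝ D.frameCoord z (Z z)) _ (c 0) :=
      hc0' ▸ (hΦ'.clm_apply hZ).hasFDerivAt
    have h2 := hd.comp_hasDerivAt 0 hc'
    have hcc : Filter.Tendsto c (𝓝 0) (𝓝 c₀) := by
      have := hc'.continuousAt.tendsto
      rwa [hc0'] at this
    have hx0 : (c 0).1 = c₀.1 := by rw [hc0']
    have hw0 : D.dY c₀.1 (X c₀).1 = 0 := (hXS.self_of_nhds hc₀).1
    have hc1 : HasDerivAt (fun t => (c t).1) (X c₀).1 0 := hc'.fst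
    have hdΓ : HasDerivAt (fun t => D.Γ (c t).1) 0 0 := by
      obtain ⟨hΓ, hΓ0⟩ := fderiv_Γ_eq_zero hk hx hw0
      have := HasFDerivAt.comp_hasDerivAt (l := D.Γ) 0 (hx0.symm ▸ hΓ) hc1
      rw [hx0, hΓ0] at this
      exact this
    have hdf : HasDerivAt (fun t => D.f (c t).1) 0 0 := by
      have := HasFDerivAt.comp_hasDerivAt (l := D.f) 0 (hx0.symm ▸ hasFDerivAt_f hx) hc1
      rw [hx0, ← df_s_dY hx, hw0, map_zero] at this
      exact this
    have hda : HasDerivAt (fun t => (c t).2.comp (D.s (c t).1)) 0 0 := by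
      have hfc : HasFDerivAt D.frameCoord (fderiv ℝ D.frameCoord c₀) (c 0) :=
        hc0' ▸ (hΦ.differentiableAt two_ne_zero).hasFDerivAt
      have h5 := hfc.comp_hasDerivAt 0 hc'
      rw [hXΦ c₀ hc₀ _ hw0 (hXS.self_of_nhds hc₀).2] at h5
      exact h5.snd.fst
    let a : ℝ → V →L[ℝ] V := fun t => (c t).2.comp (D.s (c t).1)
    let om : ℝ → V := fun t => D.f (c t).1 (adjL V (a t) (η ξ))
    have hom : HasDerivAt om 0 0 := by
      have h6 : HasDerivAt (fun t => adjL V (a t)) 0 0 := by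
        have := (adjL V).hasFDerivAt.comp_hasDerivAt 0 hda
        rwa [map_zero] at this
      refine HasDerivAt.congr_deriv (hdf.clm_apply (h6.clm_apply (hasDerivAt_const 0 (η ξ)))) ?_
      simp
    have hζ : HasDerivAt (fun t => ((om t, (a t).comp (D.Γ (c t).1 (om t)) + A.comp (a t), 0) :
        V × (V →L[ℝ] V) × (E →L[ℝ] V))) 0 0 := by
      have h7 := (hda.clm_comp (hdΓ.clm_apply hom)).add ((hasDerivAt_const 0 A).clm_comp hda)
      refine HasDerivAt.congr_deriv (hom.prodMk (h7.prodMk (hasDerivAt_const 0 _))) ?_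
      simp
    have h3 : (fun z => fderiv ℝ D.frameCoord z (Z z)) ∘ c =ᶠ[𝓝 0]
        fun t => (om t, (a t).comp (D.Γ (c t).1 (om t)) + A.comp (a t), 0) := by
      filter_upwards [hcS, hcc.eventually hZS] with t ht htZ
      rw [Function.comp_apply, htZ ht]
      obtain ⟨b, hb1, hb2, hb3⟩ := exists_of_mem_frames (x := (c t).1) (p := (c t).2) ht
      have h8 := fderiv_frameCoord_lift ht.1 b (raise (D.G (c t).1) (c t).2 (η ξ)) A
      rw [hb2] at h8
      have h9 : D.dY (c t).1 (raise (D.G (c t).1) (c t).2 (η ξ)) = om t := by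
        change _ = D.f (c t).1 (((c t).2.comp (D.s (c t).1)).adjoint (η ξ))
        rw [hb1, ← dY_raise ht.1, hb2]
      rw [h9] at h8
      change fderiv ℝ D.frameCoord (c t) _ = (_, ((c t).2.comp (D.s (c t).1)).comp _ +
        A.comp ((c t).2.comp (D.s (c t).1)), _)
      rw [hb1]
      exact h8
    have h4 := (h2.congr_of_eventuallyEq h3.symm).unique hζ
    rwa [hc0'] at h4
  -- So dΦ kills the bracket, and at a frame the kernel of dΦ is exactly the tangent space of the
  -- lifted foliation.
  have h3 := lieBracket_apply_fderiv hΦ hX hZ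
  rw [h1, h2, sub_zero] at h3
  obtain ⟨a, ha1, ha2, ha3⟩ := exists_of_mem_frames (x := c₀.1) (p := c₀.2) hc₀
  have h4 := fderiv_frameCoord hx a (lieBracket ℝ X Z c₀)
  rw [ha2] at h4
  have h5 := h4.symm.trans h3
  have e1 : D.dY c₀.1 (lieBracket ℝ X Z c₀).1 = 0 := congrArg Prod.fst h5
  have e2 := congrArg (fun q => q.2.1) h5
  have e3 := congrArg (fun q => q.2.2) h5
  refine ⟨e1, ?_⟩
  simp only at e2 e3
  rw [e2] at e3
  rw [lift_apply, e1, ha1]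
  simpa [sub_eq_zero] using e3

end BundleLikeChart
/-! ### The geodesic equation -/

section EulerLagrange

variable {E E₂ : Type*} [NormedAddCommGroup E] [NormedSpace ℝ E]
  [NormedAddCommGroup E₂] [NormedSpace ℝ E₂]

/-- The geodesic equation with lowered index: position `x`, velocity `v`, acceleration `a`. -/
noncomputable def eulerLagrange (G : E → E →L[ℝ] E →L[ℝ] ℝ) (x v a w : E) : ℝ :=
  G x a w + fderiv ℝ G x v v w - (1 / 2) * fderiv ℝ G x w v v

/-- Covariance of the geodesic equation. The acceleration acquires D²ψ(v,v); in the derivative of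
the pulled-back metric the terms with D²ψ(v,w) cancel against those with D²ψ(w,v). -/
theorem eulerLagrange_pullback {G : E → E →L[ℝ] E →L[ℝ] ℝ} {G' : E₂ → E₂ →L[ℝ] E₂ →L[ℝ] ℝ}
    {ψ : E → E₂} {x : E} (hψ : ContDiffAt ℝ 2 ψ x) (hG : DifferentiableAt ℝ G x)
    (hG' : DifferentiableAt ℝ G' (ψ x)) (hs : ∀ u v, G' (ψ x) u v = G' (ψ x) v u)
    (h : ∀ᶠ y in 𝓝 x, ∀ u v, G y u v = G' (ψ y) (fderiv ℝ ψ y u) (fderiv ℝ ψ y v)) (v a w : E) :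
    eulerLagrange G x v a w = eulerLagrange G' (ψ x) (fderiv ℝ ψ x v)
      (fderiv ℝ ψ x a + fderiv ℝ (fderiv ℝ ψ) x v v) (fderiv ℝ ψ x w) := by
  have h1 : HasFDerivAt ψ (fderiv ℝ ψ x) x := (hψ.differentiableAt two_ne_zero).hasFDerivAt
  have h2 : HasFDerivAt (fderiv ℝ ψ) (fderiv ℝ (fderiv ℝ ψ) x) x :=
    ((hψ.fderiv_right (m := 1) (by norm_num)).differentiableAt one_ne_zero).hasFDerivAt
  have hsym : IsSymmSndFDerivAt ℝ ψ x := hψ.isSymmSndFDerivAt (by simp)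
  have key : ∀ e u v, fderiv ℝ G x e u v =
      fderiv ℝ G' (ψ x) (fderiv ℝ ψ x e) (fderiv ℝ ψ x u) (fderiv ℝ ψ x v) +
      G' (ψ x) (fderiv ℝ (fderiv ℝ ψ) x e u) (fderiv ℝ ψ x v) +
      G' (ψ x) (fderiv ℝ ψ x u) (fderiv ℝ (fderiv ℝ ψ) x e v) := by
    intro e u v
    have d1 : HasFDerivAt (fun y => G y u v) _ x :=
      (hG.hasFDerivAt.clm_apply (hasFDerivAt_const u x)).clm_apply (hasFDerivAt_const v x)
    have d2 : HasFDerivAt (fun y => G' (ψ y)) _ x :=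
      HasFDerivAt.comp (g := G') x hG'.hasFDerivAt h1
    have d3 := (d2.clm_apply (h2.clm_apply (hasFDerivAt_const u x))).clm_apply
      (h2.clm_apply (hasFDerivAt_const v x))
    have d4 : (fun y => G y u v) =ᶠ[𝓝 x]
        fun y => G' (ψ y) (fderiv ℝ ψ y u) (fderiv ℝ ψ y v) := by
      filter_upwards [h] with y hy using hy u v
    have d5 := congrArg (fun T : E →L[ℝ] ℝ => T e) (d1.unique (d3.congr_of_eventuallyEq d4))
    simp at d5
    rw [d5]
    ring
  have hval := h.self_of_nhds a w
  have e1 := hsym w v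
  simp only [eulerLagrange, key, hval, map_add, _root_.add_apply, e1]
  rw [hs (fderiv ℝ (fderiv ℝ ψ) x v w) (fderiv ℝ ψ x v)]
  ring

/-- The acceleration of the geodesic with initial position and velocity `z`. -/
noncomputable def geodesicAcceleration (G : E → E →L[ℝ] E →L[ℝ] ℝ) (z : E × E) : E :=
  (G z.1).inverse ((1 / 2 : ℝ) • ((fderiv ℝ G z.1).flip z.2).flip z.2 - fderiv ℝ G z.1 z.2 z.2)

theorem eq_geodesicAcceleration {G : E → E →L[ℝ] E →L[ℝ] ℝ} {x v a : E}
    (hi : (G x).IsInvertible) (h : ∀ w, eulerLagrange G x v a w = 0) :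
    a = geodesicAcceleration G (x, v) := by
  apply hi.injective
  rw [geodesicAcceleration, hi.self_apply_inverse]
  ext w
  have := h w
  simp only [eulerLagrange] at this
  simp
  linarith

set_option maxSynthPendingDepth 3 in
theorem contDiffAt_geodesicAcceleration {G : E → E →L[ℝ] E →L[ℝ] ℝ} {W : Set E} (hW : IsOpen W)
    (hG : ContDiffOn ℝ 2 G W) (hi : ∀ x ∈ W, (G x).IsInvertible) {z : E × E} (hz : z.1 ∈ W)
    [CompleteSpace E] :
    ContDiffAt ℝ 1 (geodesicAcceleration G) z := by
  have hz' : W ×ˢ (univ : Set E) ∈ 𝓝 z := (hW.prod isOpen_univ).mem_nhds ⟨hz, mem_univ _⟩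
  have h1 : ContDiffOn ℝ 1 (fun z : E × E => G z.1) (W ×ˢ univ) :=
    (hG.of_le one_le_two).comp contDiffOn_fst fun z hz => hz.1
  have h2 : ContDiffOn ℝ 1 (fun z : E × E => fderiv ℝ G z.1) (W ×ˢ univ) :=
    (hG.fderiv_of_isOpen hW (m := 1) (by norm_num)).comp contDiffOn_fst fun z hz => hz.1
  have h3 : ContDiffOn ℝ 1 (fun z : E × E => z.2) (W ×ˢ univ) := contDiffOn_snd
  have h4 : ContDiffOn ℝ 1 (fun z : E × E => (fderiv ℝ G z.1).flip z.2) (W ×ˢ univ) :=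
    ((ContinuousLinearMap.flipₗᵢ ℝ E E (E →L[ℝ] ℝ)).toContinuousLinearEquiv.contDiff.comp_contDiffOn
      h2).clm_apply h3
  have h5 : ContDiffOn ℝ 1 (fun z : E × E => ((fderiv ℝ G z.1).flip z.2).flip z.2) (W ×ˢ univ) :=
    ((ContinuousLinearMap.flipₗᵢ ℝ E E ℝ).toContinuousLinearEquiv.contDiff.comp_contDiffOn
      h4).clm_apply h3
  exact ((h1.clm_inverse fun z hz => hi _ hz.1).clm_apply
    (((contDiffOn_const (c := (1 / 2 : ℝ))).smul h5).sub ((h2.clm_apply h3).clm_apply h3))).contDiffAt hz'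

/-- Position and velocity determine a geodesic: the equation can be solved for the acceleration,
giving a first-order system which is C¹, hence locally Lipschitz, when the metric is C². -/
theorem eventuallyEq_of_eulerLagrange [CompleteSpace E] {G : E → E →L[ℝ] E →L[ℝ] ℝ} {W : Set E}
    (hW : IsOpen W) (hG : ContDiffOn ℝ 2 G W) (hi : ∀ x ∈ W, (G x).IsInvertible) {T : ℝ}
    {c₁ v₁ a₁ c₂ v₂ a₂ : ℝ → E} (hT : c₁ T ∈ W)
    (h₁ : ∀ᶠ t in 𝓝 T, HasDerivAt c₁ (v₁ t) t ∧ HasDerivAt v₁ (a₁ t) t ∧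
      ∀ w, eulerLagrange G (c₁ t) (v₁ t) (a₁ t) w = 0)
    (h₂ : ∀ᶠ t in 𝓝 T, HasDerivAt c₂ (v₂ t) t ∧ HasDerivAt v₂ (a₂ t) t ∧
      ∀ w, eulerLagrange G (c₂ t) (v₂ t) (a₂ t) w = 0)
    (hc : c₁ T = c₂ T) (hv : v₁ T = v₂ T) :
    (fun t => (c₁ t, v₁ t)) =ᶠ[𝓝 T] fun t => (c₂ t, v₂ t) := by
  let F : E × E → E × E := fun z => (z.2, geodesicAcceleration G z)
  have hF : ContDiffAt ℝ 1 F (c₁ T, v₁ T) :=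
    contDiffAt_snd.prodMk (contDiffAt_geodesicAcceleration hW hG hi hT)
  obtain ⟨K, s, hs, hl⟩ := hF.exists_lipschitzOnWith
  have key : ∀ {c v a : ℝ → E}, c T = c₁ T → v T = v₁ T →
      (∀ᶠ t in 𝓝 T, HasDerivAt c (v t) t ∧ HasDerivAt v (a t) t ∧
        ∀ w, eulerLagrange G (c t) (v t) (a t) w = 0) →
      ∀ᶠ t in 𝓝 T, HasDerivAt (fun t => (c t, v t)) (F (c t, v t)) t ∧ (c t, v t) ∈ s := by
    intro c v a hc hv h
    have h0 := h.self_of_nhds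
    have hcont : ContinuousAt (fun t => (c t, v t)) T :=
      h0.1.continuousAt.prodMk h0.2.1.continuousAt
    have hs' : ∀ᶠ t in 𝓝 T, (c t, v t) ∈ s := by
      refine hcont.preimage_mem_nhds ?_
      rwa [hc, hv]
    have hW' : ∀ᶠ t in 𝓝 T, c t ∈ W := by
      refine h0.1.continuousAt.preimage_mem_nhds (hW.mem_nhds ?_)
      rwa [hc]
    filter_upwards [h, hs', hW'] with t ht hts htW
    refine ⟨HasDerivAt.congr_deriv (ht.1.prodMk ht.2.1) ?_, hts⟩
    exact Prod.ext rfl (eq_geodesicAcceleration (hi _ htW) ht.2.2)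
  exact ODE_solution_unique_of_eventually (v := fun _ => F) (s := fun _ => s) (K := K)
    (Filter.Eventually.of_forall fun _ => hl) (key rfl rfl h₁) (key hc.symm hv.symm h₂)
    (Prod.ext hc hv)

end EulerLagrange

/-! ### Horizontal curves of frames and orthogonal geodesics -/

namespace BundleLikeChart

variable {E V : Type*} [NormedAddCommGroup E] [NormedSpace ℝ E] [FiniteDimensional ℝ E]
  [NormedAddCommGroup V] [InnerProductSpace ℝ V] [FiniteDimensional ℝ V] {k : ℕ∞}
  {D : BundleLikeChart E V k} {x : E} {p : E →L[ℝ] V} {η : V →L[ℝ] V}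

/-- With u = `raise` of lam, differentiate G(u, ·) = ⟨lam, dY ·⟩ at a frozen argument and dY u = f
lam, then eliminate the derivative of u. This expresses the metric term of the geodesic equation by
transverse data. -/
theorem fderiv_G_raise (hx : x ∈ D.W) (lam : V) (e : E) :
    fderiv ℝ D.G x e (raise (D.G x) (D.dY x) lam) (raise (D.G x) (D.dY x) lam) =
      2 * inner ℝ lam (D.d2Y x e (raise (D.G x) (D.dY x) lam)) - inner ℝ lam (D.df x e lam) := by
  set u : E → E := fun z => raise (D.G z) (D.dY z) lam with hu
  have hud : HasFDerivAt u (fderiv ℝ u x) x :=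
    ((((D.contDiffOn_G.raise D.inv D.contDiffOn_dY).clm_apply contDiffOn_const).contDiffAt
      (nhds hx)).differentiableAt (by simp)).hasFDerivAt
  have h1 : HasFDerivAt (fun z => D.G z (u z) (u x)) _ x :=
    ((hasFDerivAt_G hx).clm_apply hud).clm_apply (hasFDerivAt_const (u x) x)
  have h2 : HasFDerivAt (fun z => inner ℝ lam (D.dY z (u x))) _ x :=
    (innerSL ℝ lam).hasFDerivAt.comp x ((hasFDerivAt_dY hx).clm_apply (hasFDerivAt_const (u x) x))
  have h3 : (fun z => D.G z (u z) (u x)) =ᶠ[𝓝 x] fun z => inner ℝ lam (D.dY z (u x)) := by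
    filter_upwards [nhds hx] with z hz using raise_spec (D.inv z hz) _ _ _
  have h4 := congrArg (fun T : E →L[ℝ] ℝ => T e) (h1.unique (h2.congr_of_eventuallyEq h3))
  have h5 : HasFDerivAt (fun z => D.dY z (u z)) _ x := (hasFDerivAt_dY hx).clm_apply hud
  have h6 : HasFDerivAt (fun z => D.f z lam) _ x :=
    (hasFDerivAt_f hx).clm_apply (hasFDerivAt_const lam x)
  have h7 := congrArg (fun T : E →L[ℝ] V => T e) (h5.unique h6)
  have h8 : D.G x (fderiv ℝ u x e) (u x) = inner ℝ lam (D.dY x (fderiv ℝ u x e)) := by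
    rw [D.symm x hx]; exact raise_spec (D.inv x hx) _ _ _
  simp at h4 h7
  rw [h8] at h4
  have h9 := congrArg (fun v => inner ℝ lam v) h7
  simp only [inner_add_right] at h9
  linarith

/-- The curves underlying horizontal curves of frames are geodesics. -/
theorem eulerLagrange_eq_zero_of_parallel {γ v : ℝ → E} {a : ℝ → V →L[ℝ] V} {ζ : V} {t : ℝ} {v' : E}
    (hx : γ t ∈ D.W) (hγ : HasDerivAt γ (v t) t)
    (hv : ∀ᶠ τ in 𝓝 t, v τ = raise (D.G (γ τ)) ((a τ).comp (D.dY (γ τ))) ζ)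
    (hv' : HasDerivAt v v' t)
    (ha : HasDerivAt a ((a t).comp (D.Γ (γ t) (D.dY (γ t) (v t)))) t) (e : E) :
    eulerLagrange D.G (γ t) (v t) v' e = 0 := by
  set lam : V := (a t).adjoint ζ with hlam
  have hvt : v t = raise (D.G (γ t)) (D.dY (γ t)) lam := by
    rw [hv.self_of_nhds, raise_comp (D.inv _ hx)]; rfl
  have h1 : HasDerivAt (fun τ => D.G (γ τ)) _ t := (hasFDerivAt_G hx).comp_hasDerivAt t hγ
  have h2 : HasDerivAt (fun τ => D.G (γ τ) (v τ) e) _ t :=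
    (h1.clm_apply hv').clm_apply (hasDerivAt_const t e)
  have h3 : HasDerivAt (fun τ => (a τ) (D.dY (γ τ) e)) _ t :=
    (hasDerivAt_comp_dY hx hγ ha).clm_apply (hasDerivAt_const t e)
  have h4 : HasDerivAt (fun τ => inner ℝ ζ ((a τ) (D.dY (γ τ) e))) _ t :=
    (innerSL ℝ ζ).hasFDerivAt.comp_hasDerivAt t h3
  have hW : ∀ᶠ τ in 𝓝 t, γ τ ∈ D.W := hγ.continuousAt.preimage_mem_nhds (nhds hx)
  -- The momentum in the fixed direction e is a linear expression in the frame, so parallelism gives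
  -- its derivative. Comparison with the geodesic equation then uses the symmetry of Γ and its
  -- compatibility with f.
  have h5 : (fun τ => D.G (γ τ) (v τ) e) =ᶠ[𝓝 t] fun τ => inner ℝ ζ ((a τ) (D.dY (γ τ) e)) := by
    filter_upwards [hv, hW] with τ hτ hτW
    rw [hτ, raise_spec (D.inv _ hτW)]
    rfl
  have h6 := h2.unique (h4.congr_of_eventuallyEq h5)
  simp at h6
  have h7 := fderiv_G_raise hx lam e
  rw [← hvt] at h7
  have h8 : D.dY (γ t) (v t) = D.f (γ t) lam := by rw [hvt]; rfl
  have h9 := congrArg (fun T : V →L[ℝ] V => inner ℝ lam (T lam)) (Γ_compat hx e)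
  have h10 : inner ℝ lam (D.f (γ t) ((D.Γ (γ t) (D.dY (γ t) e)).adjoint lam)) =
      inner ℝ lam (D.Γ (γ t) (D.dY (γ t) e) (D.f (γ t) lam)) := by
    rw [← ContinuousLinearMap.adjoint_inner_left, f_adjoint hx,
      ContinuousLinearMap.adjoint_inner_right, real_inner_comm]
  simp only [_root_.add_apply, ContinuousLinearMap.comp_apply, _root_.neg_apply, inner_add_right,
    inner_neg_right, h10] at h9
  have h11 : ∀ u, inner ℝ ζ (a t u) = inner ℝ lam u := fun u => by
    rw [hlam, ContinuousLinearMap.adjoint_inner_left]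
  rw [inner_add_right, h11, h11, h8, Γ_symm hx] at h6
  rw [d2Y_symm hx] at h7
  rw [eulerLagrange, h7]
  linarith

theorem comp_mem_frames {A : V →L[ℝ] V} (h : (x, p) ∈ D.frames η)
    (hA : A.comp (η.comp A.adjoint) = η) : (x, A.comp p) ∈ D.frames η := by
  refine ⟨h.1, fun e he => ?_, ?_⟩
  · change A (p e) = 0
    rw [h.2.1 e he, map_zero]
  · rw [gram_comp (D.inv x h.1), h.2.2, hA]

/-- Two frames over the same point differ by an isometry. -/
theorem exists_isometry_of_mem_frames (hη : ∀ v, η (η v) = v) {p' : E →L[ℝ] V}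
    (h : (x, p) ∈ D.frames η) (h' : (x, p') ∈ D.frames η) :
    ∃ A : V →L[ℝ] V, A.comp (η.comp A.adjoint) = η ∧ (∀ v, A.adjoint (η (A v)) = η v) ∧
      A.comp p = p' := by
  obtain ⟨a, -, rfl, ha⟩ := exists_of_mem_frames h
  obtain ⟨a', -, rfl, ha'⟩ := exists_of_mem_frames h'
  set A := a'.comp ((D.f x).comp (a.adjoint.comp η)) with hA
  have hAa : A.comp a = a' := by
    ext v
    simp [hA, frame_left_inv hη ha]
  have hAη : A.comp (η.comp A.adjoint) = η := by
    rw [← hAa, ContinuousLinearMap.adjoint_comp] at ha'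
    exact (congrArg (fun Q : V →L[ℝ] V => A.comp (Q.comp A.adjoint)) ha).symm.trans ha'
  refine ⟨A, hAη, fun v => ?_, by rw [← ContinuousLinearMap.comp_assoc, hAa]⟩
  have h1 : A.comp (η.comp (A.adjoint.comp η)) = ContinuousLinearMap.id ℝ V := by
    ext v
    exact (congrArg (fun T : V →L[ℝ] V => T (η v)) hAη).trans (hη v)
  have h2 := congrArg (fun T : V →L[ℝ] V => η (T v)) (comp_eq_id_comm_of_finiteDimensional h1)
  simpa [hη] using h2

/-- The horizontal lifts of a geodesic which is orthogonal to the foliation. -/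
theorem exists_horizontal_lift (hk : 1 ≤ k) (hη : ∀ v, η (η v) = v) {c v a : ℝ → E} {T : ℝ}
    (hEL : ∀ᶠ t in 𝓝 T, HasDerivAt c (v t) t ∧ HasDerivAt v (a t) t ∧
      ∀ w, eulerLagrange D.G (c t) (v t) (a t) w = 0) {ξ : V}
    (hp : (c T, p) ∈ D.frames η) (hv : v T = raise (D.G (c T)) p (η ξ)) :
    ∃ ε > 0, ∀ t₁ ∈ Ioo (T - ε) (T + ε), ∀ p₁, (c t₁, p₁) ∈ D.frames η →
      ∀ ξ₁, v t₁ = raise (D.G (c t₁)) p₁ (η ξ₁) → ∃ b : ℝ → E →L[ℝ] V, b t₁ = p₁ ∧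
      ∀ t ∈ Ioo (T - ε) (T + ε), (c t, b t) ∈ D.frames η ∧ v t = raise (D.G (c t)) (b t) (η ξ₁) ∧
        HasDerivAt (fun t => (c t, b t)) (D.stdField η ξ₁ 0 (c t, b t)) t := by
  have hk' : (1 : WithTop ℕ∞) ≤ k := by exact_mod_cast hk
  have hk2 : (2 : WithTop ℕ∞) ≤ k + 1 := by
    calc (2 : WithTop ℕ∞) = 1 + 1 := one_add_one_eq_two.symm
      _ ≤ k + 1 := by gcongr
  have hx : c T ∈ D.W := hp.1
  obtain ⟨a₀, -, rfl, ha₀⟩ := exists_of_mem_frames hp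
  let τ : E × (V →L[ℝ] V) → E := fun z => raise (D.G z.1) (z.2.comp (D.dY z.1)) (η ξ)
  have hτ : ∀ z : E × (V →L[ℝ] V), z.1 ∈ D.W → ContDiffAt ℝ 1 τ z := by
    intro z hz
    have hn : D.W ×ˢ (univ : Set (V →L[ℝ] V)) ∈ 𝓝 z :=
      (D.isOpen.prod isOpen_univ).mem_nhds ⟨hz, mem_univ _⟩
    have h1 : ContDiffOn ℝ 1 (fun z : E × (V →L[ℝ] V) => D.G z.1) (D.W ×ˢ univ) :=
      (D.contDiffOn_G.of_le (hk'.trans le_self_add)).comp contDiffOn_fst fun _ h => h.1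
    have h2 : ContDiffOn ℝ 1 (fun z : E × (V →L[ℝ] V) => D.dY z.1) (D.W ×ˢ univ) :=
      (D.contDiffOn_dY.of_le (hk'.trans le_self_add)).comp contDiffOn_fst fun _ h => h.1
    have h3 : ContDiffOn ℝ 1 (fun z : E × (V →L[ℝ] V) => z.2) (D.W ×ˢ univ) := contDiffOn_snd
    exact ((h1.raise (fun z hz => D.inv _ hz.1) (h3.clm_comp h2)).clm_apply
      contDiffOn_const).contDiffAt hn
  -- Instead of transporting a frame along c, solve for a horizontal curve of frames with ξ-vector
  -- as velocity. Its base curve γ is a geodesic with the initial data of c, so it is c; this also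
  -- shows that c stays orthogonal to the leaves.
  obtain ⟨δ, hδ, γ, α, hγ0, hα0, -, -, hd⟩ := exists_parallel_curve hk (hτ (c T, a₀) hx) hx ha₀ T
  let u : ℝ → E := fun t => τ (γ t, α t)
  have hT : T ∈ Ioo (T - δ) (T + δ) := ⟨by linarith, by linarith⟩
  have hu : ∀ t ∈ Ioo (T - δ) (T + δ), HasDerivAt u (deriv u t) t := by
    intro t ht
    obtain ⟨hW, h1, h2, -⟩ := hd t ht
    have h3 : HasDerivAt u _ t := HasFDerivAt.comp_hasDerivAt (l := τ) t
      ((hτ _ hW).differentiableAt one_ne_zero).hasFDerivAt (h1.prodMk h2)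
    exact h3.differentiableAt.hasDerivAt
  have hγ : ∀ᶠ t in 𝓝 T, HasDerivAt γ (u t) t ∧ HasDerivAt u (deriv u t) t ∧
      ∀ w, eulerLagrange D.G (γ t) (u t) (deriv u t) w = 0 := by
    filter_upwards [isOpen_Ioo.mem_nhds hT] with t ht
    obtain ⟨hW, h1, h2, -⟩ := hd t ht
    exact ⟨h1, hu t ht, eulerLagrange_eq_zero_of_parallel hW h1
      (Filter.Eventually.of_forall fun _ => rfl) (hu t ht) h2⟩
  have heq := eventuallyEq_of_eulerLagrange D.isOpen (D.contDiffOn_G.of_le hk2) D.inv hx hEL hγ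
    hγ0.symm (by simp only [u, hγ0, hα0, τ]; exact hv)
  obtain ⟨ε, hε, hεs⟩ := Metric.eventually_nhds_iff_ball.1
    (heq.eventually_nhds.and (isOpen_Ioo.mem_nhds hT))
  rw [Real.ball_eq_Ioo] at hεs
  have hcu : ∀ t ∈ Ioo (T - ε) (T + ε), c t = γ t ∧ v t = u t := fun t ht =>
    ⟨congrArg Prod.fst (hεs t ht).1.self_of_nhds, congrArg Prod.snd (hεs t ht).1.self_of_nhds⟩
  let b : ℝ → E →L[ℝ] V := fun t => (α t).comp (D.dY (c t))
  have hb : ∀ t ∈ Ioo (T - ε) (T + ε), (c t, b t) ∈ D.frames η ∧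
      v t = raise (D.G (c t)) (b t) (η ξ) ∧
      HasDerivAt (fun t => (c t, b t)) (v t, D.lift (c t) (b t) (v t)) t := by
    intro t ht
    obtain ⟨hW, h1, h2, h3⟩ := hd t (hεs t ht).2
    obtain ⟨e1, e2⟩ := hcu t ht
    have hc' : HasDerivAt c (v t) t := by
      rw [e2]
      refine h1.congr_of_eventuallyEq ?_
      filter_upwards [(hεs t ht).1] with s hs using congrArg Prod.fst hs
    rw [← e1] at hW h3
    refine ⟨comp_dY_mem_frames hW h3, by rw [e2]; simp only [u, τ, ← e1, b], ?_⟩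
    have h4 : HasDerivAt α ((α t).comp (D.Γ (c t) (D.dY (c t) (v t)))) t := by
      rw [e1, e2]; exact h2
    have h5 := hasDerivAt_comp_dY hW hc' h4
    refine HasDerivAt.congr_deriv (hc'.prodMk h5) (Prod.ext rfl ?_)
    rw [lift_comp_dY hW]
    ext e
    simp only [_root_.add_apply, ContinuousLinearMap.comp_apply, map_add]
    abel
  refine ⟨ε, hε, fun t₁ ht₁ p₁ hp₁ ξ₁ hv₁ => ?_⟩
  -- Any other initial frame at any time of the interval is an isometry A applied to the frame
  -- already transported, with A ξ = ξ₁. Constant isometries commute with horizontal lifts, so A b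
  -- is the required lift, on the same interval.
  obtain ⟨A, hA, hA', hAp⟩ := exists_isometry_of_mem_frames hη (hb t₁ ht₁).1 hp₁
  have hξ₁ : A ξ = ξ₁ := by
    have h1 := apply_raise_of_mem_frames hη (hb t₁ ht₁).1 ξ
    have h2 := apply_raise_of_mem_frames hη hp₁ ξ₁
    rw [← hv₁, ← hAp] at h2
    rw [← (hb t₁ ht₁).2.1] at h1
    rw [← h2, ← h1]
    rfl
  refine ⟨fun t => A.comp (b t), hAp, fun t ht => ?_⟩
  obtain ⟨h1, h2, h3⟩ := hb t ht
  have h4 : v t = raise (D.G (c t)) (A.comp (b t)) (η ξ₁) := by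
    rw [raise_comp (D.inv _ h1.1), ContinuousLinearMap.comp_apply, ← hξ₁, hA', ← h2]
  refine ⟨comp_mem_frames h1 hA, h4, ?_⟩
  have h5 : HasDerivAt (fun t => A.comp (b t)) _ t := (hasDerivAt_const t A).clm_comp h3.snd
  have h6 : HasDerivAt c (v t) t := h3.fst
  refine HasDerivAt.congr_deriv (h6.prodMk h5) (Prod.ext h4 ?_)
  change (0 : V →L[ℝ] V).comp (b t) + A.comp (D.lift (c t) (b t) (v t)) =
    D.lift (c t) (A.comp (b t)) (raise (D.G (c t)) (A.comp (b t)) (η ξ₁)) +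
      (0 : V →L[ℝ] V).comp (A.comp (b t))
  rw [← h4, ContinuousLinearMap.zero_comp, ContinuousLinearMap.zero_comp, zero_add, add_zero]
  rfl

end BundleLikeChart
/-! ### Vector fields and integral curves in charts -/

section ChartFields

variable {F H P : Type*} [NormedAddCommGroup F] [NormedSpace ℝ F] [TopologicalSpace H]
  {J : ModelWithCorners ℝ F H} [J.Boundaryless] [TopologicalSpace P] [ChartedSpace H P]
  [IsManifold J ∞ P] {p₀ p : P}

/-- A vector field in a chart. -/
noncomputable def chartField (J : ModelWithCorners ℝ F H) (p₀ : P) (X : ∀ p : P, TangentSpace J p)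
    (z : F) : F :=
  mfderiv J 𝓘(ℝ, F) (extChartAt J p₀) ((extChartAt J p₀).symm z) (X ((extChartAt J p₀).symm z))

/-- The vector field with given values in a chart. -/
noncomputable def ofChartField (J : ModelWithCorners ℝ F H) (p₀ : P) (X : F → F) :
    ∀ p : P, TangentSpace J p :=
  mpullback J 𝓘(ℝ, F) (extChartAt J p₀) X

theorem mdifferentiableAt_extChartAt_of_mem (hp : p ∈ (extChartAt J p₀).source) :
    MDifferentiableAt J 𝓘(ℝ, F) (extChartAt J p₀) p :=
  mdifferentiableAt_extChartAt (by rwa [← extChartAt_source J])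

theorem contMDiffAt_extChartAt_symm_of_mem {z : F} (hz : z ∈ (extChartAt J p₀).target) :
    ContMDiffAt 𝓘(ℝ, F) J ∞ (extChartAt J p₀).symm z :=
  (contMDiffOn_extChartAt_symm p₀).contMDiffAt (extChartAt_target_mem_nhds' hz)

theorem mfderiv_extChartAt_symm_apply {z : F} (hz : z ∈ (extChartAt J p₀).target) (v : F) :
    mfderiv J 𝓘(ℝ, F) (extChartAt J p₀) ((extChartAt J p₀).symm z)
      (mfderiv 𝓘(ℝ, F) J (extChartAt J p₀).symm z v) = v := by
  have := mfderiv_extChartAt_comp_mfderivWithin_extChartAt_symm (I := J) hz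
  rw [J.range_eq_univ, mfderivWithin_univ] at this
  exact congrArg (fun T : F →L[ℝ] F => T v) this

theorem mfderiv_symm_extChartAt_apply (hp : p ∈ (extChartAt J p₀).source) (v : TangentSpace J p) :
    (mfderiv 𝓘(ℝ, F) J (extChartAt J p₀).symm (extChartAt J p₀ p) : F →L[ℝ] F)
      (mfderiv J 𝓘(ℝ, F) (extChartAt J p₀) p v) = v := by
  have := mfderivWithin_extChartAt_symm_comp_mfderiv_extChartAt' (I := J) hp
  rw [J.range_eq_univ, mfderivWithin_univ] at this
  exact congrArg (fun T : F →L[ℝ] F => T v) this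

theorem mfderiv_extChartAt_isInvertible (hp : p ∈ (extChartAt J p₀).source) :
    (mfderiv J 𝓘(ℝ, F) (extChartAt J p₀) p).IsInvertible :=
  isInvertible_mfderiv_extChartAt hp

theorem mfderiv_extChartAt_ofChartField (hp : p ∈ (extChartAt J p₀).source) (X : F → F) :
    mfderiv J 𝓘(ℝ, F) (extChartAt J p₀) p (ofChartField J p₀ X p) = X (extChartAt J p₀ p) :=
  (mfderiv_extChartAt_isInvertible hp).self_apply_inverse _

theorem contMDiffAt_ofChartField [CompleteSpace F] {k : ℕ∞} (hp : p ∈ (extChartAt J p₀).source)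
    {X : F → F} (hX : ContDiffAt ℝ k X (extChartAt J p₀ p)) :
    ContMDiffAt J J.tangent k (fun p => (⟨p, ofChartField J p₀ X p⟩ : TangentBundle J P)) p := by
  have h1 : ContMDiffAt J 𝓘(ℝ, F) ∞ (extChartAt J p₀) p :=
    contMDiffOn_extChartAt.contMDiffAt ((chartAt H p₀).open_source.mem_nhds
      (by rwa [← extChartAt_source J]))
  refine ContMDiffAt.mpullback_vectorField_preimage (V := X)
    (contMDiffAt_vectorSpace_iff_contDiffAt.2 hX) h1 (mfderiv_extChartAt_isInvertible hp) ?_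
  exact_mod_cast (le_top : k + 1 ≤ (⊤ : ℕ∞))

theorem inverse_mfderiv_extChartAt_symm {z : F} (hz : z ∈ (extChartAt J p₀).target) :
    (mfderiv 𝓘(ℝ, F) J (extChartAt J p₀).symm z).IsInvertible ∧
      ((mfderiv 𝓘(ℝ, F) J (extChartAt J p₀).symm z : F →L[ℝ] F)).inverse =
      (mfderiv J 𝓘(ℝ, F) (extChartAt J p₀) ((extChartAt J p₀).symm z) : F →L[ℝ] F) := by
  have h1 := isInvertible_mfderivWithin_extChartAt_symm (I := J) hz
  rw [J.range_eq_univ, mfderivWithin_univ] at h1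
  refine ⟨h1, ?_⟩
  have h2 := mfderiv_extChartAt_comp_mfderivWithin_extChartAt_symm (I := J) hz
  have h3 := mfderivWithin_extChartAt_symm_comp_mfderiv_extChartAt (I := J) hz
  rw [J.range_eq_univ, mfderivWithin_univ] at h2 h3
  exact ContinuousLinearMap.inverse_eq h3 h2

theorem mpullback_extChartAt_symm {X : ∀ p : P, TangentSpace J p} {z : F}
    (hz : z ∈ (extChartAt J p₀).target) :
    mpullback 𝓘(ℝ, F) J (extChartAt J p₀).symm X z = chartField J p₀ X z :=
  congrArg (fun T : F →L[ℝ] F => T (X ((extChartAt J p₀).symm z)))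
    (inverse_mfderiv_extChartAt_symm hz).2

theorem contDiffAt_chartField [CompleteSpace F] {k : ℕ∞} {X : ∀ p : P, TangentSpace J p} {z : F}
    (hz : z ∈ (extChartAt J p₀).target)
    (hX : ContMDiffAt J J.tangent k (fun p => (⟨p, X p⟩ : TangentBundle J P))
      ((extChartAt J p₀).symm z)) :
    ContDiffAt ℝ k (chartField J p₀ X) z := by
  have h1 : ContDiffAt ℝ k (mpullback 𝓘(ℝ, F) J (extChartAt J p₀).symm X) z := by
    refine contMDiffAt_vectorSpace_iff_contDiffAt.1 ?_
    refine hX.mpullback_vectorField_preimage (contMDiffAt_extChartAt_symm_of_mem hz)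
      (inverse_mfderiv_extChartAt_symm hz).1 ?_
    exact_mod_cast (le_top : k + 1 ≤ (⊤ : ℕ∞))
  refine h1.congr_of_eventuallyEq ?_
  filter_upwards [extChartAt_target_mem_nhds' hz] with y hy
  exact (mpullback_extChartAt_symm hy).symm

theorem mfderiv_extChartAt_mlieBracket [CompleteSpace F] {X Y : ∀ p : P, TangentSpace J p}
    (hp : p ∈ (extChartAt J p₀).source)
    (hX : MDifferentiableAt J J.tangent (fun p => (⟨p, X p⟩ : TangentBundle J P)) p)
    (hY : MDifferentiableAt J J.tangent (fun p => (⟨p, Y p⟩ : TangentBundle J P)) p) :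
    (mfderiv J 𝓘(ℝ, F) (extChartAt J p₀) p (mlieBracket J X Y p) : F) =
      lieBracket ℝ (chartField J p₀ X) (chartField J p₀ Y) (extChartAt J p₀ p) := by
  have hz := (extChartAt J p₀).map_source hp
  have hpz := (extChartAt J p₀).left_inv hp
  have hP : IsManifold J (minSmoothness ℝ 2) P := by
    rw [minSmoothness_of_isRCLikeNormedField]; infer_instance
  have h1 := mpullback_mlieBracket (I := 𝓘(ℝ, F)) (I' := J) (f := (extChartAt J p₀).symm)
    (V := X) (W := Y) (x₀ := extChartAt J p₀ p) (n := ∞) (by rwa [hpz]) (by rwa [hpz])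
    (contMDiffAt_extChartAt_symm_of_mem hz) (by
      rw [minSmoothness_of_isRCLikeNormedField]; exact WithTop.coe_le_coe.2 le_top)
  rw [mpullback_extChartAt_symm hz] at h1
  have h2 : ∀ X : ∀ p : P, TangentSpace J p,
      mpullback 𝓘(ℝ, F) J (extChartAt J p₀).symm X =ᶠ[𝓝 (extChartAt J p₀ p)]
        chartField J p₀ X := fun X => by
    filter_upwards [extChartAt_target_mem_nhds' hz] with y hy using mpullback_extChartAt_symm hy
  have h3 := Filter.EventuallyEq.lieBracket_vectorField_eq (𝕜 := ℝ) (h2 X) (h2 Y)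
  have h4 : mlieBracket 𝓘(ℝ, F) (mpullback 𝓘(ℝ, F) J (extChartAt J p₀).symm X)
    (mpullback 𝓘(ℝ, F) J (extChartAt J p₀).symm Y) (extChartAt J p₀ p) =
    lieBracket ℝ (mpullback 𝓘(ℝ, F) J (extChartAt J p₀).symm X)
      (mpullback 𝓘(ℝ, F) J (extChartAt J p₀).symm Y) (extChartAt J p₀ p) := by
    rw [← mlieBracketWithin_univ, mlieBracketWithin_eq_lieBracketWithin]
    exact congrFun (lieBracketWithin_univ (𝕜 := ℝ) (E := F)) _
  rw [h4, h3] at h1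
  rw [← h1, chartField, hpz]

theorem hasMFDerivAt_extChartAt_symm_comp {c : ℝ → F} {v : F} {t : ℝ} (hc : HasDerivAt c v t)
    (ht : c t ∈ (extChartAt J p₀).target) {w : TangentSpace J ((extChartAt J p₀).symm (c t))}
    (hw : (mfderiv J 𝓘(ℝ, F) (extChartAt J p₀) ((extChartAt J p₀).symm (c t)) w : F) = v) :
    HasMFDerivAt 𝓘(ℝ, ℝ) J (fun t => (extChartAt J p₀).symm (c t)) t
      ((1 : ℝ →L[ℝ] ℝ).smulRight w) := by
  have h1 := ((contMDiffAt_extChartAt_symm_of_mem ht).mdifferentiableAt (by simp)).hasMFDerivAt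
  have h2 := h1.comp t hc.hasFDerivAt.hasMFDerivAt
  have h3 : (mfderiv 𝓘(ℝ, F) J (extChartAt J p₀).symm (c t) : F →L[ℝ] F) v = w := by
    have := mfderiv_symm_extChartAt_apply ((extChartAt J p₀).map_target ht) w
    rw [(extChartAt J p₀).right_inv ht] at this
    rw [← hw]
    exact this
  refine h2.congr_mfderiv ?_
  refine ContinuousLinearMap.ext fun r => ?_
  let r' : ℝ := r
  exact ((mfderiv 𝓘(ℝ, F) J (extChartAt J p₀).symm (c t) : F →L[ℝ] F).map_smul r' v).trans
    (congrArg (fun u : F => r' • u) h3)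

theorem mem_submanifoldTangent_iff {S : Set P} (hp : p ∈ (extChartAt J p₀).source)
    (v : TangentSpace J p) :
    v ∈ submanifoldTangent J S p ↔ ∃ c : ℝ → F, c 0 = extChartAt J p₀ p ∧ ContDiffAt ℝ 1 c 0 ∧
      HasDerivAt c (mfderiv J 𝓘(ℝ, F) (extChartAt J p₀) p v : F) 0 ∧
      ∀ᶠ t in 𝓝 0, (extChartAt J p₀).symm (c t) ∈ S := by
  constructor
  · rintro ⟨c, hc, hS, h⟩
    obtain rfl : c 0 = p := congrArg TotalSpace.proj h
    obtain rfl : mfderiv 𝓘(ℝ, ℝ) J c 0 (1 : ℝ) = v := TotalSpace.mk_inj.1 h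
    have h1 : ContMDiffAt J 𝓘(ℝ, F) 1 (extChartAt J p₀) (c 0) :=
      contMDiffOn_extChartAt.contMDiffAt ((chartAt H p₀).open_source.mem_nhds
        (by rwa [← extChartAt_source J]))
    refine ⟨fun t => extChartAt J p₀ (c t), rfl, (h1.comp 0 hc).contDiffAt, ?_, ?_⟩
    · have h2 := (mdifferentiableAt_extChartAt_of_mem hp).hasMFDerivAt.comp 0
        (hc.mdifferentiableAt one_ne_zero).hasMFDerivAt
      obtain ⟨A, hA, hA1⟩ : ∃ A : ℝ →L[ℝ] F, HasFDerivAt (fun t => extChartAt J p₀ (c t)) A 0 ∧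
          A 1 = mfderiv J 𝓘(ℝ, F) (extChartAt J p₀) (c 0) (mfderiv 𝓘(ℝ, ℝ) J c 0 (1 : ℝ)) :=
        ⟨_, h2.hasFDerivAt, rfl⟩
      have h3 := hA.hasDerivAt
      rw [hA1] at h3
      exact h3
    · filter_upwards [hS, hc.continuousAt.preimage_mem_nhds
        (extChartAt_source_mem_nhds' (I := J) hp)] with t ht ht'
      rwa [(extChartAt J p₀).left_inv ht']
  · rintro ⟨c, hc0, hc, hd, hS⟩
    have hz : c 0 ∈ (extChartAt J p₀).target := hc0 ▸ (extChartAt J p₀).map_source hp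
    have h0 : (extChartAt J p₀).symm (c 0) = p := by rw [hc0, (extChartAt J p₀).left_inv hp]
    refine ⟨fun t => (extChartAt J p₀).symm (c t), ?_, hS, ?_⟩
    · exact ((contMDiffAt_extChartAt_symm_of_mem hz).of_le (by exact_mod_cast le_top)).comp 0
        hc.contMDiffAt
    · subst h0
      have h1 := hasMFDerivAt_extChartAt_symm_comp hd hz (w := v) rfl
      rw [h1.mfderiv]
      exact congrArg (fun w : F => (⟨(extChartAt J p₀).symm (c 0), w⟩ : TangentBundle J P))
        (one_smul ℝ (v : F))

theorem isMIntegralCurveOn_extChartAt_symm {X : ∀ p : P, TangentSpace J p} {c : ℝ → F} {s : Set ℝ}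
    (hc : ∀ t ∈ s, c t ∈ (extChartAt J p₀).target)
    (hd : ∀ t ∈ s, HasDerivAt c (chartField J p₀ X (c t)) t) :
    IsMIntegralCurveOn (fun t => (extChartAt J p₀).symm (c t)) X s := by
  intro t ht
  exact (hasMFDerivAt_extChartAt_symm_comp (hd t ht) (hc t ht) rfl).hasMFDerivWithinAt

end ChartFields

/-! ### Global integral curves from local ones -/

section GlobalCurves

variable {F H P : Type*} [NormedAddCommGroup F] [NormedSpace ℝ F] [TopologicalSpace H]
  {J : ModelWithCorners ℝ F H} [TopologicalSpace P] [ChartedSpace H P] [IsManifold J 1 P]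
  [T2Space P] [BoundarylessManifold J P] {X : ∀ p : P, TangentSpace J p}

/-- Integral curves with a time-dependent property are global when they exist locally, uniformly
with respect to the initial value. -/
theorem exists_isMIntegralCurve_of_local
    (hX : ContMDiff J J.tangent 1 fun p => (⟨p, X p⟩ : TangentBundle J P)) {Q : ℝ → P → Prop}
    (hloc : ∀ T : ℝ, ∃ ε > 0, ∀ t₁ ∈ Ioo (T - ε) (T + ε), ∀ p, Q t₁ p → ∃ c : ℝ → P, c t₁ = p ∧
      IsMIntegralCurveOn c X (Ioo (T - ε) (T + ε)) ∧ ∀ t ∈ Ioo (T - ε) (T + ε), Q t (c t))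
    {p : P} (hp : Q 0 p) :
    ∃ c : ℝ → P, c 0 = p ∧ IsMIntegralCurve c X ∧ ∀ t, Q t (c t) := by
  classical
  let R : ℝ → ℝ → Prop := fun a b => ∃ c : ℝ → P, c 0 = p ∧ IsMIntegralCurveOn c X (Ioo a b) ∧
    ∀ t ∈ Ioo a b, Q t (c t)
  have mono : ∀ {a b a' b'}, R a b → a ≤ a' → b' ≤ b → R a' b' := by
    rintro a b a' b' ⟨c, h1, h2, h3⟩ ha hb
    exact ⟨c, h1, h2.mono (Ioo_subset_Ioo ha hb), fun t ht => h3 t (Ioo_subset_Ioo ha hb ht)⟩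
  -- The property Q at time t₁ permits a restart there on the whole interval around T; integral
  -- curves that agree at t₁ agree on the overlap and can be pasted.
  have glue : ∀ {a b T ε t₁}, R a b → 0 ∈ Ioo a b → t₁ ∈ Ioo a b → t₁ ∈ Ioo (T - ε) (T + ε) →
      (∀ t₁ ∈ Ioo (T - ε) (T + ε), ∀ p, Q t₁ p → ∃ c : ℝ → P, c t₁ = p ∧
      IsMIntegralCurveOn c X (Ioo (T - ε) (T + ε)) ∧ ∀ t ∈ Ioo (T - ε) (T + ε), Q t (c t)) →
      ∀ {a' b'}, Ioo a' b' ⊆ Ioo a b ∪ Ioo (T - ε) (T + ε) → R a' b' := by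
    rintro a b T ε t₁ ⟨c, h1, h2, h3⟩ h0 ht₁ ht₁' hT a' b' hs
    obtain ⟨c', h1', h2', h3'⟩ := hT t₁ ht₁' (c t₁) (h3 t₁ ht₁)
    refine ⟨piecewise (Ioo a b) c c', by rw [piecewise_eq_of_mem _ _ _ h0, h1],
      (isMIntegralCurveOn_piecewise hX h2 h2' ⟨ht₁, ht₁'⟩ h1'.symm).mono hs, fun t ht => ?_⟩
    by_cases h : t ∈ Ioo a b
    · rw [piecewise_eq_of_mem _ _ _ h]; exact h3 t h
    · rw [piecewise_eq_of_notMem _ _ _ h]; exact h3' t ((hs ht).resolve_left h)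
  have all : ∀ a > 0, R (-a) a := by
    by_contra! hcon
    obtain ⟨a₁, ha₁, hna₁⟩ := hcon
    obtain ⟨ε₀, hε₀, hloc₀⟩ := hloc 0
    obtain ⟨c₀, hc₀, hc₀', hc₀''⟩ := hloc₀ 0 ⟨by linarith, by linarith⟩ p hp
    have hR₀ : R (-ε₀) ε₀ := mono ⟨c₀, hc₀, hc₀', hc₀''⟩ (by linarith) (by linarith)
    let A : Set ℝ := {a | 0 < a ∧ R (-a) a}
    have hA : ∀ a ∈ A, a ≤ a₁ := by
      intro a ha
      by_contra! hlt
      exact hna₁ (mono ha.2 (by linarith) (by linarith))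
    have hAb : BddAbove A := ⟨a₁, hA⟩
    have hε₀A : ε₀ ∈ A := ⟨hε₀, hR₀⟩
    have hb : ε₀ ≤ sSup A := le_csSup hAb hε₀A
    set b := sSup A with hbdef
    obtain ⟨ε₁, hε₁, h₁⟩ := hloc b
    obtain ⟨ε₂, hε₂, h₂⟩ := hloc (-b)
    obtain ⟨a, haA, ha⟩ := exists_lt_of_lt_csSup ⟨ε₀, hε₀A⟩
      (show b - min ε₁ ε₂ / 2 < sSup A by
        have := lt_min hε₁ hε₂
        linarith)
    have hm1 := min_le_left ε₁ ε₂
    have hm2 := min_le_right ε₁ ε₂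
    have hm := lt_min hε₁ hε₂
    set m := min ε₁ ε₂ with hmdef
    have hab : a ≤ b := le_csSup hAb haA
    have ha0 := haA.1
    obtain ⟨t₁, ht₁, ht₁'⟩ := exists_between (show max 0 (b - m) < a from
      max_lt ha0 (by linarith))
    have ht₁0 : 0 < t₁ := (le_max_left _ _).trans_lt ht₁
    have ht₁m : b - m < t₁ := (le_max_right _ _).trans_lt ht₁
    -- Here b is the supremum of the admissible half-lengths, and t₁ lies within m of b but below a.
    -- The local curves near b and near -b extend the solution past both ends by the same m,
    -- contradicting the choice of b.
    have R1 : R (-a) (b + m) := by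
      refine glue (t₁ := t₁) haA.2 ⟨by linarith, by linarith⟩ ⟨by linarith, by linarith⟩
        ⟨by linarith, by linarith⟩ h₁ ?_
      intro t ht
      by_cases h : t < a
      · exact Or.inl ⟨ht.1, h⟩
      · push Not at h
        exact Or.inr ⟨by linarith, by linarith [ht.2]⟩
    have R2 : R (-(b + m)) (b + m) := by
      refine glue (t₁ := -t₁) R1 ⟨by linarith, by linarith⟩ ⟨by linarith, by linarith⟩
        ⟨by linarith, by linarith⟩ h₂ ?_
      intro t ht
      by_cases h : -a < t
      · exact Or.inl ⟨h, ht.2⟩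
      · push Not at h
        exact Or.inr ⟨by linarith [ht.1], by linarith⟩
    have : b + m ≤ b := le_csSup hAb ⟨by linarith, R2⟩
    linarith
  have : Nonempty P := ⟨p⟩
  -- By uniqueness the curves on the intervals (-a, a) are compatible; evaluating at t the one with
  -- a = |t| + 1 gives a global curve.
  choose! c h1 h2 h3 using all
  refine ⟨fun t => c (|t| + 1) t, ?_, ?_, fun t => h3 _ (by positivity) t ?_⟩
  · exact h1 _ (by positivity)
  · have := isMIntegralCurve_abs_add_one_of_isMIntegralCurveOn_Ioo hX (x := p)
      (fun a => if 0 < a then c a else fun _ => p)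
      (fun a => by by_cases ha : 0 < a <;> simp [ha, h1])
      (fun a ha => by simpa [ha] using h2 a ha)
    have heq : (fun t => (if 0 < |t| + 1 then c (|t| + 1) else fun _ => p) t) =
        fun t => c (|t| + 1) t := by
      funext t
      rw [if_pos (by positivity)]
    rwa [heq] at this
  · rw [mem_Ioo, ← abs_lt]
    exact lt_add_one _

end GlobalCurves

/-! ### Total spaces of vector bundles -/

section TotalSpace

theorem FiberBundle.totalSpace_t2Space {B F : Type*} {E : B → Type*} [TopologicalSpace B]
    [TopologicalSpace F] [TopologicalSpace (TotalSpace F E)] [∀ x, TopologicalSpace (E x)]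
    [FiberBundle F E] [T2Space B] [T2Space F] : T2Space (TotalSpace F E) := by
  refine ⟨fun p p' hne => ?_⟩
  by_cases h : p.1 = p'.1
  · let e := trivializationAt F E p.1
    have hp : p ∈ e.source := FiberBundle.mem_trivializationAt_proj_source
    have hp' : p' ∈ e.source := by
      rw [e.mem_source, ← h]
      exact FiberBundle.mem_baseSet_trivializationAt F E p.1
    have hne' : e p ≠ e p' := fun h' => hne (e.injOn hp hp' h')
    obtain ⟨U, V, hU, hV, hpU, hpV, hUV⟩ := t2_separation hne'
    refine ⟨e.source ∩ e ⁻¹' U, e.source ∩ e ⁻¹' V,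
      e.toOpenPartialHomeomorph.isOpen_inter_preimage hU,
      e.toOpenPartialHomeomorph.isOpen_inter_preimage hV, ⟨hp, hpU⟩, ⟨hp', hpV⟩, ?_⟩
    exact (hUV.preimage e).mono inter_subset_right inter_subset_right
  · obtain ⟨U, V, hU, hV, hpU, hpV, hUV⟩ := t2_separation h
    exact ⟨_, _, hU.preimage (FiberBundle.continuous_proj F E),
      hV.preimage (FiberBundle.continuous_proj F E), hpU, hpV, hUV.preimage _⟩

theorem FiberBundle.totalSpace_secondCountableTopology {B F HB : Type*} {E : B → Type*}
    [TopologicalSpace B] [TopologicalSpace F] [TopologicalSpace (TotalSpace F E)]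
    [∀ x, TopologicalSpace (E x)] [FiberBundle F E] [TopologicalSpace HB] [ChartedSpace HB B]
    [SecondCountableTopology B] [SecondCountableTopology F] [SecondCountableTopology HB]
    [∀ x, Nonempty (E x)] :
    SecondCountableTopology (TotalSpace F E) := by
  classical
  have hH : SecondCountableTopology (ModelProd HB F) :=
    inferInstanceAs (SecondCountableTopology (HB × F))
  obtain ⟨s, hs, hsU⟩ := TopologicalSpace.countable_cover_nhds
    (f := fun x : B => (chartAt HB x).source ∩ (trivializationAt F E x).baseSet)
    fun x => Filter.inter_mem (chart_source_mem_nhds HB x)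
      ((trivializationAt F E x).open_baseSet.mem_nhds
        (FiberBundle.mem_baseSet_trivializationAt F E x))
  let o : B → TotalSpace F E := fun x => ⟨x, Classical.arbitrary _⟩
  refine ChartedSpace.secondCountable_of_countable_cover (ModelProd HB F) (s := o '' s) ?_
    (hs.image o)
  rw [eq_univ_iff_forall]
  intro p
  have hp : p.1 ∈ ⋃ x ∈ s, (chartAt HB x).source ∩ (trivializationAt F E x).baseSet := by
    rw [hsU]; trivial
  obtain ⟨x, hx, hpx⟩ := mem_iUnion₂.1 hp
  refine mem_iUnion₂.2 ⟨o x, mem_image_of_mem o hx, ?_⟩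
  rw [FiberBundle.chartedSpace_chartAt]
  simp only [OpenPartialHomeomorph.trans_source, OpenPartialHomeomorph.prod_source, mem_inter_iff,
    mem_preimage, mem_prod, OpenPartialHomeomorph.refl_source, mem_univ, and_true,
    Trivialization.coe_coe]
  have h1 : p ∈ (trivializationAt F E x).source := by
    rw [Trivialization.mem_source]; exact hpx.2
  refine ⟨h1, ?_⟩
  have := (trivializationAt F E x).coe_fst h1
  change ((trivializationAt F E x) p).1 ∈ _
  rw [this]
  exact hpx.1

end TotalSpace
/-! ### Charts of the bundle of coframes -/

namespace Foliation

section CoframeChart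

variable {n q : ℕ} {M : Type*} [TopologicalSpace M] [ChartedSpace (EuclideanSpace ℝ (Fin n)) M]
  [IsManifold (𝓡 n) ∞ M] {x₀ : M} {p : CoframeSpace n M q}

variable (q) in
/-- The chart of the space of coframes given by the preferred chart around `x₀`. -/
noncomputable abbrev coframeChart (x₀ : M) : PartialEquiv (CoframeSpace n M q)
    (EuclideanSpace ℝ (Fin n) × (EuclideanSpace ℝ (Fin n) →L[ℝ] EuclideanSpace ℝ (Fin q))) :=
  extChartAt (coframeModel n q) (⟨x₀, 0⟩ : CoframeSpace n M q)

theorem mem_trivializationAt_coframe_baseSet {x : M} :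
    x ∈ (trivializationAt (EuclideanSpace ℝ (Fin n) →L[ℝ] EuclideanSpace ℝ (Fin q))
      (fun x : M => TangentSpace (𝓡 n) x →L[ℝ] EuclideanSpace ℝ (Fin q)) x₀).baseSet ↔
      x ∈ (extChartAt (𝓡 n) x₀).source := by
  rw [hom_trivializationAt_baseSet, TangentBundle.trivializationAt_baseSet, extChartAt_source]
  exact ⟨fun h => h.1, fun h => ⟨h, mem_univ _⟩⟩

theorem mem_coframeChart_source :
    p ∈ (coframeChart q x₀).source ↔ p.1 ∈ (extChartAt (𝓡 n) x₀).source := by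
  rw [coframeChart, FiberBundle.extChartAt, PartialEquiv.trans_source]
  constructor
  · intro h
    have h1 := h.1
    rw [OpenPartialHomeomorph.toFun_eq_coe] at *
    exact mem_trivializationAt_coframe_baseSet.1 ((Trivialization.mem_source _).1 h1)
  · intro h
    have h1 := (Trivialization.mem_source
      (trivializationAt (EuclideanSpace ℝ (Fin n) →L[ℝ] EuclideanSpace ℝ (Fin q))
      (fun x : M => TangentSpace (𝓡 n) x →L[ℝ] EuclideanSpace ℝ (Fin q)) x₀)).2
      (mem_trivializationAt_coframe_baseSet.2 h)
    refine ⟨h1, ?_⟩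
    rw [PartialEquiv.prod_source]
    refine ⟨?_, mem_univ _⟩
    have h2 := Trivialization.coe_fst _ h1
    exact (show _ = p.1 from h2) ▸ h

theorem mem_coframeChart_target {c : EuclideanSpace ℝ (Fin n) ×
    (EuclideanSpace ℝ (Fin n) →L[ℝ] EuclideanSpace ℝ (Fin q))} :
    c ∈ (coframeChart q x₀).target ↔ c.1 ∈ (extChartAt (𝓡 n) x₀).target := by
  rw [coframeChart, FiberBundle.extChartAt_target]
  constructor
  · exact fun h => h.1.1
  · exact fun h => ⟨⟨h, mem_trivializationAt_coframe_baseSet.2 ((extChartAt (𝓡 n) x₀).map_target h)⟩,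
      mem_univ _⟩

/-- The target bundle is trivial, so the chart of the Hom bundle only precomposes a coframe with the
derivative of the inverse chart of M. -/
theorem coframeChart_apply (hp : p.1 ∈ (extChartAt (𝓡 n) x₀).source) :
    coframeChart q x₀ p = (extChartAt (𝓡 n) x₀ p.1,
      (p.2 : EuclideanSpace ℝ (Fin n) →L[ℝ] EuclideanSpace ℝ (Fin q)).comp
        (mfderiv (𝓡 n) (𝓡 n) (extChartAt (𝓡 n) x₀).symm (extChartAt (𝓡 n) x₀ p.1) :
          EuclideanSpace ℝ (Fin n) →L[ℝ] EuclideanSpace ℝ (Fin n))) := by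
  have hp' : p.1 ∈ (chartAt (EuclideanSpace ℝ (Fin n)) x₀).source := by
    rwa [← extChartAt_source (𝓡 n)]
  have h1 := TangentBundle.symmL_trivializationAt (I := 𝓡 n) hp'
  rw [(𝓡 n).range_eq_univ, mfderivWithin_univ] at h1
  have h2 := hom_chart (𝕜 := ℝ) (F₁ := EuclideanSpace ℝ (Fin n)) (F₂ := EuclideanSpace ℝ (Fin q))
    (E₁ := fun x : M => TangentSpace (𝓡 n) x) (E₂ := fun _ => EuclideanSpace ℝ (Fin q))
    (HB := EuclideanSpace ℝ (Fin n)) (⟨x₀, 0⟩ : CoframeSpace n M q) p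
  refine (show coframeChart q x₀ p = _ from h2).trans (Prod.ext rfl ?_)
  refine ContinuousLinearMap.ext fun e => ?_
  simp only [ContinuousLinearMap.inCoordinates]
  rw [h1]
  have h3 : Trivialization.continuousLinearMapAt ℝ (trivializationAt (EuclideanSpace ℝ (Fin q))
      (fun _ : M => EuclideanSpace ℝ (Fin q)) x₀) p.proj = ContinuousLinearMap.id ℝ _ :=
    Bundle.Trivial.continuousLinearMapAt_trivialization ℝ M _ p.proj
  exact congrArg (fun T : EuclideanSpace ℝ (Fin q) →L[ℝ] EuclideanSpace ℝ (Fin q) => T (p.2 _)) h3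

theorem coframeChart_symm_proj {c : EuclideanSpace ℝ (Fin n) ×
    (EuclideanSpace ℝ (Fin n) →L[ℝ] EuclideanSpace ℝ (Fin q))}
    (hc : c.1 ∈ (extChartAt (𝓡 n) x₀).target) :
    ((coframeChart q x₀).symm c).1 = (extChartAt (𝓡 n) x₀).symm c.1 := by
  have h1 := (coframeChart q x₀).map_target (mem_coframeChart_target.2 hc)
  have h2 := (coframeChart q x₀).right_inv (mem_coframeChart_target.2 hc)
  rw [mem_coframeChart_source] at h1
  rw [coframeChart_apply h1] at h2
  rw [← congrArg Prod.fst h2, (extChartAt (𝓡 n) x₀).left_inv h1]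

end CoframeChart

end Foliation
/-! ### Foliations with bundle-like metrics in charts -/

section Gram

variable {E V : Type*} [NormedAddCommGroup E] [NormedSpace ℝ E] [FiniteDimensional ℝ E]
  [NormedAddCommGroup V] [InnerProductSpace ℝ V] [FiniteDimensional ℝ V]

/-- If `gram` kills v, then `raise B p v` lies in ker p and is orthogonal to ker p, so it is zero;
pairing it with a preimage of v gives |v|² = 0. -/
theorem gram_isInvertible {B : E →L[ℝ] E →L[ℝ] ℝ} (hB : B.IsInvertible) {p : E →L[ℝ] V}
    (hp : Function.Surjective p)
    (h : ∀ u, p u = 0 → (∀ v, p v = 0 → B u v = 0) → u = 0) : (gram B p).IsInvertible := by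
  have hinj : Function.Injective (gram B p) := by
    rw [injective_iff_map_eq_zero]
    intro v hv
    have h0 : raise B p v = 0 := h _ hv fun e he => by rw [raise_spec hB, he, inner_zero_right]
    obtain ⟨e, rfl⟩ := hp v
    have := raise_spec hB p (p e) e
    rw [h0, map_zero, _root_.zero_apply] at this
    exact inner_self_eq_zero.1 this.symm
  refine ⟨(LinearEquiv.ofInjectiveEndo (gram B p : V →ₗ[ℝ] V) hinj).toContinuousLinearEquiv, ?_⟩
  ext v
  rfl

/-- Test bundle-likeness on the fields Z_v = `raise` of v. There G(Z_v, Z_v') = ⟨v, f v'⟩, and dY[X,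
Z_v] = X(f)v because dY X = 0. The identity reads ⟨v, X(f)v'⟩ = ⟨v', X(f)v⟩ + ⟨v, X(f)v'⟩, so X(f) =
0. -/
theorem fderiv_gram_eq_zero_of_invariant {k : ℕ∞} {W : Set E} {Y : E → V}
    {G : E → E →L[ℝ] E →L[ℝ] ℝ} (hW : IsOpen W)
    (hY : ContDiffOn ℝ ((k : WithTop ℕ∞) + 2) Y W) (hG : ContDiffOn ℝ ((k : WithTop ℕ∞) + 1) G W)
    (hs : ∀ x ∈ W, ∀ u v, G x u v = G x v u) (hi : ∀ x ∈ W, (G x).IsInvertible)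
    (hg : ∀ x ∈ W, (gram (G x) (fderiv ℝ Y x)).IsInvertible)
    (H : ∀ X Z Z' : E → E, ContDiffOn ℝ ((k : WithTop ℕ∞) + 1) X W →
      ContDiffOn ℝ ((k : WithTop ℕ∞) + 1) Z W → ContDiffOn ℝ ((k : WithTop ℕ∞) + 1) Z' W →
      (∀ x ∈ W, fderiv ℝ Y x (X x) = 0) →
      (∀ x ∈ W, ∀ e, fderiv ℝ Y x e = 0 → G x e (Z x) = 0) →
      (∀ x ∈ W, ∀ e, fderiv ℝ Y x e = 0 → G x e (Z' x) = 0) →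
      ∀ x ∈ W, fderiv ℝ (fun x => G x (Z x) (Z' x)) x (X x) =
        G x (lieBracket ℝ X Z x) (Z' x) + G x (Z x) (lieBracket ℝ X Z' x)) :
    ∀ x ∈ W, ∀ w, fderiv ℝ Y x w = 0 →
      fderiv ℝ (fun x => gram (G x) (fderiv ℝ Y x)) x w = 0 := by
  have hdY : ContDiffOn ℝ ((k : WithTop ℕ∞) + 1) (fderiv ℝ Y) W :=
    hY.fderiv_of_isOpen hW (by rw [add_assoc]; rfl)
  have hf := hG.gram hi hdY
  have hr := hG.raise hi hdY
  have hsm := hr.clm_comp (hf.clm_inverse hg)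
  have hdYs : ∀ z ∈ W, ∀ v,
      fderiv ℝ Y z (raise (G z) (fderiv ℝ Y z) ((gram (G z) (fderiv ℝ Y z)).inverse v)) = v :=
    fun z hz v => (hg z hz).self_apply_inverse v
  intro x hx w hw
  -- The constant field w, corrected by its horizontal part so as to be tangent to the leaves
  -- everywhere, not only at x.
  let X : E → E := fun z => w - raise (G z) (fderiv ℝ Y z)
    ((gram (G z) (fderiv ℝ Y z)).inverse (fderiv ℝ Y z w))
  have hXx : X x = w := by simp [X, hw]
  have hX : ContDiffOn ℝ ((k : WithTop ℕ∞) + 1) X W :=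
    contDiffOn_const.sub (hsm.clm_apply (hdY.clm_apply contDiffOn_const))
  have hXY : ∀ z ∈ W, fderiv ℝ Y z (X z) = 0 := fun z hz => by
    rw [map_sub, hdYs z hz, sub_self]
  let Z : V → E → E := fun v z => raise (G z) (fderiv ℝ Y z) v
  have hZ : ∀ v, ContDiffOn ℝ ((k : WithTop ℕ∞) + 1) (Z v) W := fun v =>
    hr.clm_apply contDiffOn_const
  have hZY : ∀ v, ∀ z ∈ W, ∀ e, fderiv ℝ Y z e = 0 → G z e (Z v z) = 0 := fun v z hz e he => by
    rw [hs z hz, raise_spec (hi z hz), he, inner_zero_right]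
  have hn := hW.mem_nhds hx
  have hbr : ∀ v, fderiv ℝ Y x (lieBracket ℝ X (Z v) x) =
      fderiv ℝ (fun x => gram (G x) (fderiv ℝ Y x)) x w v := by
    intro v
    have h1 := BundleLikeChart.lieBracket_apply_fderiv (Φ := Y) (X := X) (Z := Z v) (c := x)
      ((hY.contDiffAt hn).of_le le_add_self)
      ((hX.contDiffAt hn).differentiableAt (by simp))
      (((hZ v).contDiffAt hn).differentiableAt (by simp))
    have h2 : (fun z => fderiv ℝ Y z (X z)) =ᶠ[𝓝 x] fun _ => 0 := by
      filter_upwards [hn] with z hz using hXY z hz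
    rw [h1, h2.fderiv_eq, hXx]
    have h3 := ((hf.contDiffAt hn).differentiableAt (by simp)).hasFDerivAt.clm_apply
      (hasFDerivAt_const v x)
    have h4 : (fun z => fderiv ℝ Y z (Z v z)) = fun z => gram (G z) (fderiv ℝ Y z) v := rfl
    rw [h4, h3.fderiv]
    simp
  ext v
  refine ext_inner_left ℝ fun v' => ?_
  have h1 := H X (Z v) (Z v') hX (hZ v) (hZ v') hXY (hZY v) (hZY v') x hx
  have h2 : (fun x => G x (Z v x) (Z v' x)) =ᶠ[𝓝 x]
      fun x => inner ℝ v (gram (G x) (fderiv ℝ Y x) v') := by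
    filter_upwards [hn] with z hz using raise_spec (hi z hz) _ _ _
  have h3 : HasFDerivAt (fun x => inner ℝ v (gram (G x) (fderiv ℝ Y x) v')) _ x :=
    (innerSL ℝ v).hasFDerivAt.comp x (((hf.contDiffAt hn).differentiableAt
      (by simp)).hasFDerivAt.clm_apply (hasFDerivAt_const v' x))
  rw [h2.fderiv_eq, h3.fderiv, hXx, hs x hx (lieBracket ℝ X (Z v) x), raise_spec (hi x hx),
    raise_spec (hi x hx), hbr, hbr] at h1
  simpa using h1

end Gram

/-! ### The foliation and the metric of M read in a chart -/

section FoliationChart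

variable {n q : ℕ} {M : Type*} [TopologicalSpace M] [ChartedSpace (EuclideanSpace ℝ (Fin n)) M]
  [IsManifold (𝓡 n) ∞ M] {x₀ : M} {r s : WithTop ℕ∞}

theorem fderiv_eq_of_hasMFDerivAt {A B : Type*} [NormedAddCommGroup A] [NormedSpace ℝ A]
    [NormedAddCommGroup B] [NormedSpace ℝ B] {f : A → B} {x : A} {L : A →L[ℝ] B}
    (h : HasMFDerivAt 𝓘(ℝ, A) 𝓘(ℝ, B) f x L) : fderiv ℝ f x = L :=
  have h' : HasFDerivAt f L x := hasMFDerivAt_iff_hasFDerivAt.1 h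
  h'.fderiv

theorem fderiv_comp_extChartAt_symm {y : M → EuclideanSpace ℝ (Fin q)} {z : EuclideanSpace ℝ (Fin n)}
    (hz : z ∈ (extChartAt (𝓡 n) x₀).target)
    (hy : MDifferentiableAt (𝓡 n) (𝓡 q) y ((extChartAt (𝓡 n) x₀).symm z)) :
    fderiv ℝ (fun z => y ((extChartAt (𝓡 n) x₀).symm z)) z =
      (mfderiv (𝓡 n) (𝓡 q) y ((extChartAt (𝓡 n) x₀).symm z) :
        EuclideanSpace ℝ (Fin n) →L[ℝ] EuclideanSpace ℝ (Fin q)).comp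
        (mfderiv (𝓡 n) (𝓡 n) (extChartAt (𝓡 n) x₀).symm z :
          EuclideanSpace ℝ (Fin n) →L[ℝ] EuclideanSpace ℝ (Fin n)) := by
  have h1 := hy.hasMFDerivAt.comp z
    ((contMDiffAt_extChartAt_symm_of_mem hz).mdifferentiableAt (by simp)).hasMFDerivAt
  exact fderiv_eq_of_hasMFDerivAt h1

theorem ofChartField_extChartAt_symm {X : EuclideanSpace ℝ (Fin n) → EuclideanSpace ℝ (Fin n)}
    {z : EuclideanSpace ℝ (Fin n)} (hz : z ∈ (extChartAt (𝓡 n) x₀).target) :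
    ofChartField (𝓡 n) x₀ X ((extChartAt (𝓡 n) x₀).symm z) =
      mfderiv (𝓡 n) (𝓡 n) (extChartAt (𝓡 n) x₀).symm z (X z) := by
  have h := (extChartAt (𝓡 n) x₀).map_target hz
  apply (mfderiv_extChartAt_isInvertible h).injective
  rw [mfderiv_extChartAt_ofChartField h, (extChartAt (𝓡 n) x₀).right_inv hz]
  exact (mfderiv_extChartAt_symm_apply hz _).symm

namespace PseudoRiemannianMetric

variable (g : PseudoRiemannianMetric n M r)

/-- The metric in the chart around `x₀`. -/
noncomputable def chartForm (x₀ : M) (z : EuclideanSpace ℝ (Fin n)) :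
    EuclideanSpace ℝ (Fin n) →L[ℝ] EuclideanSpace ℝ (Fin n) →L[ℝ] ℝ :=
  let B : EuclideanSpace ℝ (Fin n) →L[ℝ] EuclideanSpace ℝ (Fin n) →L[ℝ] ℝ :=
    g.val ((extChartAt (𝓡 n) x₀).symm z)
  let A : EuclideanSpace ℝ (Fin n) →L[ℝ] EuclideanSpace ℝ (Fin n) :=
    mfderiv (𝓡 n) (𝓡 n) (extChartAt (𝓡 n) x₀).symm z
  B.bilinearComp A A

variable {g}

theorem chartForm_symm (z u v : EuclideanSpace ℝ (Fin n)) :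
    g.chartForm x₀ z u v = g.chartForm x₀ z v u := g.symm _ _ _

theorem chartForm_mfderiv {x : M} (hx : x ∈ (extChartAt (𝓡 n) x₀).source)
    (u v : TangentSpace (𝓡 n) x) :
    g.chartForm x₀ (extChartAt (𝓡 n) x₀ x) (mfderiv (𝓡 n) (𝓡 n) (extChartAt (𝓡 n) x₀) x u)
      (mfderiv (𝓡 n) (𝓡 n) (extChartAt (𝓡 n) x₀) x v) = g.val x u v := by
  have hu := mfderiv_symm_extChartAt_apply hx u
  have hv := mfderiv_symm_extChartAt_apply hx v
  have hx' := (extChartAt (𝓡 n) x₀).left_inv hx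
  change (g.val ((extChartAt (𝓡 n) x₀).symm _) :
    EuclideanSpace ℝ (Fin n) →L[ℝ] EuclideanSpace ℝ (Fin n) →L[ℝ] ℝ)
    ((mfderiv (𝓡 n) (𝓡 n) (extChartAt (𝓡 n) x₀).symm (extChartAt (𝓡 n) x₀ x) :
          EuclideanSpace ℝ (Fin n) →L[ℝ] EuclideanSpace ℝ (Fin n)) _)
    ((mfderiv (𝓡 n) (𝓡 n) (extChartAt (𝓡 n) x₀).symm (extChartAt (𝓡 n) x₀ x) :
          EuclideanSpace ℝ (Fin n) →L[ℝ] EuclideanSpace ℝ (Fin n)) _) = _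
  rw [hu, hv, hx']

theorem chartForm_isInvertible {z : EuclideanSpace ℝ (Fin n)}
    (hz : z ∈ (extChartAt (𝓡 n) x₀).target) : (g.chartForm x₀ z).IsInvertible := by
  refine isInvertible_of_nondegenerate _ fun u hu => ?_
  have hinv := (inverse_mfderiv_extChartAt_symm (J := 𝓡 n) hz).1
  apply hinv.injective
  refine Eq.trans ?_ (map_zero _).symm
  refine g.nondegenerate _ _ fun v => ?_
  obtain ⟨v', rfl⟩ := hinv.surjective v
  exact hu v'

theorem contMDiffAt_apply {x : M} {X Y : ∀ x : M, TangentSpace (𝓡 n) x}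
    (hX : ContMDiffAt (𝓡 n) (𝓡 n).tangent r (fun x => (⟨x, X x⟩ : TangentBundle (𝓡 n) M)) x)
    (hY : ContMDiffAt (𝓡 n) (𝓡 n).tangent r (fun x => (⟨x, Y x⟩ : TangentBundle (𝓡 n) M)) x) :
    ContMDiffAt (𝓡 n) 𝓘(ℝ, ℝ) r (fun x => g.val x (X x) (Y x)) x := by
  have : ContMDiffAt (𝓡 n) ((𝓡 n).prod 𝓘(ℝ)) r
      (fun x => TotalSpace.mk' ℝ (E := Bundle.Trivial M ℝ) x (g.val x (X x) (Y x))) x := by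
    apply ContMDiffAt.clm_bundle_apply₂ (F₁ := EuclideanSpace ℝ (Fin n))
      (F₂ := EuclideanSpace ℝ (Fin n)) (E₁ := fun x : M => TangentSpace (𝓡 n) x)
      (E₂ := fun x : M => TangentSpace (𝓡 n) x)
    · exact g.contMDiff x
    · exact hX
    · exact hY
  rw [contMDiffAt_totalSpace] at this
  exact this.2

theorem contDiffOn_chartForm {m : ℕ∞} (hm : (m : WithTop ℕ∞) = r) :
    ContDiffOn ℝ r (g.chartForm x₀) (extChartAt (𝓡 n) x₀).target := by
  rw [contDiffOn_clm_apply]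
  intro u
  rw [contDiffOn_clm_apply]
  intro v z hz
  refine ContDiffAt.contDiffWithinAt ?_
  have hX : ∀ u : EuclideanSpace ℝ (Fin n), ContMDiffAt (𝓡 n) (𝓡 n).tangent r
      (fun x => (⟨x, ofChartField (𝓡 n) x₀ (fun _ => u) x⟩ : TangentBundle (𝓡 n) M))
      ((extChartAt (𝓡 n) x₀).symm z) := by
    intro u
    rw [← hm]
    exact contMDiffAt_ofChartField ((extChartAt (𝓡 n) x₀).map_target hz) contDiffAt_const
  have h1 := (contMDiffAt_apply (g := g) (hX u) (hX v)).comp z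
    ((contMDiffAt_extChartAt_symm_of_mem hz).of_le (by rw [← hm]; exact_mod_cast le_top))
  refine h1.contDiffAt.congr_of_eventuallyEq ?_
  filter_upwards [extChartAt_target_mem_nhds' hz] with y hy
  rw [Function.comp_apply, ofChartField_extChartAt_symm hy, ofChartField_extChartAt_symm hy]
  rfl

end PseudoRiemannianMetric

/-- Local data of a foliation and a metric in the chart around `x₀`. -/
structure Foliation.IsAdaptedChart (F : Foliation n M q s) (g : PseudoRiemannianMetric n M r)
    (x₀ : M) {k : ℕ∞}
    (D : BundleLikeChart (EuclideanSpace ℝ (Fin n)) (EuclideanSpace ℝ (Fin q)) k) : Prop where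
  subset_target : D.W ⊆ (extChartAt (𝓡 n) x₀).target
  form : ∀ z ∈ D.W, D.G z = g.chartForm x₀ z
  ker : ∀ z ∈ D.W, ∀ u : EuclideanSpace ℝ (Fin n), D.dY z u = 0 ↔
    (mfderiv (𝓡 n) (𝓡 n) (extChartAt (𝓡 n) x₀).symm z :
          EuclideanSpace ℝ (Fin n) →L[ℝ] EuclideanSpace ℝ (Fin n)) u ∈
      F.tangent ((extChartAt (𝓡 n) x₀).symm z)

/-- Non-degeneracy of g on TF makes the contravariant transverse metric invertible. Bundle-likeness
gives its invariance, after local fields on M are built from fields in the chart and their brackets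
are compared. -/
theorem Foliation.exists_isAdaptedChart {k : ℕ∞} (F : Foliation n M q ((k : WithTop ℕ∞) + 2))
    (g : PseudoRiemannianMetric n M ((k : WithTop ℕ∞) + 1)) (hg : g.IsBundleLike F) (x₀ : M) :
    ∃ D : BundleLikeChart (EuclideanSpace ℝ (Fin n)) (EuclideanSpace ℝ (Fin q)) k,
      F.IsAdaptedChart g x₀ D ∧ extChartAt (𝓡 n) x₀ x₀ ∈ D.W := by
  obtain ⟨U, y, hU, hxU, hy, hyU⟩ := F.exists_submersion x₀
  set φ := extChartAt (𝓡 n) x₀ with hφ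
  let W : Set (EuclideanSpace ℝ (Fin n)) := φ.target ∩ φ.symm ⁻¹' U
  have hW : IsOpen W := (continuousOn_extChartAt_symm x₀).isOpen_inter_preimage
    (isOpen_extChartAt_target x₀) hU
  let Y : EuclideanSpace ℝ (Fin n) → EuclideanSpace ℝ (Fin q) := fun z => y (φ.symm z)
  have hyd : ∀ z ∈ W, MDifferentiableAt (𝓡 n) (𝓡 q) y (φ.symm z) := fun z hz =>
    (hy.contMDiffAt (hU.mem_nhds hz.2)).mdifferentiableAt (by simp)
  have hdY : ∀ z ∈ W, fderiv ℝ Y z = _ := fun z hz => fderiv_comp_extChartAt_symm hz.1 (hyd z hz)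
  have hinv := fun z (hz : z ∈ W) => (inverse_mfderiv_extChartAt_symm (J := 𝓡 n) hz.1).1
  have hker : ∀ z ∈ W, ∀ u : EuclideanSpace ℝ (Fin n), fderiv ℝ Y z u = 0 ↔
      (mfderiv (𝓡 n) (𝓡 n) φ.symm z :
          EuclideanSpace ℝ (Fin n) →L[ℝ] EuclideanSpace ℝ (Fin n)) u ∈ F.tangent (φ.symm z) := by
    intro z hz u
    rw [hdY z hz]
    exact ((hyU _ hz.2).2 _).symm
  have hsurj : ∀ z ∈ W, Function.Surjective (fderiv ℝ Y z) := by
    intro z hz v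
    obtain ⟨u, hu⟩ := (hyU _ hz.2).1 v
    obtain ⟨u', rfl⟩ := (hinv z hz).surjective u
    exact ⟨u', by rw [hdY z hz]; exact hu⟩
  have hY : ContDiffOn ℝ ((k : WithTop ℕ∞) + 2) Y W := by
    intro z hz
    have h1 := (hy.contMDiffAt (hU.mem_nhds hz.2)).comp z
      ((contMDiffAt_extChartAt_symm_of_mem hz.1).of_le
        (show ((k + 2 : ℕ∞) : WithTop ℕ∞) ≤ _ from WithTop.coe_le_coe.2 le_top))
    exact h1.contDiffAt.contDiffWithinAt
  have hm : ((k + 1 : ℕ∞) : WithTop ℕ∞) = (k : WithTop ℕ∞) + 1 := by push_cast; rfl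
  have hG : ContDiffOn ℝ ((k : WithTop ℕ∞) + 1) (g.chartForm x₀) W :=
    (PseudoRiemannianMetric.contDiffOn_chartForm hm).mono inter_subset_left
  have hgram : ∀ z ∈ W, (gram (g.chartForm x₀ z) (fderiv ℝ Y z)).IsInvertible := by
    intro z hz
    refine gram_isInvertible (PseudoRiemannianMetric.chartForm_isInvertible hz.1) (hsurj z hz)
      fun u hu h => ?_
    apply (hinv z hz).injective
    refine Eq.trans ?_ (map_zero _).symm
    refine hg.1 _ _ ((hker z hz u).1 hu) fun v hv => ?_
    obtain ⟨v', rfl⟩ := (hinv z hz).surjective v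
    exact h v' ((hker z hz v').2 hv)
  have hinvariant := fderiv_gram_eq_zero_of_invariant hW hY hG
    (fun z _ => PseudoRiemannianMetric.chartForm_symm z)
    (fun z hz => PseudoRiemannianMetric.chartForm_isInvertible hz.1) hgram (by
      intro X Z Z' hX hZ hZ' hXY hZY hZY' z hz
      have hopen : IsOpen (φ.source ∩ φ ⁻¹' W) := by
        exact (continuousOn_extChartAt x₀).isOpen_inter_preimage (isOpen_extChartAt_source x₀) hW
      have hsm : ∀ X : EuclideanSpace ℝ (Fin n) → EuclideanSpace ℝ (Fin n),
          ContDiffOn ℝ ((k : WithTop ℕ∞) + 1) X W →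
          ContMDiffOn (𝓡 n) (𝓡 n).tangent ((k : WithTop ℕ∞) + 1)
            (fun x => (⟨x, ofChartField (𝓡 n) x₀ X x⟩ : TangentBundle (𝓡 n) M))
            (φ.source ∩ φ ⁻¹' W) := by
        intro X hX x hx
        rw [← hm] at hX ⊢
        exact (contMDiffAt_ofChartField hx.1 (hX.contDiffAt (hW.mem_nhds hx.2))).contMDiffWithinAt
      have hort : ∀ Z : EuclideanSpace ℝ (Fin n) → EuclideanSpace ℝ (Fin n),
          (∀ x ∈ W, ∀ e, fderiv ℝ Y x e = 0 → g.chartForm x₀ x e (Z x) = 0) →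
          ∀ z ∈ W, ofChartField (𝓡 n) x₀ Z (φ.symm z) ∈ g.orthogonal F (φ.symm z) := by
        intro Z hZ z hz u hu
        obtain ⟨u', rfl⟩ := (hinv z hz).surjective u
        rw [ofChartField_extChartAt_symm hz.1]
        exact hZ z hz u' ((hker z hz u').2 hu)
      have hx : φ.symm z ∈ φ.source ∩ φ ⁻¹' W := by
        refine ⟨φ.map_target hz.1, ?_⟩
        rw [mem_preimage, φ.right_inv hz.1]
        exact hz
      have h1 := hg.2 (φ.source ∩ φ ⁻¹' W) (ofChartField (𝓡 n) x₀ X) (ofChartField (𝓡 n) x₀ Z)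
        (ofChartField (𝓡 n) x₀ Z') hopen (hsm X hX) (hsm Z hZ) (hsm Z' hZ') (by
          intro x hx
          obtain ⟨z, hz, rfl⟩ : ∃ z ∈ W, φ.symm z = x := ⟨φ x, hx.2, φ.left_inv hx.1⟩
          refine ⟨?_, hort Z hZY z hz, hort Z' hZY' z hz⟩
          rw [ofChartField_extChartAt_symm hz.1]
          exact (hker z hz _).1 (hXY z hz)) _ hx
      have hd : ∀ X : EuclideanSpace ℝ (Fin n) → EuclideanSpace ℝ (Fin n),
          ContDiffOn ℝ ((k : WithTop ℕ∞) + 1) X W →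
          ContMDiffAt (𝓡 n) (𝓡 n).tangent ((k : WithTop ℕ∞) + 1)
            (fun x => (⟨x, ofChartField (𝓡 n) x₀ X x⟩ : TangentBundle (𝓡 n) M)) (φ.symm z) :=
        fun X hX => (hsm X hX).contMDiffAt (hopen.mem_nhds hx)
      have hbr : ∀ Z : EuclideanSpace ℝ (Fin n) → EuclideanSpace ℝ (Fin n),
          ContDiffOn ℝ ((k : WithTop ℕ∞) + 1) Z W →
          mlieBracket (𝓡 n) (ofChartField (𝓡 n) x₀ X) (ofChartField (𝓡 n) x₀ Z) (φ.symm z) =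
            mfderiv (𝓡 n) (𝓡 n) φ.symm z (lieBracket ℝ X Z z) := by
        intro Z hZ
        have hcf : ∀ X : EuclideanSpace ℝ (Fin n) → EuclideanSpace ℝ (Fin n),
            chartField (𝓡 n) x₀ (ofChartField (𝓡 n) x₀ X) =ᶠ[𝓝 z] X := by
          intro X
          filter_upwards [hW.mem_nhds hz] with y hy
          rw [chartField, mfderiv_extChartAt_ofChartField (φ.map_target hy.1)]
          exact congrArg X (φ.right_inv hy.1)
        have h2 := mfderiv_extChartAt_mlieBracket hx.1 ((hd X hX).mdifferentiableAt (by simp))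
          ((hd Z hZ).mdifferentiableAt (by simp))
        rw [φ.right_inv hz.1, ((hcf X).lieBracket_vectorField_eq (hcf Z))] at h2
        apply (mfderiv_extChartAt_isInvertible hx.1).injective
        refine h2.trans ?_
        exact (mfderiv_extChartAt_symm_apply hz.1 _).symm
      rw [hbr Z hZ, hbr Z' hZ'] at h1
      have eX := ofChartField_extChartAt_symm (X := X) hz.1
      have eZ := ofChartField_extChartAt_symm (X := Z) hz.1
      have eZ' := ofChartField_extChartAt_symm (X := Z') hz.1
      rw [eX, eZ, eZ'] at h1
      refine Eq.trans ?_ h1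
      have h3 := (PseudoRiemannianMetric.contMDiffAt_apply (g := g) (hd Z hZ)
        (hd Z' hZ')).mdifferentiableAt (by simp)
      have h4 := h3.hasMFDerivAt.comp z
        ((contMDiffAt_extChartAt_symm_of_mem hz.1).mdifferentiableAt (by simp)).hasMFDerivAt
      have h5 : (fun x => g.chartForm x₀ x (Z x) (Z' x)) =ᶠ[𝓝 z]
          (fun x' => g.val x' (ofChartField (𝓡 n) x₀ Z x') (ofChartField (𝓡 n) x₀ Z' x')) ∘
            φ.symm := by
        filter_upwards [hW.mem_nhds hz] with y hy
        rw [Function.comp_apply, ofChartField_extChartAt_symm hy.1,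
          ofChartField_extChartAt_symm hy.1]
        rfl
      rw [h5.fderiv_eq]
      exact congrArg (fun T : EuclideanSpace ℝ (Fin n) →L[ℝ] ℝ => T (X z))
        (fderiv_eq_of_hasMFDerivAt h4))
  refine ⟨⟨W, Y, g.chartForm x₀, hW, hY, hG, fun z _ => PseudoRiemannianMetric.chartForm_symm z,
    fun z hz => PseudoRiemannianMetric.chartForm_isInvertible hz.1, hgram, hinvariant⟩,
    ⟨fun z hz => hz.1, fun z _ => rfl, hker⟩, ?_, ?_⟩
  · exact mem_extChartAt_target x₀
  · rw [mem_preimage, extChartAt_to_inv]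
    exact hxU

end FoliationChart

/-! ### Lorentz frames -/

section LorentzFrames

/-- The diagonal map defining the standard Lorentz form. -/
noncomputable def lorentzMap (q : ℕ) : EuclideanSpace ℝ (Fin q) →L[ℝ] EuclideanSpace ℝ (Fin q) :=
  LinearMap.toContinuousLinearMap
    { toFun := fun v => WithLp.toLp 2 fun i => (if i.val = 0 then -1 else 1) * v i
      map_add' := fun v w => by ext i; simp [mul_add]
      map_smul' := fun a v => by ext i; simp [mul_left_comm] }

variable {q : ℕ}

theorem lorentzMap_apply (v : EuclideanSpace ℝ (Fin q)) (i : Fin q) :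
    lorentzMap q v i = (if i.val = 0 then -1 else 1) * v i := rfl

theorem lorentzMap_lorentzMap (v : EuclideanSpace ℝ (Fin q)) : lorentzMap q (lorentzMap q v) = v := by
  ext i
  rw [lorentzMap_apply, lorentzMap_apply]
  split_ifs <;> ring

theorem lorentzForm_eq_inner (a b : EuclideanSpace ℝ (Fin q)) :
    lorentzForm q a b = inner ℝ (lorentzMap q a) b := by
  rw [lorentzForm, PiLp.inner_apply]
  refine Finset.sum_congr rfl fun i _ => ?_
  rw [lorentzMap_apply, real_inner_comm]
  simp

theorem adjoint_lorentzMap : (lorentzMap q).adjoint = lorentzMap q := by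
  refine (ContinuousLinearMap.eq_adjoint_iff _ _).2 (fun a b => ?_) |>.symm
  rw [← lorentzForm_eq_inner, real_inner_comm, ← lorentzForm_eq_inner, lorentzForm, lorentzForm]
  exact Finset.sum_congr rfl fun i _ => by ring

variable {E V : Type*} [NormedAddCommGroup E] [NormedSpace ℝ E] [FiniteDimensional ℝ E]
  [NormedAddCommGroup V] [InnerProductSpace ℝ V] [FiniteDimensional ℝ V]
  {B : E →L[ℝ] E →L[ℝ] ℝ} {T : Submodule ℝ E} {η : V →L[ℝ] V} {p : E →L[ℝ] V}

/-- Orthogonal projection to T: as B is non-degenerate on T, the form B(e, ·) restricted to T is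
represented by some t ∈ T. -/
theorem exists_mem_sub_mem_orthogonal (hT : ∀ u ∈ T, (∀ v ∈ T, B u v = 0) → u = 0) (e : E) :
    ∃ t ∈ T, ∀ u ∈ T, B (e - t) u = 0 := by
  let r : (E →L[ℝ] ℝ) →L[ℝ] T →L[ℝ] ℝ := (ContinuousLinearMap.compL ℝ T E ℝ).flip T.subtypeL
  have hr : ∀ (f : E →L[ℝ] ℝ) (u : T), r f u = f u := fun f u => rfl
  let BT : T →L[ℝ] T →L[ℝ] ℝ := r.comp (B.comp T.subtypeL)
  have hBT : ∀ u v : T, BT u v = B u v := fun u v => rfl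
  have hi : BT.IsInvertible := isInvertible_of_nondegenerate BT fun u hu =>
    Subtype.ext (hT u u.2 fun v hv => hu ⟨v, hv⟩)
  obtain ⟨t, ht⟩ := hi.surjective (r (B e))
  refine ⟨t, t.2, fun u hu => ?_⟩
  have h := congrArg (fun f : T →L[ℝ] ℝ => f ⟨u, hu⟩) ht
  simp only [hBT, hr] at h
  rw [map_sub, _root_.sub_apply, h, sub_self]

/-- Duality. The vectors `raise B p v` are orthogonal to T, so an isometry on T^⊥ amounts to η p
`raise B p` = 1, that is `gram B p = η`. Conversely, a p satisfying this is onto, and descends to an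
isomorphism of E ⧸ T. -/
theorem frame_iff_gram_eq (hB : B.IsInvertible) (hs : ∀ u v, B u v = B v u)
    (hT : ∀ u ∈ T, (∀ v ∈ T, B u v = 0) → u = 0) (hη : ∀ v, η (η v) = v) (z₀ : V ≃ₗ[ℝ] E ⧸ T) :
    (∃ z : V ≃ₗ[ℝ] E ⧸ T, (∀ u, (∀ t ∈ T, B t u = 0) → ∀ v, (∀ t ∈ T, B t v = 0) →
      B u v = inner ℝ (η (z.symm (T.mkQ u))) (z.symm (T.mkQ v))) ∧ ∀ u, p u = z.symm (T.mkQ u)) ↔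
      (∀ u ∈ T, p u = 0) ∧ gram B p = η := by
  have hort : (∀ u ∈ T, p u = 0) → ∀ v, ∀ t ∈ T, B t (raise B p v) = 0 := by
    intro h0 v t ht
    rw [hs, raise_spec hB, h0 t ht, inner_zero_right]
  constructor
  · rintro ⟨z, hz, hp⟩
    have h0 : ∀ u ∈ T, p u = 0 := fun u hu => by
      rw [hp, Submodule.mkQ_apply, (Submodule.Quotient.mk_eq_zero T).2 hu, map_zero]
    refine ⟨h0, ContinuousLinearMap.ext fun v => ?_⟩
    rw [gram_apply]
    have h1 : η (p (raise B p v)) = v := by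
      refine ext_inner_right ℝ fun w => ?_
      obtain ⟨e, he⟩ := Submodule.mkQ_surjective T (z w)
      obtain ⟨t, ht, h⟩ := exists_mem_sub_mem_orthogonal hT e
      have hw : p (e - t) = w := by
        rw [map_sub, h0 t ht, sub_zero, hp, he, z.symm_apply_apply]
      have h2 := hz _ (hort h0 v) (e - t) fun u hu => (hs _ _).trans (h u hu)
      rw [← hp, ← hp, raise_spec hB, hw] at h2
      exact h2.symm
    rw [← h1, hη, h1]
  · rintro ⟨h0, hg⟩
    have hpr : ∀ v, p (raise B p (η v)) = v := fun v => by rw [← gram_apply, hg, hη]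
    let P : (E ⧸ T) →ₗ[ℝ] V := T.liftQ p.toLinearMap fun u hu => h0 u hu
    have hP : ∀ u, P (T.mkQ u) = p u := fun u => Submodule.liftQ_apply _ _ _
    have hsurj : Function.Surjective P := fun v => ⟨T.mkQ (raise B p (η v)), (hP _).trans (hpr v)⟩
    -- The given frame z₀ serves only to know that E ⧸ T and V have the same dimension.
    have hinj : Function.Injective P :=
      (LinearMap.injective_iff_surjective_of_finrank_eq_finrank z₀.symm.finrank_eq).2 hsurj
    have hbij : Function.Bijective P := ⟨hinj, hsurj⟩
    have hP' : ∀ u, (LinearEquiv.ofBijective P hbij).symm.symm (T.mkQ u) = p u := fun u => hP u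
    refine ⟨(LinearEquiv.ofBijective P hbij).symm, ?_, fun u => (hP' u).symm⟩
    intro u hu v hv
    have h1 : u - raise B p (η (p u)) = 0 := by
      refine hT _ ?_ fun t ht => ?_
      · refine (Submodule.Quotient.mk_eq_zero T).1 (hinj ?_)
        rw [map_zero]
        refine (hP _).trans ?_
        rw [map_sub, hpr, sub_self]
      · rw [hs, map_sub, hu t ht, hort h0 _ t ht, sub_zero]
    rw [hP', hP']
    conv_lhs => rw [sub_eq_zero.1 h1]
    rw [raise_spec hB]

end LorentzFrames

section FrameBundle

variable {n q : ℕ} {M : Type*} [TopologicalSpace M] [ChartedSpace (EuclideanSpace ℝ (Fin n)) M]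
  [IsManifold (𝓡 n) ∞ M] {r s : WithTop ℕ∞} {x₀ : M}
  {F : Foliation n M q s} {g : PseudoRiemannianMetric n M r}

namespace PseudoRiemannianMetric

variable (g) in
/-- The scalar product at a point, on the model space. -/
def form (x : M) : EuclideanSpace ℝ (Fin n) →L[ℝ] EuclideanSpace ℝ (Fin n) →L[ℝ] ℝ := g.val x

theorem form_isInvertible (x : M) : (g.form x).IsInvertible :=
  isInvertible_of_nondegenerate _ (g.nondegenerate x)

end PseudoRiemannianMetric

namespace Foliation

theorem mem_lorentzFrameBundle_iff (hg : g.IsBundleLike F) (hl : F.IsTransverselyLorentzian g)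
    (p : CoframeSpace n M q) : p ∈ F.lorentzFrameBundle g ↔
      (∀ u ∈ F.tangent p.1, p.2 u = 0) ∧ gram (g.form p.1)
        (p.2 : EuclideanSpace ℝ (Fin n) →L[ℝ] EuclideanSpace ℝ (Fin q)) = lorentzMap q := by
  obtain ⟨z₀, hz₀⟩ := hl.2 p.1
  refine Iff.trans ?_ (frame_iff_gram_eq (B := g.form p.1) (T := F.tangent p.1) (η := lorentzMap q)
    (p := p.2) (PseudoRiemannianMetric.form_isInvertible p.1) (g.symm p.1) (hg.1 p.1)
    lorentzMap_lorentzMap z₀)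
  refine exists_congr fun z => and_congr_left' ?_
  constructor
  · intro h u hu v hv
    refine (h u hu v hv).trans (lorentzForm_eq_inner _ _)
  · intro h u hu v hv
    exact (h u hu v hv).trans (lorentzForm_eq_inner _ _).symm

variable {k : ℕ∞} {D : BundleLikeChart (EuclideanSpace ℝ (Fin n)) (EuclideanSpace ℝ (Fin q)) k}
  {p : CoframeSpace n M q}

theorem IsAdaptedChart.mem_lorentzFrameBundle_iff (hD : F.IsAdaptedChart g x₀ D)
    (hg : g.IsBundleLike F) (hl : F.IsTransverselyLorentzian g)
    (hp : p.1 ∈ (extChartAt (𝓡 n) x₀).source) (hW : extChartAt (𝓡 n) x₀ p.1 ∈ D.W) :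
    p ∈ F.lorentzFrameBundle g ↔ coframeChart q x₀ p ∈ D.frames (lorentzMap q) := by
  rw [Foliation.mem_lorentzFrameBundle_iff hg hl, coframeChart_apply hp]
  set z := extChartAt (𝓡 n) x₀ p.1 with hz
  have hzt := (extChartAt (𝓡 n) x₀).map_source hp
  have hzp : (extChartAt (𝓡 n) x₀).symm z = p.1 := (extChartAt (𝓡 n) x₀).left_inv hp
  let L : EuclideanSpace ℝ (Fin n) →L[ℝ] EuclideanSpace ℝ (Fin n) :=
    mfderiv (𝓡 n) (𝓡 n) (extChartAt (𝓡 n) x₀).symm z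
  have hL : L.IsInvertible := (inverse_mfderiv_extChartAt_symm (J := 𝓡 n) hzt).1
  have hker : ∀ u, D.dY z u = 0 ↔ L u ∈ F.tangent p.1 := by
    intro u
    have := hD.ker z hW u
    rw [hzp] at this
    exact this
  have hform : ∀ u v, D.G z u v = g.form p.1 (L u) (L v) := by
    intro u v
    rw [hD.form z hW, ← hzp]
    rfl
  have hgr := gram_congr (PseudoRiemannianMetric.form_isInvertible p.1) (D.inv z hW) L hL hform
    (p.2 : EuclideanSpace ℝ (Fin n) →L[ℝ] EuclideanSpace ℝ (Fin q))
  constructor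
  · rintro ⟨h1, h2⟩
    exact ⟨hW, fun e he => h1 _ ((hker e).1 he), hgr.trans h2⟩
  · rintro ⟨-, h1, h2⟩
    refine ⟨fun u hu => ?_, hgr.symm.trans h2⟩
    obtain ⟨u', rfl⟩ := hL.surjective u
    exact h1 u' ((hker u').2 hu)

end Foliation

end FrameBundle

/-! ### Tangent spaces of the frame bundle and of the lifted foliation -/

section FrameTangents

variable {n q : ℕ} {M : Type*} [TopologicalSpace M] [ChartedSpace (EuclideanSpace ℝ (Fin n)) M]
  [IsManifold (𝓡 n) ∞ M] {r s : WithTop ℕ∞} {x₀ : M}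
  {F : Foliation n M q s} {g : PseudoRiemannianMetric n M r}

namespace Foliation

variable {k : ℕ∞} {D : BundleLikeChart (EuclideanSpace ℝ (Fin n)) (EuclideanSpace ℝ (Fin q)) k}
  {p : CoframeSpace n M q}

theorem IsAdaptedChart.symm_mem_lorentzFrameBundle_iff (hD : F.IsAdaptedChart g x₀ D)
    (hg : g.IsBundleLike F) (hl : F.IsTransverselyLorentzian g)
    {c : EuclideanSpace ℝ (Fin n) × (EuclideanSpace ℝ (Fin n) →L[ℝ] EuclideanSpace ℝ (Fin q))}
    (hc : c.1 ∈ D.W) :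
    (coframeChart q x₀).symm c ∈ F.lorentzFrameBundle g ↔ c ∈ D.frames (lorentzMap q) := by
  have ht := hD.subset_target hc
  have hpr := coframeChart_symm_proj (q := q) ht
  have hr := (coframeChart q x₀).right_inv (mem_coframeChart_target.2 ht)
  rw [hD.mem_lorentzFrameBundle_iff hg hl
    (by rw [hpr]; exact (extChartAt (𝓡 n) x₀).map_target ht)
    (by rw [hpr, (extChartAt (𝓡 n) x₀).right_inv ht]; exact hc), hr]

/-- The condition of lying in the domain of an adapted chart. -/
def InChart (x₀ : M) (D : BundleLikeChart (EuclideanSpace ℝ (Fin n)) (EuclideanSpace ℝ (Fin q)) k)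
    (x : M) : Prop :=
  x ∈ (extChartAt (𝓡 n) x₀).source ∧ extChartAt (𝓡 n) x₀ x ∈ D.W

theorem InChart.eventually {x : M} (h : InChart x₀ D x) : ∀ᶠ x' in 𝓝 x, InChart x₀ D x' := by
  filter_upwards [(isOpen_extChartAt_source (I := 𝓡 n) x₀).mem_nhds h.1,
    (continuousAt_extChartAt' (I := 𝓡 n) h.1).preimage_mem_nhds (D.isOpen.mem_nhds h.2)]
    with x' h1 h2 using ⟨h1, h2⟩

theorem IsAdaptedChart.inChart_symm (hD : F.IsAdaptedChart g x₀ D) {z : EuclideanSpace ℝ (Fin n)}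
    (hz : z ∈ D.W) : InChart x₀ D ((extChartAt (𝓡 n) x₀).symm z) := by
  have ht := hD.subset_target hz
  refine ⟨(extChartAt (𝓡 n) x₀).map_target ht, ?_⟩
  rw [(extChartAt (𝓡 n) x₀).right_inv ht]
  exact hz

theorem coframeChart_fst (hx : InChart x₀ D p.1) :
    (coframeChart q x₀ p).1 = extChartAt (𝓡 n) x₀ p.1 := by
  rw [coframeChart_apply hx.1]

theorem IsAdaptedChart.mem_frames (hD : F.IsAdaptedChart g x₀ D)
    (hg : g.IsBundleLike F) (hl : F.IsTransverselyLorentzian g) (hx : InChart x₀ D p.1)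
    (hp : p ∈ F.lorentzFrameBundle g) : coframeChart q x₀ p ∈ D.frames (lorentzMap q) :=
  (hD.mem_lorentzFrameBundle_iff hg hl hx.1 hx.2).1 hp

theorem IsAdaptedChart.mem_submanifoldTangent_iff (hk : 1 ≤ k) (hD : F.IsAdaptedChart g x₀ D)
    (hg : g.IsBundleLike F) (hl : F.IsTransverselyLorentzian g) (hx : InChart x₀ D p.1)
    (hp : p ∈ F.lorentzFrameBundle g) (v : TangentSpace (coframeModel n q) p) :
    v ∈ submanifoldTangent (coframeModel n q) (F.lorentzFrameBundle g) p ↔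
      mfderiv (coframeModel n q) 𝓘(ℝ, _) (coframeChart q x₀) p v ∈
        D.frameTangent (lorentzMap q) (coframeChart q x₀ p).1 (coframeChart q x₀ p).2 := by
  have hps : p ∈ (coframeChart q x₀).source := mem_coframeChart_source.2 hx.1
  have hfr := hD.mem_frames hg hl hx hp
  have hev : ∀ c : ℝ → EuclideanSpace ℝ (Fin n) ×
      (EuclideanSpace ℝ (Fin n) →L[ℝ] EuclideanSpace ℝ (Fin q)), c 0 = coframeChart q x₀ p →
      ContinuousAt c 0 → ∀ᶠ t in 𝓝 0, (c t).1 ∈ D.W := by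
    intro c h0 hc
    have h1 : (c 0).1 ∈ D.W := by rw [h0, coframeChart_fst hx]; exact hx.2
    exact hc.fst.preimage_mem_nhds (D.isOpen.mem_nhds h1)
  rw [_root_.mem_submanifoldTangent_iff hps]
  constructor
  · rintro ⟨c, h0, hc, hd, hS⟩
    have := D.mem_frameTangent_of_hasDerivAt lorentzMap_lorentzMap adjoint_lorentzMap hd (by
      filter_upwards [hS, hev c h0 hc.continuousAt] with t h1 h2
      exact (hD.symm_mem_lorentzFrameBundle_iff hg hl h2).1 h1)
    rwa [h0] at this
  · intro h
    obtain ⟨c, h0, hc, hd, hS⟩ := D.exists_curve_of_mem_frameTangent hk hfr h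
    refine ⟨c, h0, hc, hd, ?_⟩
    filter_upwards [hS, hev c h0 hc.continuousAt] with t h1 h2
    exact (hD.symm_mem_lorentzFrameBundle_iff hg hl h2).2 h1

theorem coframeChart_differentialSection {y : M → EuclideanSpace ℝ (Fin q)} {x : M}
    (hx : x ∈ (extChartAt (𝓡 n) x₀).source) (hy : MDifferentiableAt (𝓡 n) (𝓡 q) y x) :
    coframeChart q x₀ (differentialSection y x) = (extChartAt (𝓡 n) x₀ x,
      fderiv ℝ (y ∘ (extChartAt (𝓡 n) x₀).symm) (extChartAt (𝓡 n) x₀ x)) := by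
  rw [coframeChart_apply (p := differentialSection y x) hx]
  refine Prod.ext rfl ?_
  have hz := (extChartAt (𝓡 n) x₀).map_source hx
  have hzx := (extChartAt (𝓡 n) x₀).left_inv hx
  have h := fderiv_comp_extChartAt_symm (y := y) hz (by rwa [hzx])
  refine Eq.trans ?_ h.symm
  have : ∀ x' (_ : x' = x), (mfderiv (𝓡 n) (𝓡 q) y x : EuclideanSpace ℝ (Fin n) →L[ℝ]
    EuclideanSpace ℝ (Fin q)) = mfderiv (𝓡 n) (𝓡 q) y x' := by
    rintro _ rfl
    rfl
  exact congrArg (fun T : EuclideanSpace ℝ (Fin n) →L[ℝ] EuclideanSpace ℝ (Fin q) =>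
    T.comp (mfderiv (𝓡 n) (𝓡 n) (extChartAt (𝓡 n) x₀).symm (extChartAt (𝓡 n) x₀ x) :
          EuclideanSpace ℝ (Fin n) →L[ℝ] EuclideanSpace ℝ (Fin n))) (this _ hzx)

theorem contDiffAt_comp_extChartAt_symm {y : M → EuclideanSpace ℝ (Fin q)} {x : M}
    (hx : x ∈ (extChartAt (𝓡 n) x₀).source) {m : ℕ∞} (hy : ContMDiffAt (𝓡 n) (𝓡 q) m y x) :
    ContDiffAt ℝ m (y ∘ (extChartAt (𝓡 n) x₀).symm) (extChartAt (𝓡 n) x₀ x) := by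
  have hz := (extChartAt (𝓡 n) x₀).map_source hx
  have hzx := (extChartAt (𝓡 n) x₀).left_inv hx
  rw [← hzx] at hy
  exact (hy.comp _ ((contMDiffAt_extChartAt_symm_of_mem hz).of_le
    (WithTop.coe_le_coe.2 le_top))).contDiffAt

/-- In charts the section dy is z ↦ (z, D(y ∘ φ⁻¹)(z)), so its velocity involves the second
derivative of y; this ties the lifted foliation to the horizontal lift. -/
theorem mfderiv_coframeChart_differentialSection {y : M → EuclideanSpace ℝ (Fin q)} {x : M}
    (hx : x ∈ (extChartAt (𝓡 n) x₀).source) (hy : ContMDiffAt (𝓡 n) (𝓡 q) 2 y x)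
    (u : TangentSpace (𝓡 n) x) :
    (mfderiv (coframeModel n q) 𝓘(ℝ, EuclideanSpace ℝ (Fin n) ×
      (EuclideanSpace ℝ (Fin n) →L[ℝ] EuclideanSpace ℝ (Fin q))) (coframeChart (n := n) q x₀)
      (differentialSection y x)
      (mfderiv (𝓡 n) (coframeModel n q) (differentialSection y) x u) :
        EuclideanSpace ℝ (Fin n) × (EuclideanSpace ℝ (Fin n) →L[ℝ] EuclideanSpace ℝ (Fin q))) =
      ((mfderiv (𝓡 n) (𝓡 n) (extChartAt (𝓡 n) x₀) x u : EuclideanSpace ℝ (Fin n)),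
        fderiv ℝ (fderiv ℝ (y ∘ (extChartAt (𝓡 n) x₀).symm)) (extChartAt (𝓡 n) x₀ x)
          (mfderiv (𝓡 n) (𝓡 n) (extChartAt (𝓡 n) x₀) x u : EuclideanSpace ℝ (Fin n))) := by
  set φ := extChartAt (𝓡 n) x₀ with hφ
  let h : EuclideanSpace ℝ (Fin n) →
      EuclideanSpace ℝ (Fin n) × (EuclideanSpace ℝ (Fin n) →L[ℝ] EuclideanSpace ℝ (Fin q)) :=
    fun z => (z, fderiv ℝ (y ∘ φ.symm) z)
  have hev : (coframeChart q x₀) ∘ (differentialSection y) =ᶠ[𝓝 x] h ∘ φ := by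
    filter_upwards [(isOpen_extChartAt_source (I := 𝓡 n) x₀).mem_nhds hx,
      (contMDiffAt_iff_contMDiffAt_nhds (by simp)).1 hy] with x' hx' hy'
    exact coframeChart_differentialSection hx' (hy'.mdifferentiableAt (by simp))
  have hd2 : HasFDerivAt (fderiv ℝ (y ∘ φ.symm)) (fderiv ℝ (fderiv ℝ (y ∘ φ.symm)) (φ x)) (φ x) :=
    ((contDiffAt_comp_extChartAt_symm (m := 2) hx hy).fderiv_right
      (m := 1) (by norm_num)).differentiableAt (by simp) |>.hasFDerivAt
  have hh : HasFDerivAt h ((ContinuousLinearMap.id ℝ _).prod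
      (fderiv ℝ (fderiv ℝ (y ∘ φ.symm)) (φ x))) (φ x) := (hasFDerivAt_id _).prodMk hd2
  have hφd : HasMFDerivAt (𝓡 n) (𝓡 n) φ x (mfderiv (𝓡 n) (𝓡 n) φ x) :=
    (mdifferentiableAt_extChartAt_of_mem hx).hasMFDerivAt
  have h1 := hh.hasMFDerivAt.comp x hφd
  have h2 := h1.congr_of_eventuallyEq hev
  have hps : differentialSection (n := n) y x ∈ (coframeChart q x₀).source := mem_coframeChart_source.2 hx
  -- The chain rule for the chart requires the section itself to be differentiable, which is read
  -- back from its chart expression.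
  have hσ : MDifferentiableAt (𝓡 n) (coframeModel n q) (differentialSection (n := n) y) x := by
    have h3 := (contMDiffAt_extChartAt_symm_of_mem
      ((coframeChart q x₀).map_source hps)).mdifferentiableAt (by simp)
    have h4 := MDifferentiableAt.comp x h3 h2.mdifferentiableAt
    refine h4.congr_of_eventuallyEq ?_
    filter_upwards [(isOpen_extChartAt_source (I := 𝓡 n) x₀).mem_nhds hx] with x' hx'
    exact ((coframeChart q x₀).left_inv (mem_coframeChart_source.2 hx')).symm
  have h5 := (mdifferentiableAt_extChartAt_of_mem hps).hasMFDerivAt.comp x hσ.hasMFDerivAt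
  exact congrArg (fun T : EuclideanSpace ℝ (Fin n) →L[ℝ] EuclideanSpace ℝ (Fin n) ×
    (EuclideanSpace ℝ (Fin n) →L[ℝ] EuclideanSpace ℝ (Fin q)) => T u) (hasMFDerivAt_unique h5 h2)

end Foliation

end FrameTangents

/-! ### The lifted foliation and the standard vectors -/

section StandardVectors

variable {n q : ℕ} {M : Type*} [TopologicalSpace M] [ChartedSpace (EuclideanSpace ℝ (Fin n)) M]
  [IsManifold (𝓡 n) ∞ M] {r : WithTop ℕ∞} {x₀ : M} {k : ℕ∞}
  {F : Foliation n M q ((k : WithTop ℕ∞) + 2)} {g : PseudoRiemannianMetric n M r}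

namespace Foliation

variable {D : BundleLikeChart (EuclideanSpace ℝ (Fin n)) (EuclideanSpace ℝ (Fin q)) k}
  {p : CoframeSpace n M q}

variable (F) in
/-- `y` is a submersion on `U` whose fibres are the plaques of `F`. -/
def IsPlaqueSubmersion (U : Set M) (y : M → EuclideanSpace ℝ (Fin q)) : Prop :=
  ContMDiffOn (𝓡 n) (𝓡 q) ((k : WithTop ℕ∞) + 2) y U ∧
    ∀ x ∈ U, Function.Surjective (mfderiv (𝓡 n) (𝓡 q) y x) ∧
      ∀ u : TangentSpace (𝓡 n) x, u ∈ F.tangent x ↔ mfderiv (𝓡 n) (𝓡 q) y x u = 0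

theorem IsPlaqueSubmersion.contMDiffAt {U : Set M} {y : M → EuclideanSpace ℝ (Fin q)}
    (h : F.IsPlaqueSubmersion U y) (hU : IsOpen U) {x : M} (hx : x ∈ U) :
    ContMDiffAt (𝓡 n) (𝓡 q) 2 y x :=
  (h.1.contMDiffAt (hU.mem_nhds hx)).of_le le_add_self

theorem IsAdaptedChart.eventually_ker (hD : F.IsAdaptedChart g x₀ D) {U : Set M}
    {y : M → EuclideanSpace ℝ (Fin q)} (h : F.IsPlaqueSubmersion U y) (hU : IsOpen U)
    {x : M} (hx : InChart x₀ D x) (hxU : x ∈ U) :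
    ∀ᶠ z in 𝓝 (extChartAt (𝓡 n) x₀ x), ∀ e, D.dY z e = 0 →
      fderiv ℝ (y ∘ (extChartAt (𝓡 n) x₀).symm) z e = 0 := by
  have h1 : ∀ᶠ z in 𝓝 (extChartAt (𝓡 n) x₀ x), (extChartAt (𝓡 n) x₀).symm z ∈ U :=
    (continuousAt_extChartAt_symm' (I := 𝓡 n) hx.1).preimage_mem_nhds
      (hU.mem_nhds (by rwa [(extChartAt (𝓡 n) x₀).left_inv hx.1]))
  filter_upwards [h1, D.isOpen.mem_nhds hx.2] with z hzU hzW e he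
  refine (congrArg (fun T : EuclideanSpace ℝ (Fin n) →L[ℝ] EuclideanSpace ℝ (Fin q) => T e)
    (fderiv_comp_extChartAt_symm (hD.subset_target hzW)
      ((h.contMDiffAt hU hzU).mdifferentiableAt (by simp)))).trans ?_
  exact ((h.2 _ hzU).2 _).1 ((hD.ker z hzW e).1 he)

/-- Through a Lorentz frame there is a submersion whose transverse metric is constant to first
order. -/
theorem IsAdaptedChart.exists_submersion (hD : F.IsAdaptedChart g x₀ D)
    (hg : g.IsBundleLike F) (hl : F.IsTransverselyLorentzian g) (hx : InChart x₀ D p.1)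
    (hp : p ∈ F.lorentzFrameBundle g) : ∃ (U : Set M) (y : M → EuclideanSpace ℝ (Fin q)),
      IsOpen U ∧ p.1 ∈ U ∧ F.IsPlaqueSubmersion U y ∧ differentialSection y p.1 = p ∧
      HasMFDerivAt (𝓡 n) 𝓘(ℝ, EuclideanSpace ℝ (Fin q) →L[ℝ] EuclideanSpace ℝ (Fin q))
        (fun x => gram (g.form x) (mfderiv (𝓡 n) (𝓡 q) y x :
          EuclideanSpace ℝ (Fin n) →L[ℝ] EuclideanSpace ℝ (Fin q))) p.1
        (0 : EuclideanSpace ℝ (Fin n) →L[ℝ] EuclideanSpace ℝ (Fin q) →L[ℝ]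
          EuclideanSpace ℝ (Fin q)) := by
  have hfr := hD.mem_frames hg hl hx hp
  rw [coframeChart_apply hx.1] at hfr
  obtain ⟨O, y, hO, hxO, hOW, hy, hyO, hdy, hgram⟩ :=
    D.exists_submersion_of_mem_frames lorentzMap_lorentzMap hfr
  set φ := extChartAt (𝓡 n) x₀ with hφ
  have hU : IsOpen (φ.source ∩ φ ⁻¹' O) :=
    (continuousOn_extChartAt x₀).isOpen_inter_preimage (isOpen_extChartAt_source x₀) hO
  have hd : ∀ x ∈ φ.source ∩ φ ⁻¹' O, HasMFDerivAt (𝓡 n) (𝓡 q) (y ∘ φ) x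
      ((fderiv ℝ y (φ x)).comp (mfderiv (𝓡 n) (𝓡 n) φ x :
        EuclideanSpace ℝ (Fin n) →L[ℝ] EuclideanSpace ℝ (Fin n))) := by
    intro x hx
    have h1 : HasFDerivAt y (fderiv ℝ y (φ x)) (φ x) :=
      ((hy.contDiffAt (hO.mem_nhds hx.2)).differentiableAt (by simp)).hasFDerivAt
    exact h1.hasMFDerivAt.comp x (mdifferentiableAt_extChartAt_of_mem hx.1).hasMFDerivAt
  have hmf : ∀ x ∈ φ.source ∩ φ ⁻¹' O, (mfderiv (𝓡 n) (𝓡 q) (y ∘ φ) x :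
      EuclideanSpace ℝ (Fin n) →L[ℝ] EuclideanSpace ℝ (Fin q)) = (fderiv ℝ y (φ x)).comp
      (mfderiv (𝓡 n) (𝓡 n) φ x : EuclideanSpace ℝ (Fin n) →L[ℝ] EuclideanSpace ℝ (Fin n)) :=
    fun x hx => (hd x hx).mfderiv
  have hinv := fun x (hx : x ∈ φ.source) => mfderiv_extChartAt_isInvertible (J := 𝓡 n) hx
  refine ⟨φ.source ∩ φ ⁻¹' O, y ∘ φ, hU, ⟨hx.1, hxO⟩, ⟨?_, fun x hx => ⟨?_, fun u => ?_⟩⟩, ?_, ?_⟩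
  · intro x hx
    have h1 : ContMDiffAt (𝓡 n) (𝓡 n) ((k : WithTop ℕ∞) + 2) φ x :=
      ((contMDiffOn_extChartAt (n := ∞)).contMDiffAt ((chartAt _ x₀).open_source.mem_nhds
        (by rw [← extChartAt_source (𝓡 n)]; exact hx.1))).of_le
        (show ((k + 2 : ℕ∞) : WithTop ℕ∞) ≤ _ from WithTop.coe_le_coe.2 le_top)
    exact ((hy.contDiffAt (hO.mem_nhds hx.2)).contMDiffAt.comp x h1).contMDiffWithinAt
  · intro v
    obtain ⟨w, hw⟩ := (hyO _ hx.2).1 v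
    obtain ⟨u, hu⟩ := (hinv x hx.1).surjective w
    exact ⟨u, (congrArg (fun T : EuclideanSpace ℝ (Fin n) →L[ℝ] EuclideanSpace ℝ (Fin q) => T u)
      (hmf x hx)).trans ((congrArg (fderiv ℝ y (φ x)) hu).trans hw)⟩
  · have h1 := hD.ker (φ x) (hOW hx.2) (mfderiv (𝓡 n) (𝓡 n) φ x u)
    have h2 := mfderiv_symm_extChartAt_apply hx.1 u
    have h3 := φ.left_inv hx.1
    have h4 : ∀ x' (_ : x' = x), ((u : EuclideanSpace ℝ (Fin n)) ∈ F.tangent x' ↔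
        u ∈ F.tangent x) := by
      rintro _ rfl
      rfl
    have h5 : D.dY (φ x) (mfderiv (𝓡 n) (𝓡 n) φ x u) = 0 ↔
        (u : EuclideanSpace ℝ (Fin n)) ∈ F.tangent (φ.symm (φ x)) := by
      rw [h1]
      exact iff_of_eq (congrArg (fun w : EuclideanSpace ℝ (Fin n) =>
        w ∈ F.tangent (φ.symm (φ x))) h2)
    refine ((h4 _ h3).symm.trans h5.symm).trans ?_
    refine ((hyO _ hx.2).2 _).symm.trans (Eq.congr_left ?_)
    exact (congrArg (fun T : EuclideanSpace ℝ (Fin n) →L[ℝ] EuclideanSpace ℝ (Fin q) => T u)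
      (hmf x hx)).symm
  · refine TotalSpace.ext rfl (heq_of_eq ?_)
    refine (hmf p.1 ⟨hx.1, hxO⟩).trans ?_
    rw [hdy]
    refine ContinuousLinearMap.ext fun u => ?_
    exact congrArg (p.2 : EuclideanSpace ℝ (Fin n) →L[ℝ] EuclideanSpace ℝ (Fin q))
      (mfderiv_symm_extChartAt_apply hx.1 u)
  · have h1 := hgram.hasMFDerivAt.comp p.1
      (mdifferentiableAt_extChartAt_of_mem (J := 𝓡 n) hx.1).hasMFDerivAt
    refine (h1.congr_mfderiv (ContinuousLinearMap.zero_comp _)).congr_of_eventuallyEq ?_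
    filter_upwards [hU.mem_nhds ⟨hx.1, hxO⟩] with x hx
    rw [hmf x hx]
    refine gram_congr (D.inv _ (hOW hx.2)) (PseudoRiemannianMetric.form_isInvertible x) _
      (hinv x hx.1) (fun u v => ?_) _
    rw [hD.form _ (hOW hx.2)]
    exact (PseudoRiemannianMetric.chartForm_mfderiv hx.1 u v).symm

end Foliation

end StandardVectors

/-! ### The lifted foliation and the standard vectors in charts -/

section LiftTangent

variable {n q : ℕ} {M : Type*} [TopologicalSpace M] [ChartedSpace (EuclideanSpace ℝ (Fin n)) M]
  [IsManifold (𝓡 n) ∞ M] {r : WithTop ℕ∞} {x₀ : M} {k : ℕ∞}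
  {F : Foliation n M q ((k : WithTop ℕ∞) + 2)} {g : PseudoRiemannianMetric n M r}

namespace Foliation

/-- The derivative of a chart of the space of coframes. -/
noncomputable def coframeDeriv (x₀ : M) (p : CoframeSpace n M q) :
    TangentSpace (coframeModel n q) p →L[ℝ]
      EuclideanSpace ℝ (Fin n) × (EuclideanSpace ℝ (Fin n) →L[ℝ] EuclideanSpace ℝ (Fin q)) :=
  mfderiv (coframeModel n q) 𝓘(ℝ, EuclideanSpace ℝ (Fin n) ×
      (EuclideanSpace ℝ (Fin n) →L[ℝ] EuclideanSpace ℝ (Fin q))) (coframeChart (n := n) q x₀) p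

variable {D : BundleLikeChart (EuclideanSpace ℝ (Fin n)) (EuclideanSpace ℝ (Fin q)) k}
  {p : CoframeSpace n M q}

theorem coframeDeriv_bijective (hp : p.1 ∈ (extChartAt (𝓡 n) x₀).source) :
    Function.Bijective (coframeDeriv x₀ p) :=
  (mfderiv_extChartAt_isInvertible (mem_coframeChart_source.2 hp)).bijective

theorem coframeDeriv_of_eq {y : M → EuclideanSpace ℝ (Fin q)} {x : M}
    (hx : x ∈ (extChartAt (𝓡 n) x₀).source) (hy : ContMDiffAt (𝓡 n) (𝓡 q) 2 y x)
    {u : TangentSpace (𝓡 n) x} {p : CoframeSpace n M q} {v : TangentSpace (coframeModel n q) p}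
    (h : (⟨differentialSection y x, mfderiv (𝓡 n) (coframeModel n q) (differentialSection y) x u⟩ :
          TangentBundle (coframeModel n q) (CoframeSpace n M q)) = ⟨p, v⟩) :
    coframeDeriv x₀ p v = ((mfderiv (𝓡 n) (𝓡 n) (extChartAt (𝓡 n) x₀) x u :
        EuclideanSpace ℝ (Fin n)),
        fderiv ℝ (fderiv ℝ (y ∘ (extChartAt (𝓡 n) x₀).symm)) (extChartAt (𝓡 n) x₀ x)
          (mfderiv (𝓡 n) (𝓡 n) (extChartAt (𝓡 n) x₀) x u : EuclideanSpace ℝ (Fin n))) ∧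
    coframeChart q x₀ p = (extChartAt (𝓡 n) x₀ x,
      fderiv ℝ (y ∘ (extChartAt (𝓡 n) x₀).symm) (extChartAt (𝓡 n) x₀ x)) := by
  obtain rfl : differentialSection y x = p := congrArg TotalSpace.proj h
  obtain rfl := TotalSpace.mk_inj.1 h
  exact ⟨mfderiv_coframeChart_differentialSection hx hy u,
    coframeChart_differentialSection hx (hy.mdifferentiableAt (by simp))⟩

theorem IsAdaptedChart.ker_mfderiv (hD : F.IsAdaptedChart g x₀ D) {x : M} (hx : InChart x₀ D x)
    (u : TangentSpace (𝓡 n) x) : D.dY (extChartAt (𝓡 n) x₀ x)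
      (mfderiv (𝓡 n) (𝓡 n) (extChartAt (𝓡 n) x₀) x u : EuclideanSpace ℝ (Fin n)) = 0 ↔
      u ∈ F.tangent x := by
  have h4 : ∀ x' (_ : x' = x), ((u : EuclideanSpace ℝ (Fin n)) ∈ F.tangent x' ↔
      u ∈ F.tangent x) := by
    rintro _ rfl
    rfl
  refine (hD.ker _ hx.2 _).trans (Iff.trans ?_ (h4 _ ((extChartAt (𝓡 n) x₀).left_inv hx.1)))
  exact iff_of_eq (congrArg (fun w : EuclideanSpace ℝ (Fin n) =>
    w ∈ F.tangent ((extChartAt (𝓡 n) x₀).symm (extChartAt (𝓡 n) x₀ x)))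
    (mfderiv_symm_extChartAt_apply hx.1 u))

/-- Every generator satisfies the right-hand condition, because all plaque submersions have the same
second differential in leaf directions; the condition is linear, so it passes to the span.
Conversely, one plaque submersion through p already realizes every such vector. -/
theorem IsAdaptedChart.mem_liftTangent_iff (hD : F.IsAdaptedChart g x₀ D)
    (hg : g.IsBundleLike F) (hl : F.IsTransverselyLorentzian g) (hx : InChart x₀ D p.1)
    (hp : p ∈ F.lorentzFrameBundle g) (v : TangentSpace (coframeModel n q) p) :
    v ∈ F.liftTangent p ↔ D.dY (coframeChart q x₀ p).1 (coframeDeriv x₀ p v).1 = 0 ∧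
      (coframeDeriv x₀ p v).2 =
        D.lift (coframeChart q x₀ p).1 (coframeChart q x₀ p).2 (coframeDeriv x₀ p v).1 := by
  constructor
  · intro hv
    refine Submodule.span_induction (p := fun v _ =>
      D.dY (coframeChart q x₀ p).1 (coframeDeriv x₀ p v).1 = 0 ∧ (coframeDeriv x₀ p v).2 =
        D.lift (coframeChart q x₀ p).1 (coframeChart q x₀ p).2 (coframeDeriv x₀ p v).1)
      ?_ ?_ ?_ ?_ hv
    · rintro v ⟨U, y, hU, hxU, hy, hyU, u, hu, h⟩
      have hyp : F.IsPlaqueSubmersion U y := ⟨hy, hyU⟩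
      have hy2 := hyp.contMDiffAt hU hxU
      obtain ⟨h1, h2⟩ := coframeDeriv_of_eq hx.1 hy2 h
      rw [h1, h2]
      have h3 := (hD.ker_mfderiv hx u).2 hu
      exact ⟨h3, D.fderiv_fderiv_eq_lift_of_mem_ker hx.2
        (contDiffAt_comp_extChartAt_symm (m := 2) hx.1 hy2) (hD.eventually_ker hyp hU hx hxU) h3⟩
    · rw [map_zero]
      exact ⟨map_zero _, (map_zero _).symm⟩
    · rintro v w - - ⟨h1, h2⟩ ⟨h3, h4⟩
      rw [map_add, Prod.fst_add, Prod.snd_add, map_add, map_add, h1, h2, h3, h4]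
      exact ⟨add_zero _, rfl⟩
    · rintro a v - ⟨h1, h2⟩
      rw [map_smul, Prod.smul_fst, Prod.smul_snd, map_smul, map_smul, h1, h2]
      exact ⟨smul_zero _, rfl⟩
  · rintro ⟨h1, h2⟩
    obtain ⟨U, y, hU, hxU, hyp, hσ, -⟩ := hD.exists_submersion hg hl hx hp
    have hy2 := hyp.contMDiffAt hU hxU
    obtain ⟨u, hu⟩ := (mfderiv_extChartAt_isInvertible (J := 𝓡 n) hx.1).surjective
      (coframeDeriv x₀ p v).1
    have hu' : (mfderiv (𝓡 n) (𝓡 n) (extChartAt (𝓡 n) x₀) p.1 u : EuclideanSpace ℝ (Fin n)) =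
      (coframeDeriv x₀ p v).1 := hu
    have huF : u ∈ F.tangent p.1 := by
      rw [← hD.ker_mfderiv hx u, hu', ← coframeChart_fst hx]
      exact h1
    have hcast : ∀ p' (_ : differentialSection y p.1 = p'),
        ∃ v', (⟨differentialSection y p.1,
          mfderiv (𝓡 n) (coframeModel n q) (differentialSection y) p.1 u⟩ :
          TangentBundle (coframeModel n q) (CoframeSpace n M q)) = ⟨p', v'⟩ := by
      rintro _ rfl
      exact ⟨_, rfl⟩
    obtain ⟨v', hv'⟩ := hcast p hσ
    refine Submodule.subset_span ⟨U, y, hU, hxU, hyp.1, hyp.2, u, huF, ?_⟩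
    rw [hv']
    congr 1
    apply (coframeDeriv_bijective hx.1).1
    obtain ⟨h3, h4⟩ := coframeDeriv_of_eq hx.1 hy2 hv'
    rw [hu'] at h3
    rw [h3]
    refine Prod.ext rfl ?_
    rw [h2]
    rw [coframeChart_fst hx] at h1
    have h5 := D.fderiv_fderiv_eq_lift_of_mem_ker hx.2
      (contDiffAt_comp_extChartAt_symm (m := 2) hx.1 hy2) (hD.eventually_ker hyp hU hx hxU) h1
    rw [h4]
    exact h5

/-- At a Lorentz frame, some tangent vector is the value of the standard field in all charts. -/
theorem IsAdaptedChart.exists_standardVector (hD : F.IsAdaptedChart g x₀ D)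
    (hg : g.IsBundleLike F) (hl : F.IsTransverselyLorentzian g) (hx : InChart x₀ D p.1)
    (hp : p ∈ F.lorentzFrameBundle g) (ξ : EuclideanSpace ℝ (Fin q))
    (A : EuclideanSpace ℝ (Fin q) →L[ℝ] EuclideanSpace ℝ (Fin q)) :
    ∃ w : TangentSpace (coframeModel n q) p, ∀ (x₁ : M)
      (D₁ : BundleLikeChart (EuclideanSpace ℝ (Fin n)) (EuclideanSpace ℝ (Fin q)) k),
      F.IsAdaptedChart g x₁ D₁ → InChart x₁ D₁ p.1 →
      coframeDeriv x₁ p w = D₁.stdField (lorentzMap q) ξ A (coframeChart q x₁ p) := by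
  obtain ⟨U, y, hU, hxU, hyp, hσ, hgram⟩ := hD.exists_submersion hg hl hx hp
  have hy2 := hyp.contMDiffAt hU hxU
  let P : EuclideanSpace ℝ (Fin n) →L[ℝ] EuclideanSpace ℝ (Fin q) := p.2
  -- The vector of TF^⊥ whose coordinates in the frame p are ξ. The horizontal part of the standard
  -- vector is the velocity of dy along u, which is defined without the chart.
  let u : TangentSpace (𝓡 n) p.1 := raise (g.form p.1) P (lorentzMap q ξ)
  have hcast : ∀ p' (_ : differentialSection y p.1 = p'),
      ∃ v', (⟨differentialSection y p.1,
        mfderiv (𝓡 n) (coframeModel n q) (differentialSection y) p.1 u⟩ :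
        TangentBundle (coframeModel n q) (CoframeSpace n M q)) = ⟨p', v'⟩ := by
    rintro _ rfl
    exact ⟨_, rfl⟩
  obtain ⟨w₁, hw₁⟩ := hcast p hσ
  -- the vertical part
  let c : ℝ → CoframeSpace n M q := fun t => ⟨p.1, (P + t • A.comp P :
    EuclideanSpace ℝ (Fin n) →L[ℝ] EuclideanSpace ℝ (Fin q))⟩
  have hc0 : c 0 = p := by
    refine TotalSpace.ext rfl (heq_of_eq ?_)
    change P + (0 : ℝ) • A.comp P = P
    rw [zero_smul, add_zero]
  have hcd : ∀ x₁ : M, p.1 ∈ (extChartAt (𝓡 n) x₁).source →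
      HasDerivAt (fun t => coframeChart q x₁ (c t)) (0, A.comp (coframeChart q x₁ p).2) 0 := by
    intro x₁ hx₁
    let L : EuclideanSpace ℝ (Fin n) →L[ℝ] EuclideanSpace ℝ (Fin n) :=
      mfderiv (𝓡 n) (𝓡 n) (extChartAt (𝓡 n) x₁).symm (extChartAt (𝓡 n) x₁ p.1)
    have h1 : (fun t => coframeChart q x₁ (c t)) = fun t : ℝ =>
        (extChartAt (𝓡 n) x₁ p.1, (coframeChart q x₁ p).2 + t • A.comp (coframeChart q x₁ p).2) := by
      funext t
      rw [coframeChart_apply (p := c t) hx₁, coframeChart_apply hx₁]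
      refine Prod.ext rfl ?_
      change (P + t • A.comp P).comp L = P.comp L + t • A.comp (P.comp L)
      ext e i
      rfl
    rw [h1]
    refine (hasDerivAt_const _ _).prodMk ?_
    have h2 := ((hasDerivAt_id (0 : ℝ)).smul_const (A.comp (coframeChart q x₁ p).2)).const_add
      (coframeChart q x₁ p).2
    rw [one_smul] at h2
    exact h2
  have hcm : MDifferentiableAt 𝓘(ℝ, ℝ) (coframeModel n q) c 0 := by
    have hs : c 0 ∈ (coframeChart q x₀).source := mem_coframeChart_source.2 hx.1
    have h3 := (contMDiffAt_extChartAt_symm_of_mem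
      ((coframeChart q x₀).map_source hs)).mdifferentiableAt (by simp)
    have h4 := MDifferentiableAt.comp (0 : ℝ) h3
      (hcd x₀ hx.1).hasFDerivAt.hasMFDerivAt.mdifferentiableAt
    refine h4.congr_of_eventuallyEq (Filter.Eventually.of_forall fun t => ?_)
    exact ((coframeChart q x₀).left_inv (show c t ∈ (coframeChart q x₀).source from
      mem_coframeChart_source.2 hx.1)).symm
  have hvert : ∀ p' (_ : c 0 = p'), ∃ w₂ : TangentSpace (coframeModel n q) p', ∀ x₁ : M,
      p.1 ∈ (extChartAt (𝓡 n) x₁).source →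
      coframeDeriv x₁ p' w₂ = (0, A.comp (coframeChart q x₁ p).2) := by
    rintro _ rfl
    refine ⟨mfderiv 𝓘(ℝ, ℝ) (coframeModel n q) c 0 (1 : ℝ), fun x₁ hx₁ => ?_⟩
    have hs : c 0 ∈ (coframeChart q x₁).source := mem_coframeChart_source.2 hx₁
    have h5 := (mdifferentiableAt_extChartAt_of_mem hs).hasMFDerivAt.comp (0 : ℝ) hcm.hasMFDerivAt
    have h6 := hasMFDerivAt_unique h5 (hcd x₁ hx₁).hasFDerivAt.hasMFDerivAt
    refine (congrArg (fun T : ℝ →L[ℝ] EuclideanSpace ℝ (Fin n) ×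
      (EuclideanSpace ℝ (Fin n) →L[ℝ] EuclideanSpace ℝ (Fin q)) => T 1) h6).trans ?_
    exact one_smul ℝ _
  obtain ⟨w₂, hw₂⟩ := hvert p hc0
  refine ⟨w₁ + w₂, fun x₁ D₁ hD₁ hx₁ => ?_⟩
  obtain ⟨h1, h2⟩ := coframeDeriv_of_eq hx₁.1 hy2 hw₁
  have hfr := hD₁.mem_frames hg hl hx₁ hp
  set φ := extChartAt (𝓡 n) x₁ with hφ
  set z := φ p.1 with hz
  have hL := mfderiv_extChartAt_isInvertible (J := 𝓡 n) hx₁.1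
  -- the horizontal vector in the chart
  have hu : (mfderiv (𝓡 n) (𝓡 n) φ p.1 u : EuclideanSpace ℝ (Fin n)) =
      raise (D₁.G (coframeChart q x₁ p).1) (coframeChart q x₁ p).2 (lorentzMap q ξ) := by
    have hzt := φ.map_source hx₁.1
    have hLi := (inverse_mfderiv_extChartAt_symm (J := 𝓡 n) hzt).1
    let L : EuclideanSpace ℝ (Fin n) →L[ℝ] EuclideanSpace ℝ (Fin n) :=
      mfderiv (𝓡 n) (𝓡 n) φ p.1
    have hPL : P = (coframeChart q x₁ p).2.comp L := by
      rw [coframeChart_apply hx₁.1]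
      refine ContinuousLinearMap.ext fun e => ?_
      exact (congrArg P (mfderiv_symm_extChartAt_apply hx₁.1 e)).symm
    have := raise_congr (D₁.inv z hx₁.2) (PseudoRiemannianMetric.form_isInvertible (g := g) p.1) L hL
      (fun u v => by
        rw [hD₁.form z hx₁.2]
        exact (PseudoRiemannianMetric.chartForm_mfderiv hx₁.1 u v).symm)
      (coframeChart q x₁ p).2 (lorentzMap q ξ)
    rw [← hPL] at this
    refine this.trans ?_
    rw [coframeChart_fst hx₁]
  -- The matrix of dy is a function on M, so its first-order constancy at the point passes to the
  -- arbitrary chart around x₁.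
  have hgram' : HasFDerivAt (fun z => gram (D₁.G z) (fderiv ℝ (y ∘ φ.symm) z))
      (0 : EuclideanSpace ℝ (Fin n) →L[ℝ] EuclideanSpace ℝ (Fin q) →L[ℝ]
          EuclideanSpace ℝ (Fin q)) z := by
    have hzx : φ.symm z = p.1 := φ.left_inv hx₁.1
    have hzt := φ.map_source hx₁.1
    rw [← hzx] at hgram
    have h5 := hgram.comp z
      ((contMDiffAt_extChartAt_symm_of_mem hzt).mdifferentiableAt (by simp)).hasMFDerivAt
    have h6 := (h5.congr_mfderiv (ContinuousLinearMap.zero_comp _)).hasFDerivAt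
    refine h6.congr_of_eventuallyEq ?_
    have h7 : ∀ᶠ z' in 𝓝 z, φ.symm z' ∈ U :=
      (continuousAt_extChartAt_symm' (I := 𝓡 n) hx₁.1).preimage_mem_nhds
        (hU.mem_nhds (by rwa [hzx]))
    filter_upwards [h7, D₁.isOpen.mem_nhds hx₁.2] with z' h8 h9
    have hzt' := hD₁.subset_target h9
    have h10 := fderiv_comp_extChartAt_symm (y := y) hzt'
      ((hyp.contMDiffAt hU h8).mdifferentiableAt (by simp))
    refine (congrArg (gram (D₁.G z')) h10).trans ?_
    refine gram_congr (PseudoRiemannianMetric.form_isInvertible _) (D₁.inv _ h9) _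
      (inverse_mfderiv_extChartAt_symm (J := 𝓡 n) hzt').1 (fun u v => ?_) _
    rw [hD₁.form _ h9]
    rfl
  rw [h2] at hfr
  obtain ⟨e, he⟩ : ∃ e : EuclideanSpace ℝ (Fin n), e = mfderiv (𝓡 n) (𝓡 n) φ p.1 u := ⟨_, rfl⟩
  have h1' : coframeDeriv x₁ p w₁ = (e, fderiv ℝ (fderiv ℝ (y ∘ φ.symm)) z e) := by
    rw [he]
    exact h1
  have h3 := D₁.fderiv_fderiv_eq_lift lorentzMap_lorentzMap
    (contDiffAt_comp_extChartAt_symm (m := 2) hx₁.1 hy2) (hD₁.eventually_ker hyp hU hx₁ hxU) hfr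
    hgram' e
  have hu' := he.trans hu
  rw [map_add, h1', hw₂ x₁ hx₁.1, BundleLikeChart.stdField, ← hu', Prod.mk_add_mk, add_zero]
  refine Prod.ext rfl ?_
  rw [h2]
  exact congrArg (· + _) h3

end Foliation

end LiftTangent

/-! ### The standard vector fields -/

section StandardFields

variable {n q : ℕ} {M : Type*} [TopologicalSpace M] [T2Space M] [SecondCountableTopology M]
  [ChartedSpace (EuclideanSpace ℝ (Fin n)) M]
  [IsManifold (𝓡 n) ∞ M] {k : ℕ∞}
  {F : Foliation n M q ((k : WithTop ℕ∞) + 2)}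
  {g : PseudoRiemannianMetric n M ((k : WithTop ℕ∞) + 1)}

namespace Foliation

instance coframeSpace_t2Space : T2Space (CoframeSpace n M q) := FiberBundle.totalSpace_t2Space

instance coframeSpace_secondCountableTopology : SecondCountableTopology (CoframeSpace n M q) :=
  FiberBundle.totalSpace_secondCountableTopology (HB := EuclideanSpace ℝ (Fin n))

/-- Needed, with the Hausdorff property, for partitions of unity on the space of coframes. -/
instance coframeSpace_sigmaCompactSpace : SigmaCompactSpace (CoframeSpace n M q) := by
  have : LocallyCompactSpace (CoframeSpace n M q) :=
    Manifold.locallyCompact_of_finiteDimensional (coframeModel n q)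
  infer_instance

variable (F g) in
/-- `X` is the standard vector field on the frame bundle with horizontal part `ξ` and vertical
part `A`. -/
def IsStandardField (ξ : EuclideanSpace ℝ (Fin q))
    (A : EuclideanSpace ℝ (Fin q) →L[ℝ] EuclideanSpace ℝ (Fin q))
    (X : ∀ p : CoframeSpace n M q, TangentSpace (coframeModel n q) p) : Prop :=
  ContMDiff (coframeModel n q) (coframeModel n q).tangent k
    (fun p => (⟨p, X p⟩ : TangentBundle (coframeModel n q) (CoframeSpace n M q))) ∧
  ∀ p ∈ F.lorentzFrameBundle g, ∀ (x₁ : M)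
    (D₁ : BundleLikeChart (EuclideanSpace ℝ (Fin n)) (EuclideanSpace ℝ (Fin q)) k),
    F.IsAdaptedChart g x₁ D₁ → InChart x₁ D₁ p.1 →
    coframeDeriv x₁ p (X p) = D₁.stdField (lorentzMap q) ξ A (coframeChart q x₁ p)

/-- Each chart provides a C^k field. On the frame bundle it takes the intrinsic standard value, so
it has the prescribed expression in all other charts too; off the bundle nothing is required. The
requirement is convex in each fibre, so a partition of unity glues the local fields. -/
theorem exists_isStandardField (hg : g.IsBundleLike F) (hl : F.IsTransverselyLorentzian g)
    (ξ : EuclideanSpace ℝ (Fin q))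
    (A : EuclideanSpace ℝ (Fin q) →L[ℝ] EuclideanSpace ℝ (Fin q)) :
    ∃ X, F.IsStandardField g ξ A X := by
  let t : ∀ p : CoframeSpace n M q, Set (TangentSpace (coframeModel n q) p) := fun p =>
    {w | p ∈ F.lorentzFrameBundle g → ∀ (x₁ : M)
      (D₁ : BundleLikeChart (EuclideanSpace ℝ (Fin n)) (EuclideanSpace ℝ (Fin q)) k),
      F.IsAdaptedChart g x₁ D₁ → InChart x₁ D₁ p.1 →
      coframeDeriv x₁ p w = D₁.stdField (lorentzMap q) ξ A (coframeChart q x₁ p)}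
  have ht : ∀ p, Convex ℝ (t p) := by
    intro p v hv w hw a b ha hb hab hp x₁ D₁ hD₁ hx₁
    rw [map_add, map_smul, map_smul, hv hp x₁ D₁ hD₁ hx₁, hw hp x₁ D₁ hD₁ hx₁, ← add_smul, hab,
      one_smul]
  obtain ⟨X, hX⟩ := exists_contMDiffSection_forall_mem_convex_of_local (coframeModel n q) (n := k)
    (fun p : CoframeSpace n M q => TangentSpace (coframeModel n q) p) t ht (by
    intro p₀
    obtain ⟨D, hD, hW⟩ := F.exists_isAdaptedChart g hg p₀.1
    have hU : ∀ᶠ p : CoframeSpace n M q in 𝓝 p₀, InChart p₀.1 D p.1 :=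
      (FiberBundle.continuous_proj (EuclideanSpace ℝ (Fin n) →L[ℝ] EuclideanSpace ℝ (Fin q))
        (fun x : M => TangentSpace (𝓡 n) x →L[ℝ] EuclideanSpace ℝ (Fin q))).continuousAt.eventually
        (InChart.eventually (⟨mem_extChartAt_source _, hW⟩ : InChart p₀.1 D p₀.1))
    refine ⟨_, hU, ofChartField (coframeModel n q) ⟨p₀.1, 0⟩ (D.stdField (lorentzMap q) ξ A),
      fun p hp => ?_, fun p hp => ?_⟩
    · refine (contMDiffAt_ofChartField (mem_coframeChart_source.2 hp.1) ?_).contMDiffWithinAt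
      refine (D.contDiffOn_stdField ξ A).contDiffAt ((D.isOpen.prod isOpen_univ).mem_nhds
        ⟨?_, mem_univ _⟩)
      change (coframeChart q p₀.1 p).1 ∈ D.W
      rw [coframeChart_fst hp]
      exact hp.2
    · intro hpS
      obtain ⟨w, hw⟩ := hD.exists_standardVector hg hl hp hpS ξ A
      have h1 : coframeDeriv p₀.1 p (ofChartField (coframeModel n q) ⟨p₀.1, 0⟩
          (D.stdField (lorentzMap q) ξ A) p) = D.stdField (lorentzMap q) ξ A
            (coframeChart q p₀.1 p) :=
        mfderiv_extChartAt_ofChartField (mem_coframeChart_source.2 hp.1) _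
      rw [(coframeDeriv_bijective hp.1).1 (h1.trans (hw _ D hD hp).symm)]
      exact hw)
  exact ⟨X, X.contMDiff, hX⟩

variable {ξ : EuclideanSpace ℝ (Fin q)}
  {A : EuclideanSpace ℝ (Fin q) →L[ℝ] EuclideanSpace ℝ (Fin q)}
  {X : ∀ p : CoframeSpace n M q, TangentSpace (coframeModel n q) p}

theorem IsStandardField.isVectorFieldOn (hk : 1 ≤ k) (hg : g.IsBundleLike F)
    (hl : F.IsTransverselyLorentzian g)
    (hA : A.comp (lorentzMap q) + (lorentzMap q).comp A.adjoint = 0)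
    (hX : F.IsStandardField g ξ A X) :
    IsVectorFieldOn (coframeModel n q) k (F.lorentzFrameBundle g) X := by
  refine ⟨hX.1, fun p hp => ?_⟩
  obtain ⟨D, hD, hW⟩ := F.exists_isAdaptedChart g hg p.1
  have hx : InChart p.1 D p.1 := ⟨mem_extChartAt_source _, hW⟩
  rw [hD.mem_submanifoldTangent_iff hk hg hl hx hp]
  have h := hX.2 p hp p.1 D hD hx
  have h2 := D.stdField_mem_frameTangent (ξ := ξ) hA (coframeChart q p.1 p)
  rw [← h] at h2
  exact h2

/-- Transfer principle: a pointwise property of a field along the frame bundle, stated through the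
chart derivative, holds for the field read in the chart along the orthonormal frames. -/
theorem IsAdaptedChart.chartField_of_mem_frames
    {x₀ : M} {D : BundleLikeChart (EuclideanSpace ℝ (Fin n)) (EuclideanSpace ℝ (Fin q)) k}
    (hD : F.IsAdaptedChart g x₀ D) (hg : g.IsBundleLike F) (hl : F.IsTransverselyLorentzian g)
    {Q : (EuclideanSpace ℝ (Fin n) × (EuclideanSpace ℝ (Fin n) →L[ℝ] EuclideanSpace ℝ (Fin q))) →
      (EuclideanSpace ℝ (Fin n) × (EuclideanSpace ℝ (Fin n) →L[ℝ] EuclideanSpace ℝ (Fin q))) → Prop}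
    (hQ : ∀ p ∈ F.lorentzFrameBundle g, InChart x₀ D p.1 →
      Q (coframeChart q x₀ p) (coframeDeriv x₀ p (X p)))
    {c : EuclideanSpace ℝ (Fin n) × (EuclideanSpace ℝ (Fin n) →L[ℝ] EuclideanSpace ℝ (Fin q))}
    (hc : c ∈ D.frames (lorentzMap q)) :
    Q c (chartField (coframeModel n q) (⟨x₀, 0⟩ : CoframeSpace n M q) X c) := by
  have hcW : c.1 ∈ D.W := hc.1
  have ht := hD.subset_target hcW
  have h1 := hQ ((coframeChart q x₀).symm c) ((hD.symm_mem_lorentzFrameBundle_iff hg hl hcW).2 hc)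
    (by rw [coframeChart_symm_proj ht]; exact hD.inChart_symm hcW)
  rw [(coframeChart q x₀).right_inv (mem_coframeChart_target.2 ht)] at h1
  exact h1

theorem IsStandardField.isBasicField (hk : 1 ≤ k) (hg : g.IsBundleLike F)
    (hl : F.IsTransverselyLorentzian g)
    (hA : A.comp (lorentzMap q) + (lorentzMap q).comp A.adjoint = 0)
    (hX : F.IsStandardField g ξ A X) :
    IsBasicField (coframeModel n q) k (F.lorentzFrameBundle g) F.liftTangent X := by
  refine ⟨hX.isVectorFieldOn hk hg hl hA, fun Z hZ hZF p hp => ?_⟩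
  obtain ⟨D, hD, hW⟩ := F.exists_isAdaptedChart g hg p.1
  have hx : InChart p.1 D p.1 := ⟨mem_extChartAt_source _, hW⟩
  have hps := mem_coframeChart_source.2 hx.1
  have hpt := (coframeChart q p.1).map_source hps
  have hk0 : (k : WithTop ℕ∞) ≠ 0 := by
    have : k ≠ 0 := (zero_lt_one.trans_le hk).ne'
    exact_mod_cast this
  rw [hD.mem_liftTangent_iff hg hl hx hp]
  have hbr : coframeDeriv p.1 p (mlieBracket (coframeModel n q) Z X p) = _ :=
    mfderiv_extChartAt_mlieBracket hps ((hZ.1 p).mdifferentiableAt hk0)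
      ((hX.1 p).mdifferentiableAt hk0)
  rw [hbr]
  have hdiff : ∀ Y : ∀ p : CoframeSpace n M q, TangentSpace (coframeModel n q) p,
      ContMDiff (coframeModel n q) (coframeModel n q).tangent k
      (fun p => (⟨p, Y p⟩ : TangentBundle (coframeModel n q) (CoframeSpace n M q))) →
      DifferentiableAt ℝ (chartField (coframeModel n q) (⟨p.1, 0⟩ : CoframeSpace n M q) Y)
        (coframeChart q p.1 p) := fun Y hY =>
    (contDiffAt_chartField hpt (hY _)).differentiableAt hk0
  refine D.lieBracket_stdField (ξ := ξ) hk (hD.mem_frames hg hl hx hp) (hdiff Z hZ.1) (hdiff X hX.1)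
    ?_ hA ?_
  · refine Filter.Eventually.of_forall fun c hc => ?_
    exact hD.chartField_of_mem_frames hg hl (X := Z) (Q := fun c w => D.dY c.1 w.1 = 0 ∧
      w.2 = D.lift c.1 c.2 w.1)
      (fun p hp hx => (hD.mem_liftTangent_iff hg hl hx hp _).1 (hZF p hp)) hc
  · refine Filter.Eventually.of_forall fun c hc => ?_
    exact hD.chartField_of_mem_frames hg hl (X := X)
      (Q := fun c w => w = D.stdField (lorentzMap q) ξ A c)
      (fun p' hp' hx' => hX.2 p' hp' _ D hD hx') hc

end Foliation

end StandardFields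

/-! ### Completeness of the standard vector fields -/

namespace BundleLikeChart

variable {E V : Type*} [NormedAddCommGroup E] [NormedSpace ℝ E] [FiniteDimensional ℝ E]
  [NormedAddCommGroup V] [InnerProductSpace ℝ V] [FiniteDimensional ℝ V] {k : ℕ∞}
  {D : BundleLikeChart E V k} {η : V →L[ℝ] V} {x : E} {p : E →L[ℝ] V}

theorem dY_eq_zero_of_mem_frames (hη : ∀ v, η (η v) = v) (hmem : (x, p) ∈ D.frames η) {e : E}
    (he : p e = 0) : D.dY x e = 0 := by
  obtain ⟨a, -, hap, ha⟩ := D.exists_of_mem_frames hmem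
  rw [← hap] at he
  exact (frame_isInvertible hη ha).injective (he.trans (map_zero a).symm)

/-- The difference of the two sides is orthogonal to ker dY, and orthogonal to the vectors `raise`
since p kills it. These two kinds of vectors span E, so it is zero. -/
theorem eq_raise_of_orthogonal (hη : ∀ v, η (η v) = v) (hmem : (x, p) ∈ D.frames η) {v : E}
    (hv : ∀ e, D.dY x e = 0 → D.G x v e = 0) : v = raise (D.G x) p (η (p v)) := by
  have hx : x ∈ D.W := hmem.1
  have hpr := D.apply_raise_of_mem_frames hη hmem
  have hw : p (v - raise (D.G x) p (η (p v))) = 0 := by rw [map_sub, hpr, sub_self]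
  rw [← sub_eq_zero]
  apply (D.inv x hx).injective
  rw [map_zero]
  ext e
  have h1 : p (e - raise (D.G x) p (η (p e))) = 0 := by rw [map_sub, hpr, sub_self]
  have h2 : D.G x (v - raise (D.G x) p (η (p v))) (e - raise (D.G x) p (η (p e))) = 0 := by
    rw [map_sub (D.G x), _root_.sub_apply, hv _ (D.dY_eq_zero_of_mem_frames hη hmem h1),
      raise_spec (D.inv x hx), h1, inner_zero_right,
      sub_zero]
  have h3 : D.G x (v - raise (D.G x) p (η (p v))) (raise (D.G x) p (η (p e))) = 0 := by
    rw [D.symm x hx, raise_spec (D.inv x hx), hw, inner_zero_right]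
  rw [map_sub, h3, sub_zero] at h2
  exact h2

theorem G_raise_of_mem_frames (hmem : (x, p) ∈ D.frames η) (w : V) {e : E} (he : D.dY x e = 0) :
    D.G x (raise (D.G x) p w) e = 0 := by
  rw [raise_spec (D.inv x hmem.1), hmem.2.1 e he, inner_zero_right]

end BundleLikeChart

/-! ### Geodesics of M in a fixed chart -/

section ChartGeodesic

variable {n q : ℕ} {M : Type*} [TopologicalSpace M]
  [ChartedSpace (EuclideanSpace ℝ (Fin n)) M]
  [IsManifold (𝓡 n) ∞ M] {k : ℕ∞} {x₀ x : M}
  {F : Foliation n M q ((k : WithTop ℕ∞) + 2)}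
  {g : PseudoRiemannianMetric n M ((k : WithTop ℕ∞) + 1)}

/-- The derivative of a chart, on the model space. -/
noncomputable def chartDeriv (x₀ x : M) : EuclideanSpace ℝ (Fin n) →L[ℝ] EuclideanSpace ℝ (Fin n) :=
  mfderiv (𝓡 n) (𝓡 n) (extChartAt (𝓡 n) x₀) x

/-- The velocity of a curve, in the model space. -/
noncomputable def curveVelocity (n : ℕ) [ChartedSpace (EuclideanSpace ℝ (Fin n)) M] (γ : ℝ → M)
    (t : ℝ) : EuclideanSpace ℝ (Fin n) :=
  mfderiv 𝓘(ℝ, ℝ) (𝓡 n) γ t (1 : ℝ)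

theorem chartDeriv_isInvertible (hx : x ∈ (extChartAt (𝓡 n) x₀).source) :
    (chartDeriv (n := n) x₀ x).IsInvertible :=
  mfderiv_extChartAt_isInvertible hx

theorem hasDerivAt_extChartAt_comp {γ : ℝ → M} {t : ℝ} (hγ : MDifferentiableAt 𝓘(ℝ, ℝ) (𝓡 n) γ t)
    (hx : γ t ∈ (extChartAt (𝓡 n) x₀).source) :
    HasDerivAt (fun τ => extChartAt (𝓡 n) x₀ (γ τ)) (chartDeriv x₀ (γ t) (curveVelocity n γ t)) t := by
  have h := (mdifferentiableAt_extChartAt_of_mem (J := 𝓡 n) hx).hasMFDerivAt.comp t hγ.hasMFDerivAt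
  let A : ℝ →L[ℝ] EuclideanSpace ℝ (Fin n) := mfderiv 𝓘(ℝ, ℝ) (𝓡 n) γ t
  have h1 : HasFDerivAt (fun τ => extChartAt (𝓡 n) x₀ (γ τ)) ((chartDeriv x₀ (γ t)).comp A) t :=
    h.hasFDerivAt
  exact h1.hasDerivAt

theorem contDiffAt_extChartAt_comp {γ : ℝ → M} {t : ℝ} (hγ : ContMDiffAt 𝓘(ℝ, ℝ) (𝓡 n) 2 γ t)
    (hx : γ t ∈ (extChartAt (𝓡 n) x₀).source) :
    ContDiffAt ℝ 2 (fun τ => extChartAt (𝓡 n) x₀ (γ τ)) t := by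
  have h1 : ContMDiffAt (𝓡 n) (𝓡 n) 2 (extChartAt (𝓡 n) x₀) (γ t) :=
    (contMDiffOn_extChartAt (n := 2)).contMDiffAt ((chartAt _ x₀).open_source.mem_nhds
      (by rw [← extChartAt_source (𝓡 n)]; exact hx))
  exact (h1.comp t hγ).contDiffAt

theorem PseudoRiemannianMetric.differentiableAt_chartForm {z : EuclideanSpace ℝ (Fin n)}
    (hz : z ∈ (extChartAt (𝓡 n) x₀).target) : DifferentiableAt ℝ (g.chartForm x₀) z :=
  ((PseudoRiemannianMetric.contDiffOn_chartForm (m := k + 1) (by push_cast; rfl)).contDiffAt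
    ((isOpen_extChartAt_target x₀).mem_nhds hz)).differentiableAt (by simp)

theorem PseudoRiemannianMetric.IsGeodesic.eulerLagrange {γ : ℝ → M} (hγ : g.IsGeodesic γ) (t : ℝ)
    (w : EuclideanSpace ℝ (Fin n)) :
    eulerLagrange (g.chartForm (γ t)) (extChartAt (𝓡 n) (γ t) (γ t))
      (deriv (fun τ => extChartAt (𝓡 n) (γ t) (γ τ)) t)
      (deriv (deriv fun τ => extChartAt (𝓡 n) (γ t) (γ τ)) t) w = 0 := by
  have h := hγ.2 t w
  have hd := (PseudoRiemannianMetric.differentiableAt_chartForm (g := g)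
    (mem_extChartAt_target (I := 𝓡 n) (γ t))).hasFDerivAt
  have hf : ∀ u v e : EuclideanSpace ℝ (Fin n),
      fderiv ℝ (fun y => g.inChart (γ t) y u v) (extChartAt (𝓡 n) (γ t) (γ t)) e =
        fderiv ℝ (g.chartForm (γ t)) (extChartAt (𝓡 n) (γ t) (γ t)) e u v := by
    intro u v e
    have h1 : HasFDerivAt (fun y => g.inChart (γ t) y u v) _ (extChartAt (𝓡 n) (γ t) (γ t)) :=
      (hd.clm_apply (hasFDerivAt_const u _)).clm_apply (hasFDerivAt_const v _)
    rw [h1.fderiv]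
    simp
  simp only at h
  rw [hf, hf] at h
  exact h

/-- The definition gives the geodesic equation at time t only in the chart around γ t. Pullback by
the change of charts gives it in one fixed chart for all nearby times, as ODE uniqueness requires.
-/
theorem PseudoRiemannianMetric.IsGeodesic.eulerLagrange_chart {γ : ℝ → M} (hγ : g.IsGeodesic γ)
    {t : ℝ} (ht : γ t ∈ (extChartAt (𝓡 n) x₀).source) (w : EuclideanSpace ℝ (Fin n)) :
    _root_.eulerLagrange (g.chartForm x₀) (extChartAt (𝓡 n) x₀ (γ t))
      (deriv (fun τ => extChartAt (𝓡 n) x₀ (γ τ)) t)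
      (deriv (deriv fun τ => extChartAt (𝓡 n) x₀ (γ τ)) t) w = 0 := by
  set φ := extChartAt (𝓡 n) x₀ with hφ
  set φ' := extChartAt (𝓡 n) (γ t) with hφ'
  let ψ : EuclideanSpace ℝ (Fin n) → EuclideanSpace ℝ (Fin n) := φ' ∘ φ.symm
  have hzt := φ.map_source ht
  have hzx : φ.symm (φ (γ t)) = γ t := φ.left_inv ht
  have hψd : ∀ z ∈ φ.target, φ.symm z ∈ φ'.source → ContDiffAt ℝ 2 ψ z ∧
      ∀ u, fderiv ℝ ψ z u = mfderiv (𝓡 n) (𝓡 n) φ' (φ.symm z)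
        (mfderiv (𝓡 n) (𝓡 n) φ.symm z u) := by
    intro z hz hz'
    have h1 : ContMDiffAt (𝓡 n) (𝓡 n) 2 φ' (φ.symm z) :=
      (contMDiffOn_extChartAt (n := 2)).contMDiffAt ((chartAt _ (γ t)).open_source.mem_nhds
        (by rw [← extChartAt_source (𝓡 n)]; exact hz'))
    have h2 : ContMDiffAt (𝓡 n) (𝓡 n) 2 φ.symm z :=
      (contMDiffAt_extChartAt_symm_of_mem hz).of_le
        (show ((2 : ℕ∞) : WithTop ℕ∞) ≤ _ from WithTop.coe_le_coe.2 le_top)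
    refine ⟨(h1.comp z h2).contDiffAt, fun u => ?_⟩
    have h3 := (h1.mdifferentiableAt (by simp)).hasMFDerivAt.comp z
      (h2.mdifferentiableAt (by simp)).hasMFDerivAt
    exact congrArg (fun T : EuclideanSpace ℝ (Fin n) →L[ℝ] EuclideanSpace ℝ (Fin n) => T u)
      (fderiv_eq_of_hasMFDerivAt h3)
  have hsrc : φ.symm (φ (γ t)) ∈ φ'.source := by rw [hzx]; exact mem_extChartAt_source _
  have hψ := (hψd _ hzt hsrc).1
  have hψx : ψ (φ (γ t)) = φ' (γ t) := congrArg φ' hzx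
  have hnear : ∀ᶠ z in 𝓝 (φ (γ t)), z ∈ φ.target ∧ φ.symm z ∈ φ'.source := by
    filter_upwards [(isOpen_extChartAt_target (I := 𝓡 n) x₀).mem_nhds hzt,
      (continuousAt_extChartAt_symm' (I := 𝓡 n) ht).preimage_mem_nhds
        ((isOpen_extChartAt_source (I := 𝓡 n) (γ t)).mem_nhds hsrc)] with z h1 h2 using ⟨h1, h2⟩
  rw [eulerLagrange_pullback (G' := g.chartForm (γ t)) hψ
    (PseudoRiemannianMetric.differentiableAt_chartForm hzt) (by
      rw [hψx]
      exact PseudoRiemannianMetric.differentiableAt_chartForm (mem_extChartAt_target (γ t)))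
    (PseudoRiemannianMetric.chartForm_symm _) (by
      filter_upwards [hnear] with z hz u v
      rw [(hψd z hz.1 hz.2).2, (hψd z hz.1 hz.2).2]
      exact (PseudoRiemannianMetric.chartForm_mfderiv hz.2 _ _).symm)]
  -- the curve in the second chart is the image of the curve in the first one
  have hc2 : ContDiffAt ℝ 2 (fun τ => φ (γ τ)) t := contDiffAt_extChartAt_comp (hγ.1 t) ht
  have hγc : ∀ᶠ τ in 𝓝 t, γ τ ∈ φ.source :=
    hγ.1.continuous.continuousAt.preimage_mem_nhds ((isOpen_extChartAt_source x₀).mem_nhds ht)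
  have hcnear := hc2.continuousAt.eventually hnear
  have heq : (fun τ => φ' (γ τ)) =ᶠ[𝓝 t] fun τ => ψ (φ (γ τ)) := by
    filter_upwards [hγc] with τ hτ
    exact congrArg φ' (φ.left_inv hτ).symm
  have hcd : ∀ᶠ τ in 𝓝 t, HasDerivAt (fun τ => φ (γ τ)) (deriv (fun τ => φ (γ τ)) τ) τ := by
    filter_upwards [hc2.eventually (by simp)] with τ hτ
    exact (hτ.differentiableAt (by simp)).hasDerivAt
  have hd1 : deriv (fun τ => φ' (γ τ)) =ᶠ[𝓝 t]
      fun τ => fderiv ℝ ψ (φ (γ τ)) (deriv (fun τ => φ (γ τ)) τ) := by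
    filter_upwards [heq.deriv, hcd, hcnear] with τ h1 h2 h3
    rw [h1]
    exact (((hψd _ h3.1 h3.2).1.differentiableAt (by simp)).hasFDerivAt.comp_hasDerivAt τ h2).deriv
  have hd2 : HasDerivAt (deriv fun τ => φ (γ τ)) (deriv (deriv fun τ => φ (γ τ)) t) t := by
    have h1 : ContDiffAt ℝ 1 (fderiv ℝ (fun τ => φ (γ τ))) t :=
      hc2.fderiv_right (m := 1) (by norm_num)
    have h2 : ContDiffAt ℝ 1 (deriv (fun τ => φ (γ τ))) t := h1.clm_apply contDiffAt_const
    exact (h2.differentiableAt (by simp)).hasDerivAt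
  have hψ2 : HasFDerivAt (fderiv ℝ ψ) (fderiv ℝ (fderiv ℝ ψ) (φ (γ t))) (φ (γ t)) :=
    ((hψ.fderiv_right (m := 1) (by norm_num)).differentiableAt (by simp)).hasFDerivAt
  have h5 : HasDerivAt (fun τ => fderiv ℝ ψ (φ (γ τ)))
      (fderiv ℝ (fderiv ℝ ψ) (φ (γ t)) (deriv (fun τ => φ (γ τ)) t)) t :=
    hψ2.comp_hasDerivAt t hcd.self_of_nhds
  have h6 := (h5.clm_apply hd2).deriv
  have h7 := hγ.eulerLagrange t (fderiv ℝ ψ (φ (γ t)) w)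
  rw [hd1.deriv_eq, h6, hd1.self_of_nhds, ← hψx,
    add_comm (fderiv ℝ (fderiv ℝ ψ) _ _ _)] at h7
  exact h7

end ChartGeodesic

/-! ### Lifts of geodesics and global flows of the standard fields -/

section Completeness

variable {n q : ℕ} {M : Type*} [TopologicalSpace M]
  [ChartedSpace (EuclideanSpace ℝ (Fin n)) M]
  [IsManifold (𝓡 n) ∞ M] {k : ℕ∞} {x₀ : M}
  {F : Foliation n M q ((k : WithTop ℕ∞) + 2)}
  {g : PseudoRiemannianMetric n M ((k : WithTop ℕ∞) + 1)}

namespace Foliation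

theorem exists_mem_lorentzFrameBundle (hl : F.IsTransverselyLorentzian g) (x : M) :
    ∃ p ∈ F.lorentzFrameBundle g, p.1 = x := by
  obtain ⟨z, hz⟩ := hl.2 x
  let l : EuclideanSpace ℝ (Fin n) →ₗ[ℝ] EuclideanSpace ℝ (Fin q) :=
    z.symm.toLinearMap ∘ₗ (F.tangent x).mkQ
  let L : EuclideanSpace ℝ (Fin n) →L[ℝ] EuclideanSpace ℝ (Fin q) :=
    LinearMap.toContinuousLinearMap l
  exact ⟨⟨x, L⟩, ⟨z, hz, fun u => rfl⟩, rfl⟩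

variable {D : BundleLikeChart (EuclideanSpace ℝ (Fin n)) (EuclideanSpace ℝ (Fin q)) k}
  {p : CoframeSpace n M q}

variable (g) in
/-- The vector orthogonal to the foliation with given coordinates in a frame. -/
noncomputable def horizontalVector (p : CoframeSpace n M q) (v : EuclideanSpace ℝ (Fin q)) :
    EuclideanSpace ℝ (Fin n) :=
  raise (g.form p.1) (p.2 : EuclideanSpace ℝ (Fin n) →L[ℝ] EuclideanSpace ℝ (Fin q))
    (lorentzMap q v)

theorem IsAdaptedChart.chartDeriv_horizontalVector (hD : F.IsAdaptedChart g x₀ D)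
    (hx : InChart x₀ D p.1) (v : EuclideanSpace ℝ (Fin q)) :
    chartDeriv x₀ p.1 (horizontalVector g p v) =
      raise (D.G (coframeChart q x₀ p).1) (coframeChart q x₀ p).2 (lorentzMap q v) := by
  let P : EuclideanSpace ℝ (Fin n) →L[ℝ] EuclideanSpace ℝ (Fin q) := p.2
  have hPL : P = (coframeChart q x₀ p).2.comp (chartDeriv x₀ p.1) := by
    rw [coframeChart_apply hx.1]
    refine ContinuousLinearMap.ext fun e => ?_
    exact (congrArg P (mfderiv_symm_extChartAt_apply hx.1 e)).symm
  have := raise_congr (D.inv _ hx.2) (PseudoRiemannianMetric.form_isInvertible (g := g) p.1)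
    (chartDeriv x₀ p.1) (chartDeriv_isInvertible hx.1)
    (fun u v => by
      rw [hD.form _ hx.2]
      exact (PseudoRiemannianMetric.chartForm_mfderiv hx.1 u v).symm)
    (coframeChart q x₀ p).2 (lorentzMap q v)
  rw [← hPL] at this
  refine this.trans ?_
  rw [coframeChart_fst hx]

theorem horizontalVector_mem_orthogonal (hg : g.IsBundleLike F) (hl : F.IsTransverselyLorentzian g)
    (hp : p ∈ F.lorentzFrameBundle g) (v : EuclideanSpace ℝ (Fin q)) :
    horizontalVector g p v ∈ g.orthogonal F p.1 := by
  intro u hu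
  refine (g.symm _ _ _).trans ?_
  refine (raise_spec (PseudoRiemannianMetric.form_isInvertible p.1) _ _ _).trans ?_
  exact (congrArg (inner ℝ (lorentzMap q v)) (((mem_lorentzFrameBundle_iff hg hl p).1 hp).1 u hu)).trans
    (inner_zero_right _)

/-- Local horizontal lifts of a geodesic to the frame bundle. -/
theorem IsAdaptedChart.exists_lift (hk : 1 ≤ k) (hD : F.IsAdaptedChart g x₀ D)
    (hg : g.IsBundleLike F) (hl : F.IsTransverselyLorentzian g) {γ : ℝ → M} (hγ : g.IsGeodesic γ)
    {T : ℝ} (hx : InChart x₀ D (γ T)) (ξ : EuclideanSpace ℝ (Fin q)) :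
    ∃ ε > 0, ∀ t₁ ∈ Ioo (T - ε) (T + ε), ∀ p ∈ F.lorentzFrameBundle g, p.1 = γ t₁ →
      horizontalVector g p ξ = curveVelocity n γ t₁ →
      ∃ b : ℝ → EuclideanSpace ℝ (Fin n) →L[ℝ] EuclideanSpace ℝ (Fin q),
        (extChartAt (𝓡 n) x₀ (γ t₁), b t₁) = coframeChart q x₀ p ∧
        ∀ t ∈ Ioo (T - ε) (T + ε), InChart x₀ D (γ t) ∧
          (extChartAt (𝓡 n) x₀ (γ t), b t) ∈ D.frames (lorentzMap q) ∧
          chartDeriv x₀ (γ t) (curveVelocity n γ t) =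
            raise (D.G (extChartAt (𝓡 n) x₀ (γ t))) (b t) (lorentzMap q ξ) ∧
          HasDerivAt (fun t => (extChartAt (𝓡 n) x₀ (γ t), b t))
            (D.stdField (lorentzMap q) ξ 0 (extChartAt (𝓡 n) x₀ (γ t), b t)) t := by
  set φ := extChartAt (𝓡 n) x₀ with hφ
  let c : ℝ → EuclideanSpace ℝ (Fin n) := fun t => φ (γ t)
  have hin : ∀ᶠ t in 𝓝 T, InChart x₀ D (γ t) :=
    hγ.1.continuous.continuousAt.eventually hx.eventually
  have hc2 : ∀ t, InChart x₀ D (γ t) → ContDiffAt ℝ 2 c t := fun t ht =>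
    contDiffAt_extChartAt_comp (hγ.1 t) ht.1
  have hv : ∀ t, InChart x₀ D (γ t) →
      HasDerivAt c (chartDeriv x₀ (γ t) (curveVelocity n γ t)) t := fun t ht =>
    hasDerivAt_extChartAt_comp ((hγ.1 t).mdifferentiableAt (by simp)) ht.1
  have hd2 : ∀ t, InChart x₀ D (γ t) → HasDerivAt (deriv c) (deriv (deriv c) t) t := by
    intro t ht
    have h1 : ContDiffAt ℝ 1 (fderiv ℝ c) t := (hc2 t ht).fderiv_right (m := 1) (by norm_num)
    have h2 : ContDiffAt ℝ 1 (deriv c) t := h1.clm_apply contDiffAt_const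
    exact (h2.differentiableAt (by simp)).hasDerivAt
  have hEL : ∀ᶠ t in 𝓝 T, HasDerivAt c (deriv c t) t ∧ HasDerivAt (deriv c) (deriv (deriv c) t) t ∧
      ∀ w, eulerLagrange D.G (c t) (deriv c t) (deriv (deriv c) t) w = 0 := by
    filter_upwards [hin] with t ht
    refine ⟨(hv t ht).differentiableAt.hasDerivAt, hd2 t ht, fun w => ?_⟩
    have h1 := hγ.eulerLagrange_chart ht.1 w
    have h2 : D.G =ᶠ[𝓝 (c t)] g.chartForm x₀ := by
      filter_upwards [D.isOpen.mem_nhds ht.2] with z hz using hD.form z hz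
    rw [eulerLagrange, h2.fderiv_eq, h2.self_of_nhds]
    exact h1
  have hframe : ∀ t p, InChart x₀ D (γ t) → p ∈ F.lorentzFrameBundle g → p.1 = γ t →
      horizontalVector g p ξ = curveVelocity n γ t →
      (c t, (coframeChart q x₀ p).2) ∈ D.frames (lorentzMap q) ∧
      (c t, (coframeChart q x₀ p).2) = coframeChart q x₀ p ∧
      deriv c t = raise (D.G (c t)) (coframeChart q x₀ p).2 (lorentzMap q ξ) := by
    intro t p ht hp hpt hvel
    have hxp : InChart x₀ D p.1 := by rwa [hpt]
    have h1 : (coframeChart q x₀ p).1 = c t := by rw [coframeChart_fst hxp, hpt]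
    have h2 : (c t, (coframeChart q x₀ p).2) = coframeChart q x₀ p := by rw [← h1]
    refine ⟨by rw [h2]; exact hD.mem_frames hg hl hxp hp, h2, ?_⟩
    rw [(hv t ht).deriv, ← hvel, ← hpt, hD.chartDeriv_horizontalVector hxp, h1]
  -- It is not assumed that γ is orthogonal to the foliation at time T. If it is, local lifts exist;
  -- if not, it is not orthogonal at nearby times either, and no frame there satisfies the initial
  -- condition.
  by_cases hort : ∀ e, D.dY (c T) e = 0 → D.G (c T) (deriv c T) e = 0
  · obtain ⟨p₀, hp₀, hp₀T⟩ := exists_mem_lorentzFrameBundle hl (γ T)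
    have hxp : InChart x₀ D p₀.1 := by rwa [hp₀T]
    have hfr := hD.mem_frames hg hl hxp hp₀
    have h1 : coframeChart q x₀ p₀ = (c T, (coframeChart q x₀ p₀).2) := by
      refine Prod.ext ?_ rfl
      rw [coframeChart_fst hxp, hp₀T]
    rw [h1] at hfr
    obtain ⟨ε, hε, h⟩ := D.exists_horizontal_lift hk lorentzMap_lorentzMap hEL hfr
      (D.eq_raise_of_orthogonal lorentzMap_lorentzMap hfr hort)
    obtain ⟨δ, hδ, hball⟩ := Metric.eventually_nhds_iff_ball.1 hin
    have hsub : ∀ t ∈ Ioo (T - min ε δ) (T + min ε δ), t ∈ Ioo (T - ε) (T + ε) ∧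
        InChart x₀ D (γ t) := by
      intro t ht
      have hl1 := min_le_left ε δ
      have hl2 := min_le_right ε δ
      refine ⟨⟨by linarith [ht.1], by linarith [ht.2]⟩, hball t ?_⟩
      rw [Real.ball_eq_Ioo]
      exact ⟨by linarith [ht.1], by linarith [ht.2]⟩
    refine ⟨min ε δ, lt_min hε hδ, fun t₁ ht₁ p hp hpt hvel => ?_⟩
    obtain ⟨ht₁ε, ht₁x⟩ := hsub t₁ ht₁
    obtain ⟨hf, hf', hr⟩ := hframe t₁ p ht₁x hp hpt hvel
    obtain ⟨b, hb, hb'⟩ := h t₁ ht₁ε _ hf ξ hr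
    refine ⟨b, by rw [hb]; exact hf', fun t ht => ?_⟩
    obtain ⟨htε, htx⟩ := hsub t ht
    obtain ⟨h3, h4, h5⟩ := hb' t htε
    rw [(hv t htx).deriv] at h4
    exact ⟨htx, h3, h4, h5⟩
  · push Not at hort
    obtain ⟨e, he, hne⟩ := hort
    have hcT : c T ∈ D.W := hx.2
    have hcc : ContinuousAt c T := (hv T hx).continuousAt
    -- The vector e - s(dY e) extends the leaf direction e at c T to a continuous family of leaf
    -- directions along the curve.
    have hcont : ContinuousAt (fun t => D.G (c t) (deriv c t)
        (e - D.s (c t) (D.dY (c t) e))) T := by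
      have hG : ContinuousAt (fun t => D.G (c t)) T :=
        ContinuousAt.comp (g := D.G)
          (D.contDiffOn_G.continuousOn.continuousAt (D.isOpen.mem_nhds hcT)) hcc
      have hs : ContinuousAt (fun t => D.s (c t)) T :=
        ContinuousAt.comp (g := D.s)
          (D.contDiffOn_s.continuousOn.continuousAt (D.isOpen.mem_nhds hcT)) hcc
      have hdY : ContinuousAt (fun t => D.dY (c t)) T :=
        ContinuousAt.comp (g := D.dY)
          (D.contDiffOn_dY.continuousOn.continuousAt (D.isOpen.mem_nhds hcT)) hcc
      have hvc : ContinuousAt (deriv c) T := (hd2 T hx).continuousAt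
      exact (hG.clm_apply hvc).clm_apply
        (continuousAt_const.sub (hs.clm_apply (hdY.clm_apply continuousAt_const)))
    have hne' : D.G (c T) (deriv c T) (e - D.s (c T) (D.dY (c T) e)) ≠ 0 := by
      rwa [he, map_zero, sub_zero]
    obtain ⟨ε, hε, hball⟩ := Metric.eventually_nhds_iff_ball.1 ((hcont.eventually_ne hne').and hin)
    refine ⟨ε, hε, fun t₁ ht₁ p hp hpt hvel => ?_⟩
    rw [← Real.ball_eq_Ioo] at ht₁
    obtain ⟨h1, h2⟩ := hball t₁ ht₁
    obtain ⟨hf, -, hr⟩ := hframe t₁ p h2 hp hpt hvel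
    refine absurd ?_ h1
    rw [hr]
    refine D.G_raise_of_mem_frames hf _ ?_
    rw [map_sub, D.dY_s h2.2, sub_self]

variable {ξ : EuclideanSpace ℝ (Fin q)}
  {A : EuclideanSpace ℝ (Fin q) →L[ℝ] EuclideanSpace ℝ (Fin q)}
  {X : ∀ p : CoframeSpace n M q, TangentSpace (coframeModel n q) p}

theorem IsStandardField.chartField_eq {x₀ : M} [T2Space M] [SecondCountableTopology M]
    (hX : F.IsStandardField g ξ A X) (hD : F.IsAdaptedChart g x₀ D)
    (hg : g.IsBundleLike F) (hl : F.IsTransverselyLorentzian g)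
    {c : EuclideanSpace ℝ (Fin n) × (EuclideanSpace ℝ (Fin n) →L[ℝ] EuclideanSpace ℝ (Fin q))}
    (hc : c ∈ D.frames (lorentzMap q)) :
    chartField (coframeModel n q) (⟨x₀, 0⟩ : CoframeSpace n M q) X c =
      D.stdField (lorentzMap q) ξ A c :=
  hD.chartField_of_mem_frames hg hl (X := X)
      (Q := fun c w => w = D.stdField (lorentzMap q) ξ A c)
      (fun p' hp' hx' => hX.2 p' hp' _ D hD hx') hc

/-- The integral curve exp(tA) p stays in one fibre, so a single chart contains it for all times. -/
theorem IsStandardField.isCompleteField_vertical [T2Space M] [SecondCountableTopology M]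
    (hg : g.IsBundleLike F) (hl : F.IsTransverselyLorentzian g)
    (hA : A.comp (lorentzMap q) + (lorentzMap q).comp A.adjoint = 0)
    (hX : F.IsStandardField g 0 A X) :
    IsCompleteField (coframeModel n q) (F.lorentzFrameBundle g) X := by
  intro p hp
  obtain ⟨D, hD, hW⟩ := F.exists_isAdaptedChart g hg p.1
  have hx : InChart p.1 D p.1 := ⟨mem_extChartAt_source _, hW⟩
  have hfr := hD.mem_frames hg hl hx hp
  set c₀ := coframeChart q p.1 p with hc₀
  let ex : ℝ → EuclideanSpace ℝ (Fin q) →L[ℝ] EuclideanSpace ℝ (Fin q) :=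
    fun t => NormedSpace.exp (t • A)
  have hex : ∀ t, HasDerivAt ex (A * ex t) t := fun t => hasDerivAt_exp_smul_const' A t
  have hex0 : ex 0 = 1 := by simp [ex]
  have hframes : ∀ t, (c₀.1, (ex t).comp c₀.2) ∈ D.frames (lorentzMap q) := fun t =>
    BundleLikeChart.comp_mem_frames hfr (BundleLikeChart.exp_smul_comp_comp_adjoint hA t)
  have htarget : ∀ t, (c₀.1, (ex t).comp c₀.2) ∈ (coframeChart q p.1).target := fun t =>
    mem_coframeChart_target.2 (hD.subset_target (hframes t).1)
  refine ⟨fun t => (coframeChart q p.1).symm (c₀.1, (ex t).comp c₀.2), ?_, fun t => ?_, ?_⟩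
  · simp only [hex0]
    exact (coframeChart q p.1).left_inv (mem_coframeChart_source.2 hx.1)
  · exact (hD.symm_mem_lorentzFrameBundle_iff hg hl (hframes t).1).2 (hframes t)
  · rw [isMIntegralCurve_iff_isMIntegralCurveOn]
    refine isMIntegralCurveOn_extChartAt_symm (fun t _ => htarget t) fun t _ => ?_
    rw [hX.chartField_eq hD hg hl (hframes t), BundleLikeChart.stdField]
    refine ((hasDerivAt_const t c₀.1).prodMk ((hex t).clm_comp (hasDerivAt_const t c₀.2))).congr_deriv
      ?_
    rw [map_zero, map_zero, map_zero, zero_add]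
    refine Prod.ext rfl ?_
    rw [ContinuousLinearMap.comp_zero, add_zero]
    rfl

/-- The integral curve is the horizontal lift of the geodesic whose initial velocity is the ξ-vector
of p, complete by hypothesis. -/
theorem IsStandardField.isCompleteField_horizontal [T2Space M] [SecondCountableTopology M]
    (hk : 1 ≤ k) (hg : g.IsBundleLike F) (hl : F.IsTransverselyLorentzian g)
    (hc : g.IsOrthogonallyComplete F) (hX : F.IsStandardField g ξ 0 X) :
    IsCompleteField (coframeModel n q) (F.lorentzFrameBundle g) X := by
  intro p hp
  obtain ⟨γ, hγ, hγ0⟩ := hc p.1 _ (horizontalVector_mem_orthogonal hg hl hp ξ)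
  have h0 : ∀ x (v : TangentSpace (𝓡 n) x), (⟨γ 0, mfderiv 𝓘(ℝ, ℝ) (𝓡 n) γ 0 (1 : ℝ)⟩ :
      TangentBundle (𝓡 n) M) = ⟨x, v⟩ → x = γ 0 ∧
      (v : EuclideanSpace ℝ (Fin n)) = curveVelocity n γ 0 := by
    rintro x v h
    cases h
    exact ⟨rfl, rfl⟩
  obtain ⟨hp0, hv0⟩ := h0 _ _ hγ0
  -- At time t only frames over γ t whose ξ-vector is the velocity of γ are admitted; for them the
  -- length of the local lifts depends only on T.
  let Q : ℝ → CoframeSpace n M q → Prop := fun t p => p ∈ F.lorentzFrameBundle g ∧ p.1 = γ t ∧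
    horizontalVector g p ξ = curveVelocity n γ t
  have hX1 : ContMDiff (coframeModel n q) (coframeModel n q).tangent 1
      (fun p => (⟨p, X p⟩ : TangentBundle (coframeModel n q) (CoframeSpace n M q))) :=
    hX.1.of_le (by exact_mod_cast hk)
  obtain ⟨c, hc0, hcX, hcQ⟩ := exists_isMIntegralCurve_of_local hX1 (Q := Q) (p := p) (fun T => by
    obtain ⟨D, hD, hW⟩ := F.exists_isAdaptedChart g hg (γ T)
    obtain ⟨ε, hε, h⟩ := hD.exists_lift hk hg hl hγ ⟨mem_extChartAt_source _, hW⟩ ξ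
    refine ⟨ε, hε, fun t₁ ht₁ p₁ hQ => ?_⟩
    obtain ⟨b, hb, hb'⟩ := h t₁ ht₁ p₁ hQ.1 hQ.2.1 hQ.2.2
    have hp₁s : p₁ ∈ (coframeChart q (γ T)).source := by
      rw [mem_coframeChart_source, hQ.2.1]
      exact (hb' t₁ ht₁).1.1
    refine ⟨fun t => (coframeChart q (γ T)).symm (extChartAt (𝓡 n) (γ T) (γ t), b t), ?_, ?_,
      fun t ht => ?_⟩
    · simp only [hb]
      exact (coframeChart q (γ T)).left_inv hp₁s
    · refine isMIntegralCurveOn_extChartAt_symm (fun t ht =>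
        mem_coframeChart_target.2 (hD.subset_target (hb' t ht).1.2)) fun t ht => ?_
      obtain ⟨-, h2, -, h4⟩ := hb' t ht
      rw [hX.chartField_eq hD hg hl h2]
      exact h4
    · obtain ⟨h1, h2, h3, -⟩ := hb' t ht
      have htt := hD.subset_target h1.2
      have hproj : ((coframeChart q (γ T)).symm (extChartAt (𝓡 n) (γ T) (γ t), b t)).1 = γ t := by
        rw [coframeChart_symm_proj htt]
        exact (extChartAt (𝓡 n) (γ T)).left_inv h1.1
      refine ⟨(hD.symm_mem_lorentzFrameBundle_iff hg hl h1.2).2 h2, hproj, ?_⟩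
      apply (chartDeriv_isInvertible h1.1).injective
      rw [h3, ← hproj, hD.chartDeriv_horizontalVector (by rw [hproj]; exact h1),
        (coframeChart q (γ T)).right_inv (mem_coframeChart_target.2 htt), hproj])
    ⟨hp, hp0, hv0⟩
  exact ⟨c, hc0, fun t => (hcQ t).1, hcX⟩

end Foliation

end Completeness

/-! ### The transverse parallelism -/

section Parallelism

variable {E V : Type*} [NormedAddCommGroup E] [NormedSpace ℝ E] [FiniteDimensional ℝ E]
  [NormedAddCommGroup V] [InnerProductSpace ℝ V] [FiniteDimensional ℝ V] {k : ℕ∞}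
  {D : BundleLikeChart E V k} {η : V →L[ℝ] V} {x : E} {p : E →L[ℝ] V}

/-- The Lie algebra of the isometries of a scalar product. -/
def skewMaps (η : V →L[ℝ] V) : Submodule ℝ (V →L[ℝ] V) where
  carrier := {A | A.comp η + η.comp A.adjoint = 0}
  zero_mem' := by
    ext v
    simp
  add_mem' := by
    intro A B hA hB
    rw [mem_ofPred_eq] at hA hB ⊢
    rw [map_add, ContinuousLinearMap.add_comp, ContinuousLinearMap.comp_add,
      add_add_add_comm, hA, hB, add_zero]
  smul_mem' := by
    intro a A hA
    rw [mem_ofPred_eq] at hA ⊢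
    rw [map_smulₛₗ, ContinuousLinearMap.smul_comp, ContinuousLinearMap.comp_smul]
    simp only [conj_trivial]
    rw [← smul_add, hA, smul_zero]

namespace BundleLikeChart

variable (D η) in
/-- The standard vectors at a frame. -/
noncomputable def stdMap (c : E × (E →L[ℝ] V)) :
    V × skewMaps η →ₗ[ℝ] E × (E →L[ℝ] V) where
  toFun a := D.stdField η a.1 a.2 c
  map_add' a b := by
    simp only [stdField, Prod.fst_add, Prod.snd_add, map_add, Submodule.coe_add,
      ContinuousLinearMap.add_comp, Prod.mk_add_mk]
    rw [add_add_add_comm]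
  map_smul' r a := by
    simp only [stdField, Prod.smul_fst, Prod.smul_snd, map_smul, Submodule.coe_smul,
      ContinuousLinearMap.smul_comp, Prod.smul_mk, smul_add, RingHom.id_apply]

/-- Applying p to the base component recovers ξ, which vanishes on leaf directions. What remains is
A p = 0, and p is onto. -/
theorem stdMap_eq_zero (hη : ∀ v, η (η v) = v) (hmem : (x, p) ∈ D.frames η) {a : V × skewMaps η}
    (h1 : D.dY x (D.stdMap η (x, p) a).1 = 0)
    (h2 : (D.stdMap η (x, p) a).2 = D.lift x p (D.stdMap η (x, p) a).1) : a = 0 := by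
  have hpr := D.apply_raise_of_mem_frames hη hmem
  have ha1 : a.1 = 0 := (hpr a.1).symm.trans (hmem.2.1 _ h1)
  have h3 : (a.2 : V →L[ℝ] V).comp p = 0 := by
    have h4 : D.lift x p (D.stdMap η (x, p) a).1 + (a.2 : V →L[ℝ] V).comp p =
      D.lift x p (D.stdMap η (x, p) a).1 := h2
    rwa [add_eq_left] at h4
  refine Prod.ext ha1 (Subtype.ext (ContinuousLinearMap.ext fun v => ?_))
  rw [← hpr v]
  exact congrArg (fun T : E →L[ℝ] V => T (raise (D.G x) p (η v))) h3

theorem stdMap_add_mem_frameTangent (a : V × skewMaps η) {v : E × (E →L[ℝ] V)}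
    (hv : v.2 = D.lift x p v.1) : v + D.stdMap η (x, p) a ∈ D.frameTangent η x p := by
  refine ⟨a.2, a.2.2, ?_⟩
  rw [Prod.snd_add, Prod.fst_add, map_add, hv, add_assoc]
  rfl

/-- The witness pairs the canonical form p(`v.1`) with the connection form A of v; subtracting the
corresponding standard vector leaves a leafwise horizontal vector. -/
theorem exists_stdMap_sub (hη : ∀ v, η (η v) = v) (hmem : (x, p) ∈ D.frames η)
    {v : E × (E →L[ℝ] V)} (hv : v ∈ D.frameTangent η x p) : ∃ a : V × skewMaps η,
      D.dY x (v - D.stdMap η (x, p) a).1 = 0 ∧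
      (v - D.stdMap η (x, p) a).2 = D.lift x p (v - D.stdMap η (x, p) a).1 := by
  obtain ⟨A, hA, h⟩ := hv
  refine ⟨(p v.1, ⟨A, hA⟩), ?_, ?_⟩
  · refine D.dY_eq_zero_of_mem_frames hη hmem ?_
    rw [Prod.fst_sub, map_sub, sub_eq_zero]
    exact (D.apply_raise_of_mem_frames hη hmem _).symm
  · rw [Prod.snd_sub, Prod.fst_sub, map_sub, h]
    change _ - (D.lift x p _ + A.comp p) = _
    rw [add_sub_add_right_eq_sub]
    rfl

end BundleLikeChart

end Parallelism

/-! ### The standard fields span a complement of the lifted foliation -/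

section TransverseParallelism

variable {n q : ℕ} {M : Type*} [TopologicalSpace M]
  [ChartedSpace (EuclideanSpace ℝ (Fin n)) M] [IsManifold (𝓡 n) ∞ M] {k : ℕ∞}
  {F : Foliation n M q ((k : WithTop ℕ∞) + 2)}
  {g : PseudoRiemannianMetric n M ((k : WithTop ℕ∞) + 1)}

namespace Foliation

/-- In a chart, evaluating standard fields at p is a linear map on ℝ^q × so(1,q-1). Only zero is
sent into the tangent space of the lifted foliation, and every tangent vector of the frame bundle
differs from a value by a leafwise one. -/
theorem spansComplement_of_isStandardField [T2Space M] [SecondCountableTopology M]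
    (hk : 1 ≤ k) (hg : g.IsBundleLike F)
    (hl : F.IsTransverselyLorentzian g) {ι : Type*}
    (b : Module.Basis ι ℝ (EuclideanSpace ℝ (Fin q) × skewMaps (lorentzMap q)))
    {X : ι → ∀ p : CoframeSpace n M q, TangentSpace (coframeModel n q) p}
    (hX : ∀ i, F.IsStandardField g (b i).1 (b i).2 (X i)) {p : CoframeSpace n M q}
    (hp : p ∈ F.lorentzFrameBundle g) :
    LinearIndependent ℝ (fun i => X i p) ∧
      SpansComplement (coframeModel n q) (F.lorentzFrameBundle g) F.liftTangent p
        (range fun i => X i p) := by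
  obtain ⟨D, hD, hW⟩ := F.exists_isAdaptedChart g hg p.1
  have hx : InChart p.1 D p.1 := ⟨mem_extChartAt_source _, hW⟩
  have hfr := hD.mem_frames hg hl hx hp
  let e := LinearEquiv.ofBijective (coframeDeriv p.1 p).toLinearMap (coframeDeriv_bijective hx.1)
  have he : ∀ v, e v = coframeDeriv p.1 p v := fun v => rfl
  let S := D.stdMap (lorentzMap q) (coframeChart q p.1 p)
  let Θ := e.symm.toLinearMap ∘ₗ S
  have heΘ : ∀ a, coframeDeriv p.1 p (Θ a) = S a := fun a => e.apply_symm_apply (S a)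
  have hXΘ : (fun i => X i p) = Θ ∘ b := by
    funext i
    exact e.injective (((hX i).2 p hp p.1 D hD hx).trans (heΘ (b i)).symm)
  have hspan : Submodule.span ℝ (range fun i => X i p) = LinearMap.range Θ := by
    rw [hXΘ, range_comp, ← Submodule.map_span, b.span_eq, Submodule.map_top]
  have hD' := fun v => hD.mem_liftTangent_iff hg hl hx hp v
  have hzero : ∀ a, Θ a ∈ F.liftTangent p → a = 0 := by
    intro a ha
    rw [hD', heΘ] at ha
    exact D.stdMap_eq_zero lorentzMap_lorentzMap hfr ha.1 ha.2
  refine ⟨?_, ?_, ?_⟩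
  · rw [hXΘ]
    refine b.linearIndependent.map' Θ (LinearMap.ker_eq_bot'.2 fun a ha => hzero a ?_)
    rw [ha]
    exact Submodule.zero_mem _
  · rw [hspan, eq_bot_iff]
    rintro v ⟨h1, a, rfl⟩
    rw [hzero a h1, map_zero]
    exact Submodule.zero_mem _
  · rw [hspan]
    ext v
    rw [SetLike.mem_coe, Submodule.mem_sup, hD.mem_submanifoldTangent_iff hk hg hl hx hp]
    change _ ↔ coframeDeriv p.1 p v ∈ _
    constructor
    · rintro ⟨u, hu, _, ⟨a, rfl⟩, rfl⟩
      rw [map_add, heΘ]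
      exact D.stdMap_add_mem_frameTangent a ((hD' u).1 hu).2
    · intro hv
      obtain ⟨a, h1, h2⟩ := D.exists_stdMap_sub lorentzMap_lorentzMap hfr hv
      refine ⟨v - Θ a, (hD' _).2 ?_, Θ a, ⟨a, rfl⟩, sub_add_cancel _ _⟩
      rw [map_sub, heΘ]
      exact ⟨h1, h2⟩

end Foliation

end TransverseParallelism

theorem proposition2p1 (n q : ℕ) (M : Type*) [TopologicalSpace M] [T2Space M]
    [SecondCountableTopology M] [ChartedSpace (EuclideanSpace ℝ (Fin n)) M]
    [IsManifold (𝓡 n) ∞ M] (k : ℕ∞) (hk : 1 ≤ k)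
    (F : Foliation n M q ((k : WithTop ℕ∞) + 2))
    (g : PseudoRiemannianMetric n M ((k : WithTop ℕ∞) + 1))
    (hbundle : g.IsBundleLike F) (hlorentz : F.IsTransverselyLorentzian g)
    (hcomplete : g.IsOrthogonallyComplete F) :
    F.IsTransverselyComplete k g := by
  -- A product basis makes each field purely horizontal or purely vertical; completeness is
  -- established only in these two cases.
  let b := (Module.finBasis ℝ (EuclideanSpace ℝ (Fin q))).prod
    (Module.finBasis ℝ (skewMaps (lorentzMap q)))
  choose X hX using fun i => Foliation.exists_isStandardField hbundle hlorentz (b i).1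
    ((b i).2 : EuclideanSpace ℝ (Fin q) →L[ℝ] EuclideanSpace ℝ (Fin q))
  have hbasic : ∀ i, IsBasicField (Foliation.coframeModel n q) k (F.lorentzFrameBundle g)
      F.liftTangent (X i) := fun i => (hX i).isBasicField hk hbundle hlorentz (b i).2.2
  have hcomp : ∀ i, IsCompleteField (Foliation.coframeModel n q) (F.lorentzFrameBundle g)
      (X i) := by
    rintro (i | j)
    · have h := hX (Sum.inl i)
      have h2 : ((b (Sum.inl i)).2 : EuclideanSpace ℝ (Fin q) →L[ℝ] EuclideanSpace ℝ (Fin q)) = 0 :=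
        congrArg Subtype.val (Module.Basis.prod_apply_inl_snd _ _ i)
      rw [h2] at h
      exact h.isCompleteField_horizontal hk hbundle hlorentz hcomplete
    · have h := hX (Sum.inr j)
      have h1 : (b (Sum.inr j)).1 = 0 := Module.Basis.prod_apply_inr_fst _ _ j
      rw [h1] at h
      exact h.isCompleteField_vertical hbundle hlorentz (b (Sum.inr j)).2.2
  refine ⟨⟨_, fun i => X (finSumFinEquiv.symm i), fun i => hbasic _, fun p hp => ?_⟩,
    fun p hp => ⟨range fun i => X i p, ?_, ?_⟩⟩
  · obtain ⟨h1, h2⟩ := Foliation.spansComplement_of_isStandardField hk hbundle hlorentz b hX hp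
    refine ⟨h1.comp _ finSumFinEquiv.symm.injective, ?_⟩
    have h3 : (range fun i => X (finSumFinEquiv.symm i) p) = range fun i => X i p :=
      finSumFinEquiv.symm.surjective.range_comp fun i => X i p
    rw [h3]
    exact h2
  · rintro _ ⟨i, rfl⟩
    exact ⟨X i, hbasic i, hcomp i, rfl⟩
  · exact (Foliation.spansComplement_of_isStandardField hk hbundle hlorentz b hX hp).2
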